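/- **Setting.** Let $\mathfrak g$ be a simply-laced simple complex Lie algebra with Cartan subalgebra $\mathfrak h$, Chevalley generators $e_i,\alpha_i^\vee,f_i$ ($i\in I$), Cartan matrix $C$, and dual Coxeter number $h^\vee$. Put $f=\sum_i f_i$ and let $\rho^\vee\in\mathfrak h$ be the element with $\alpha_i(\rho^\vee)=1$ for all $i$. Put $\mathfrak g^d=\{x:[\rho^\vee,x]=dx\}$, let $\mathfrak n_+$ be the subalgebra generated by the $e_i$, and put $\mathfrak b_+=\mathfrak h\oplus\mathfrak n_+$. Fix an $\operatorname{ad}\rho^\vee$-invariant subspace $\mathfrak s\subset\mathfrak b_+$ with $\mathfrak b_+=[f,\mathfrak n_+]\oplus\mathfrak s$, and write $\mathfrak s^d=\mathfrak s\cap\mathfrak g^d$. Let $e_\theta$ be a highest root vector, $r\in\mathfrak h$, $\hat k\in(0,1)$ real. Let $\bar r=\sum_d\bar r^d$ with $\bar r^d\in\mathfrak s^d$ be the element of $\mathfrak s$ such that $f-\rho^\vee+\bar r$ is conjugate to $f-\rho^\vee+r$ under $\exp(\operatorname{ad}\mathfrak n_+)$. Let $\{w_j\}_{j\in J}\subset\mathbb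 C^*$ be a finite (possibly empty) set, let $s^d_l(j)\in\mathfrak s^d$ for $0\le l\le d$, and let $$\mathcal L(z,\lambda)=\partial_z+f+\sum_d\frac{\bar r^d}{z^{d+1}}+z^{1-h^\vee}(1+\lambda z^{-\hat k})e_\theta+\sum_d s^d(z),\qquad s^d(z)=z^{-d}\sum_{j\in J}\sum_{l=0}^{d}\frac{s^d_l(j)}{(z-w_j)^{d+1-l}},$$ where $d$ runs over the integers $0\le d\le h^\vee-1$. Assume that for every $\lambda\in\mathbb C$ and every finite-dimensional $\mathfrak g$-module, the equation $\mathcal L\psi=0$ has trivial monodromy at each $w_j$. Let $p:I\to\mathbb Z/2$ satisfy $p(j)=p(i)+1$ whenever $C_{ij}<0$. Fix $i\in I$ and put $$\mathcal L^{p(i)/2}(z,\lambda)=\partial_z+f+\sum_d\frac{\bar r^d}{z^{d+1}}+(-1)^{p(i)}z^{1-h^\vee}(1+\lambda z^{-\hat k})e_\theta+\sum_d(-1)^{p(i)(d+1)}s^d\big((-1)^{p(i)}z\big).$$ Let $L(\omega_i)$ be the $i$-th fundamental representation, with set of weights $P_{\omega_i}$. Let $\widehat{\mathbb C}$ be the universal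 cover of $\mathbb C^*$ minus the lifts of the points $(-1)^{p(i)}w_j$. Let $V^i(\lambda)$ be the set of analytic functions $\psi:\widehat{\mathbb C}\times\mathbb C\to L(\omega_i)$, $(z,\lambda)\mapsto\psi(z,\lambda)$ (so $\psi$ is entire in $\lambda$), with $\mathcal L^{p(i)/2}\psi=0$. The monodromy operator is $M(\psi)(z,\lambda)=e^{2\pi i\rho^\vee}\psi(e^{2\pi i}z,e^{2\pi i\hat k}\lambda)$. Write $\ell=r-\rho^\vee$. The pair $(r,\hat k)$ is *generic* if, for every $i'\in I$, every $\omega\in P_{\omega_{i'}}$ and every eigenvalue $\mu$ of $\ell$ in $L(\omega_{i'})$: when $\hat k$ is irrational, $\mu-\omega(\ell)\ne m+n\hat k$ for all $(m,n)\in\mathbb Z^2\setminus\{(0,0)\}$; when $\hat k=p'/q$ in lowest terms, $q(\mu-\omega(\ell))$ is not a positive integer. **Proposition.** Let $(r,\hat k)$ be generic (rational or irrational $\hat k$). Let $\omega\in P_{\omega_i}$ and let $\chi_\omega\in L(\omega_i)$ be an eigenvector of $f-\rho^\vee+\bar r$ with eigenvalue $\omega(r-\rho^\vee)$. Then there is a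 unique solution $\chi_\omega(z,\lambda)\in V^i(\lambda)$ such that, for all $z$ sufficiently close to $0$ and all $\lambda\in\mathbb C$, $$\chi_\omega(z,\lambda)=z^{-\rho^\vee}z^{-\omega(r-\rho^\vee)}F(z,\lambda z^{-\hat k})$$ for an $L(\omega_i)$-valued function $F(z,w)$ which is analytic in a neighbourhood of $(0,0)$ and satisfies $\lim_{z\to0}F(z,\lambda z^{-\hat k})=\chi_\omega$ for every $\lambda$. For this solution $F$ can be chosen analytic on $\big(\mathbb C\setminus\{(-1)^{p(i)}w_j\}_{j\in J}\big)\times\mathbb C$, and then the formula holds on all of $\widehat{\mathbb C}\times\mathbb C$. In particular $F$ is an entire function of two variables if $J=\emptyset$. Moreover $$M(\chi_\omega)(z,\lambda)=e^{-2\pi i\,\omega(r-\rho^\vee)}\chi_\omega(z,\lambda),$$ so that $\chi_\omega$ is an eigenfunction of the monodromy operator $M$. -/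

import Mathlib

open Filter Topology

universe u v

noncomputable section

namespace KdVOper

section Algebra

variable {ι : Type*} [Fintype ι] [DecidableEq ι] {L : Type u} [LieRing L] [LieAlgebra ℂ L]
  {H : LieSubalgebra ℂ L}

/-- The principal nilpotent element `f = ∑ i, f i`. -/
def principalF (b : LieAlgebra.Basis ι H) : L := ∑ i, b.f i

/-- The element `ρ^∨ = ∑ i j, (C⁻¹) i j α_j^∨` of the Cartan subalgebra, where `C` is the Cartan
matrix; with the index convention of `LieAlgebra.Basis` one has `C i j = b.A j i`. -/
def rhoCheck (b : LieAlgebra.Basis ι H) : H :=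
  ∑ i, ∑ j, ((b.A.map (Int.cast : ℤ → ℂ))⁻¹) j i • b.h' j

/-- The component of degree `d` of the principal gradation: `{x | [ρ^∨, x] = d x}`. -/
def principalDegree (b : LieAlgebra.Basis ι H) (d : ℤ) : Submodule ℂ L where
  carrier := {x | ⁅(rhoCheck b : L), x⁆ = (d : ℂ) • x}
  add_mem' := by
    intro x y hx hy
    simp only [Set.mem_ofPred_eq] at hx hy ⊢
    rw [lie_add, hx, hy, smul_add]
  zero_mem' := by simp
  smul_mem' := by
    intro c x hx
    simp only [Set.mem_ofPred_eq] at hx ⊢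
    rw [lie_smul, hx, smul_comm]

/-- The subalgebra `n_+` generated by the `e i`. -/
def nPlus (b : LieAlgebra.Basis ι H) : Submodule ℂ L :=
  (LieSubalgebra.lieSpan ℂ L (Set.range b.e)).toSubmodule

/-- The Borel subalgebra `b_+ = h ⊕ n_+`. -/
def bPlus (b : LieAlgebra.Basis ι H) : Submodule ℂ L := H.toSubmodule ⊔ nPlus b

/-- The (dual) Coxeter number of a simply-laced simple Lie algebra: one plus the largest degree
that occurs in the principal gradation (that is, one plus the height of the highest root). -/
def coxeterNumber (b : LieAlgebra.Basis ι H) : ℕ :=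
  sSup {d : ℕ | principalDegree b (d : ℤ) ≠ ⊥} + 1

/-- `x` is a highest root vector: a nonzero element annihilated by all `ad (e i)`. -/
def IsHighestRootVector (b : LieAlgebra.Basis ι H) (x : L) : Prop :=
  x ≠ 0 ∧ ∀ i, ⁅b.e i, x⁆ = 0

/-- A transversal space: an `ad ρ^∨`-invariant subspace `s` with `b_+ = [f, n_+] ⊕ s`. -/
structure IsTransversal (b : LieAlgebra.Basis ι H) (s : Submodule ℂ L) : Prop where
  invariant : ∀ x ∈ s, ⁅(rhoCheck b : L), x⁆ ∈ s
  disjoint : Disjoint ((nPlus b).map (LieAlgebra.ad ℂ L (principalF b))) s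
  sup_eq : (nPlus b).map (LieAlgebra.ad ℂ L (principalF b)) ⊔ s = bPlus b

/-- `x` and `y` are conjugated by an element `exp (ad n)`, `n ∈ n_+`, of the unipotent group. The
sum is the full exponential series, since `ad n` is nilpotent and so `(ad n) ^ (dim L) = 0`. -/
def UnipotentConj (b : LieAlgebra.Basis ι H) (x y : L) : Prop :=
  ∃ n ∈ nPlus b, y = ∑ m ∈ Finset.range (Module.finrank ℂ L),
    ((m.factorial : ℂ)⁻¹) • ((LieAlgebra.ad ℂ L n) ^ m) x

/-- `W` is (a model of) the `i`-th fundamental representation `L(ω_i)`: it is irreducible, with a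
highest weight vector of weight `ω_i`, where `ω_i (α_j^∨) = δ_{ij}`. -/
def IsFundamentalModule (b : LieAlgebra.Basis ι H) (i : ι) (W : Type v) [AddCommGroup W]
    [Module ℂ W] [LieRingModule L W] [LieModule ℂ L W] : Prop :=
  LieModule.IsIrreducible ℂ L W ∧
    ∃ w : W, w ≠ 0 ∧ (∀ j, ⁅b.e j, w⁆ = 0) ∧ ∀ j, ⁅b.h j, w⁆ = if j = i then w else 0

/-- `ω` is a weight of the module `W`. -/
def IsWeight (H : LieSubalgebra ℂ L) (W : Type v) [AddCommGroup W] [Module ℂ W]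
    [LieRingModule L W] (ω : Module.Dual ℂ H) : Prop :=
  ∃ w : W, w ≠ 0 ∧ ∀ h : H, ⁅(h : L), w⁆ = ω h • w

/-- Genericity of the pair `(r, k)`. Writing `ℓ = r - ρ^∨`:
if `k` is irrational, for every weight `ω` of every fundamental representation, no `μ - ω(ℓ)` with
`μ` in the spectrum of `ℓ` is of the form `m + n k` with `(m, n) ∈ ℤ² ∖ {(0, 0)}`;
if `k = p / q` in lowest terms, no `q (μ - ω(ℓ))` is a positive integer. -/
def IsGeneric (b : LieAlgebra.Basis ι H) (r : H) (k : ℝ) : Prop :=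
  ∀ (i : ι) (W : Type v) [AddCommGroup W] [Module ℂ W] [FiniteDimensional ℂ W]
    [LieRingModule L W] [LieModule ℂ L W], IsFundamentalModule b i W →
    ∀ ω : Module.Dual ℂ H, IsWeight H W ω →
      ∀ μ ∈ spectrum ℂ (LieModule.toEnd ℂ L W ((r - rhoCheck b : H) : L)),
        (Irrational k → ∀ m n : ℤ, (m, n) ≠ (0, 0) →
          μ - ω (r - rhoCheck b) ≠ (m : ℂ) + (n : ℂ) * (k : ℂ)) ∧
        (∀ c : ℚ, (c : ℝ) = k → ∀ N : ℕ, 0 < N →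
          (c.den : ℂ) * (μ - ω (r - rhoCheck b)) ≠ (N : ℂ))

/-- The parameters of the operator
`ℒ(z, λ) = ∂_z + f + ∑_d r̄^d / z^(d+1) + z^(1-h) (1 + λ z^(-k)) e_θ
  + ∑_{w ∈ sing} ∑_d z^(-d) ∑_{l ≤ d} s w d l / (z - w)^(d+1-l)`.
The sums over `d` run over the degrees `0 ≤ d < h`; only exponents contribute, since the degree `d`
part of the transversal space vanishes for the other `d`. -/
structure OperData (b : LieAlgebra.Basis ι H) where
  /-- the transversal space -/
  transversal : Submodule ℂ L
  isTransversal : IsTransversal b transversal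
  /-- the parameter `k`, a real number in `(0, 1)` -/
  k : ℝ
  k_pos : 0 < k
  k_lt_one : k < 1
  /-- the highest root vector `e_θ` -/
  eTheta : L
  isHighestRootVector : IsHighestRootVector b eTheta
  /-- the parameter `r` in the Cartan subalgebra -/
  r : H
  /-- the components `r̄^d` of the element `r̄` of the transversal space -/
  rBar : ℕ → L
  rBar_mem : ∀ d : ℕ, rBar d ∈ transversal ⊓ principalDegree b (d : ℤ)
  rBar_conj : UnipotentConj b (principalF b - (rhoCheck b : L) + (r : L))
    (principalF b - (rhoCheck b : L) + ∑ d ∈ Finset.range (coxeterNumber b), rBar d)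
  /-- the finite set of additional singularities -/
  sing : Finset ℂ
  zero_notMem : (0 : ℂ) ∉ sing
  /-- the coefficients at the additional singularities -/
  s : ℂ → ℕ → ℕ → L
  s_mem : ∀ (w : ℂ) (d l : ℕ), s w d l ∈ transversal ⊓ principalDegree b (d : ℤ)

/-- The sign `(-1)^p`, `p ∈ ℤ/2`. -/
def sgn (p : ZMod 2) : ℂ := (-1) ^ p.val

variable {b : LieAlgebra.Basis ι H}

namespace OperData

/-- The principal coefficient `f - ρ^∨ + r̄` of the singularity at `0`. -/
def principalCoeff (D : OperData b) : L :=
  principalF b - (rhoCheck b : L) + ∑ d ∈ Finset.range (coxeterNumber b), D.rBar d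

/-- The `𝔤^d`-valued rational function
`s^d(z) = z^(-d) ∑_{w ∈ sing} ∑_{l=0}^{d} s w d l / (z - w)^(d+1-l)`. -/
def sFun (D : OperData b) (d : ℕ) (z : ℂ) : L :=
  (z ^ d)⁻¹ • ∑ w ∈ D.sing, ∑ l ∈ Finset.range (d + 1), ((z - w) ^ (d + 1 - l))⁻¹ • D.s w d l

/-- The coefficient `B(ζ, λ)` of the operator `ℒ^{p/2}(z, λ) = ∂_z + B`, at the point of the
universal cover of `ℂ^*` with coordinate `ζ`, `z = exp ζ` (so `z^(-k) = exp (-k ζ)`):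
`B = f + ∑_d r̄^d / z^(d+1) + (-1)^p z^(1-h) (1 + λ z^(-k)) e_θ + ∑_d (-1)^{p(d+1)} s^d((-1)^p z)`.
For `p = 0` this is `ℒ` itself. For `p = 1` it is the operator obtained from `ℒ(z, λ)` by the
rotation `(z, λ) ↦ (e^{iπ} z, e^{iπk} λ)`, a component of principal degree `d` being multiplied by
`e^{iπ(d+1)}`. -/
def coeff (D : OperData b) (p : ZMod 2) (ζ lam : ℂ) : L :=
  principalF b
    + ∑ d ∈ Finset.range (coxeterNumber b), (Complex.exp (-((d : ℂ) + 1) * ζ)) • D.rBar d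
    + (sgn p * Complex.exp ((1 - (coxeterNumber b : ℂ)) * ζ)
        * (1 + lam * Complex.exp (-(D.k : ℂ) * ζ))) • D.eTheta
    + ∑ d ∈ Finset.range (coxeterNumber b),
        (sgn p ^ (d + 1)) • D.sFun d (sgn p * Complex.exp ζ)

/-- The universal cover of `ℂ^*`, minus the lifts of the additional singular points `(-1)^p w` of
`ℒ^{p/2}`, in the coordinate `ζ` with `z = exp ζ`. -/
def cover (D : OperData b) (p : ZMod 2) : Set ℂ :=
  {ζ | sgn p * Complex.exp ζ ∉ D.sing}

variable {V : Type v} [NormedAddCommGroup V] [NormedSpace ℂ V] [LieRingModule L V]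

/-- `∂_z ψ + B ψ = 0` at the point `ζ`, in the coordinate `ζ` (where `∂_z = exp (-ζ) ∂_ζ`). -/
def SolvesAt (D : OperData b) (p : ZMod 2) (lam : ℂ) (ψ : ℂ → V) (ζ : ℂ) : Prop :=
  HasDerivAt ψ (-(Complex.exp ζ • ⁅D.coeff p ζ lam, ψ ζ⁆)) ζ

/-- All additional singular points of `ℒ(z, λ)` have trivial monodromy for every `λ`: in every
finite-dimensional module, near each lift of an additional singular point, every initial value at
a point of a punctured disc is attained by a solution that is single-valued there. -/
def TrivialMonodromy (D : OperData b) : Prop :=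
  ∀ (W : Type v) [NormedAddCommGroup W] [NormedSpace ℂ W] [FiniteDimensional ℂ W]
    [LieRingModule L W] [LieModule ℂ L W] (lam ζ₀ : ℂ), Complex.exp ζ₀ ∈ D.sing →
    ∃ ε > 0, ∀ ζ₁ ∈ Metric.ball ζ₀ ε \ {ζ₀}, ∀ w : W, ∃ ψ : ℂ → W, ψ ζ₁ = w ∧
      ∀ ζ ∈ Metric.ball ζ₀ ε \ {ζ₀}, D.SolvesAt 0 lam ψ ζ

variable (V) in
/-- The space of solutions of `ℒ^{p/2}(z, λ) ψ(z, λ) = 0` with values in `V` that are analytic on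
the punctured universal cover and entire in `λ`. The argument of `ψ` is the pair `(ζ, λ)`. -/
def solutions (D : OperData b) (p : ZMod 2) : Set (ℂ × ℂ → V) :=
  {ψ | AnalyticOnNhd ℂ ψ (D.cover p ×ˢ Set.univ) ∧
    ∀ ζ ∈ D.cover p, ∀ lam, D.SolvesAt p lam (fun ζ' => ψ (ζ', lam)) ζ}

end OperData

variable {V : Type v} [NormedAddCommGroup V] [NormedSpace ℂ V] [FiniteDimensional ℂ V]
  [LieRingModule L V] [LieModule ℂ L V]

variable (V) in
/-- The operator `exp (c ρ^∨)` on the representation `V`. -/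
def expRho (b : LieAlgebra.Basis ι H) (c : ℂ) : V →L[ℂ] V :=
  NormedSpace.exp
    (c • LinearMap.toContinuousLinearMap (LieModule.toEnd ℂ L V (rhoCheck b : L)))

/-- The monodromy operator `M ψ (z, λ) = e^{2πiρ^∨} ψ(e^{2πi} z, e^{2πik} λ)`. -/
def monodromy (b : LieAlgebra.Basis ι H) (k : ℝ) (ψ : ℂ × ℂ → V) : ℂ × ℂ → V := fun x =>
  expRho V b (2 * Real.pi * Complex.I)
    (ψ (x.1 + 2 * Real.pi * Complex.I, Complex.exp (2 * Real.pi * Complex.I * k) * x.2))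

/-- The function `z^(-ρ^∨) z^(-a) F(z, λ z^(-k))` of `(ζ, λ)`, where `z = exp ζ`. -/
def frobeniusForm (b : LieAlgebra.Basis ι H) (k : ℝ) (a : ℂ) (F : ℂ × ℂ → V) : ℂ × ℂ → V :=
  fun x => expRho V b (-x.1) (Complex.exp (-a * x.1) •
    F (Complex.exp x.1, x.2 * Complex.exp (-(k : ℂ) * x.1)))

/-- `χ(z, λ) = z^(-ρ^∨) z^(-a) F(z, λ z^(-k))` for `z` near `0` and all `λ`, where `F` is analytic
at `(0, 0)` and `F(z, λ z^(-k)) → χ₀` as `z → 0` (that is, as `Re ζ → -∞`), for every `λ`. -/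
def IsFrobeniusExpansion (b : LieAlgebra.Basis ι H) (k : ℝ) (a : ℂ) (χ₀ : V)
    (χ F : ℂ × ℂ → V) : Prop :=
  AnalyticAt ℂ F (0, 0) ∧
  (∃ R > 0, ∀ ζ lam : ℂ, ‖Complex.exp ζ‖ < R → χ (ζ, lam) = frobeniusForm b k a F (ζ, lam)) ∧
  ∀ lam : ℂ, Tendsto (fun ζ : ℂ => F (Complex.exp ζ, lam * Complex.exp (-(k : ℂ) * ζ)))
    (comap Complex.re atBot) (𝓝 χ₀)

end Algebra

end KdVOper

/-!
The gauge transformation `z^(ρ^∨) z^a` turns `ℒ^{p/2} ψ = 0`, in the coordinate `ζ = log z`, into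
`φ' = -(Q + z ((1 + λ z^(-k)) E + S z)) φ` with `Q = f - ρ^∨ + r̄ - a`. Along the curves
`(z, u) = (exp ζ, λ exp ((1 - k) ζ))` the derivation `d/dζ` becomes the Euler field
`z ∂_z + (1 - k) u ∂_u`, and the coefficient becomes linear in `u` and analytic in `z`. The
spectrum of `Q` is that of `r - ρ^∨ - a`, so genericity makes `m + (1 - k) n + [Q, ·]` invertible
for `(m, n) ≠ 0`, with an inverse bounded uniformly in `(m, n)`. Hence there is a convergent double
power series `Ψ(z, u)` with `Ψ(0, 0) = 1` such that the solutions near `z = 0` are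
`Ψ(z, u) exp (-ζ Q) c`.

Existence: a vector `χ₀` in the kernel of `Q` gives the solution `Ψ(z, u) χ₀`, which depends on `ζ`
only through `z` and `w = λ z^(-k)`. Trivial monodromy at the additional singular points continues
it to a single-valued function of `(z, w)`.

Uniqueness: the difference of two solutions is `Ψ(z, u) exp (-ζ Q) c(λ)` with `c` entire, and
single-valuedness in `(z, w)` means `c (e^{2πik} λ) = e^{2πiQ} c(λ)`. By genericity every Taylor
coefficient of `c` lies in the kernel of `Q`, so the difference is `Ψ(z, u) c(λ)`, which tends to
`c(λ)` as `z → 0`. The prescribed limit forces `c = 0`.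
-/

noncomputable section

namespace KdVOper

section Recursion

open Finset HasAntidiagonal

variable {M : Type*} [AddCancelCommMonoid M] [PartialOrder M] [CanonicallyOrderedAdd M]
  [HasAntidiagonal M] {𝔸 : Type*}

lemma snd_lt_of_mem_antidiagonal {p : M} {q : M × M} (hq : q ∈ antidiagonal p) (h : q.1 ≠ 0) :
    q.2 < p := by
  rw [← mem_antidiagonal.1 hq]
  exact lt_of_le_of_ne le_add_self fun h' => h (right_eq_add.1 h')

theorem exists_convolution_recursion [WellFoundedLT M] [NonUnitalNonAssocSemiring 𝔸] {a : M → 𝔸}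
    (ha : a 0 = 0) (R : M → 𝔸 → 𝔸) (g₀ : 𝔸) :
    ∃ g : M → 𝔸, g 0 = g₀ ∧
      ∀ p ≠ 0, g p = R p (∑ q ∈ antidiagonal p, a q.1 * g q.2) := by
  classical
  let Φ : ∀ p : M, (∀ q, q < p → 𝔸) → 𝔸 := fun p ih =>
    if p = 0 then g₀
    else R p (∑ q ∈ antidiagonal p, a q.1 * if h : q.2 < p then ih q.2 h else 0)
  let g : M → 𝔸 := wellFounded_lt.fix Φ
  have hg : ∀ p, g p = Φ p fun q _ => g q := fun p => WellFounded.fix_eq _ _ _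
  refine ⟨g, by rw [hg]; exact if_pos rfl, fun p hp => ?_⟩
  rw [hg]
  simp only [Φ, hp, if_false]
  refine congrArg (R p) (sum_congr rfl fun q hq => ?_)
  rcases eq_or_ne q.1 0 with h0 | h0
  · rw [h0, ha, zero_mul, zero_mul]
  · rw [dif_pos (snd_lt_of_mem_antidiagonal hq h0)]

variable [NormedRing 𝔸]

lemma norm_convolution_mul_le {w : M → ℝ} (hw : ∀ p, 0 ≤ w p)
    (hwadd : ∀ p q, w (p + q) = w p * w q) {a g : M → 𝔸} (ha : a 0 = 0)
    (hsum : Summable fun q => ‖a q‖ * w q) {B : ℝ} (hB : 0 ≤ B) {p : M}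
    (hg : ∀ q < p, ‖g q‖ * w q ≤ B) :
    ‖∑ q ∈ antidiagonal p, a q.1 * g q.2‖ * w p ≤ (∑' q, ‖a q‖ * w q) * B := by
  have hterm : ∀ q ∈ antidiagonal p, ‖a q.1 * g q.2‖ * w p ≤ ‖a q.1‖ * w q.1 * B := by
    intro q hq
    rcases eq_or_ne q.1 0 with h0 | h0
    · simp [h0, ha]
    calc ‖a q.1 * g q.2‖ * w p ≤ ‖a q.1‖ * ‖g q.2‖ * w p :=
          mul_le_mul_of_nonneg_right (norm_mul_le _ _) (hw p)
      _ = ‖a q.1‖ * w q.1 * (‖g q.2‖ * w q.2) := by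
          rw [← mem_antidiagonal.1 hq, hwadd]; ring
      _ ≤ ‖a q.1‖ * w q.1 * B :=
          mul_le_mul_of_nonneg_left (hg _ (snd_lt_of_mem_antidiagonal hq h0))
            (mul_nonneg (norm_nonneg _) (hw _))
  classical
  have hinj : Set.InjOn Prod.fst (antidiagonal p : Set (M × M)) := fun q hq q' hq' h =>
    antidiagonal_congr hq hq' |>.2 h
  calc ‖∑ q ∈ antidiagonal p, a q.1 * g q.2‖ * w p
      ≤ (∑ q ∈ antidiagonal p, ‖a q.1 * g q.2‖) * w p :=
        mul_le_mul_of_nonneg_right (norm_sum_le _ _) (hw p)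
    _ ≤ ∑ q ∈ antidiagonal p, ‖a q.1‖ * w q.1 * B := by
        rw [sum_mul]; exact sum_le_sum hterm
    _ = (∑ q ∈ (antidiagonal p).image Prod.fst, ‖a q‖ * w q) * B := by
        rw [← sum_mul, sum_image hinj]
    _ ≤ (∑' q, ‖a q‖ * w q) * B :=
        mul_le_mul_of_nonneg_right
          (hsum.sum_le_tsum _ fun q _ => mul_nonneg (norm_nonneg _) (hw q)) hB

theorem norm_le_of_convolution_recursion [WellFoundedLT M] {w : M → ℝ} (hw : ∀ p, 0 ≤ w p)
    (hw0 : w 0 = 1) (hwadd : ∀ p q, w (p + q) = w p * w q) {a g : M → 𝔸} (ha : a 0 = 0)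
    {R : M → 𝔸 → 𝔸} (hg : ∀ p ≠ 0, g p = R p (∑ q ∈ antidiagonal p, a q.1 * g q.2))
    {C : ℝ} (hC : 0 ≤ C) (hR : ∀ p ≠ 0, ∀ X, ‖R p X‖ ≤ C * ‖X‖)
    (hsum : Summable fun q => ‖a q‖ * w q) (hsmall : C * ∑' q, ‖a q‖ * w q ≤ 1) (p : M) :
    ‖g p‖ * w p ≤ ‖g 0‖ := by
  induction p using WellFoundedLT.induction with
  | ind p ih =>
  rcases eq_or_ne p 0 with rfl | hp
  · rw [hw0, mul_one]
  calc ‖g p‖ * w p ≤ C * ‖∑ q ∈ antidiagonal p, a q.1 * g q.2‖ * w p := by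
        conv_lhs => rw [hg p hp]
        exact mul_le_mul_of_nonneg_right (hR p hp _) (hw p)
    _ = C * (‖∑ q ∈ antidiagonal p, a q.1 * g q.2‖ * w p) := mul_assoc _ _ _
    _ ≤ C * ((∑' q, ‖a q‖ * w q) * ‖g 0‖) :=
        mul_le_mul_of_nonneg_left
          (norm_convolution_mul_le hw hwadd ha hsum (norm_nonneg _) ih) hC
    _ = C * (∑' q, ‖a q‖ * w q) * ‖g 0‖ := (mul_assoc _ _ _).symm
    _ ≤ ‖g 0‖ := mul_le_of_le_one_left (norm_nonneg _) hsmall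

end Recursion

section DoubleSeries

open Finset HasAntidiagonal

lemma hasSum_sum_antidiagonal {A : Type*} [AddCommMonoid A] [TopologicalSpace A] [ContinuousAdd A]
    [RegularSpace A] {f : ℕ × ℕ → A} {s : A} (h : HasSum f s) :
    HasSum (fun N => ∑ q ∈ antidiagonal N, f q) s := by
  refine (sigmaAntidiagonalEquivProd.hasSum_iff.2 h).sigma fun N => ?_
  rw [← sum_coe_sort]
  exact hasSum_fintype _

variable {E : Type*} [NormedAddCommGroup E]

/-- Absolute convergence of the double power series with coefficients `g` on the closed polydisc
of radius `r`, which is the closed ball of `ℂ × ℂ`. -/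
def DoubleSummable (g : ℕ × ℕ → E) (r : ℝ) : Prop :=
  Summable fun p : ℕ × ℕ => ‖g p‖ * r ^ (p.1 + p.2)

lemma doubleSummable_of_norm_le {g : ℕ × ℕ → E} {r s B : ℝ} (hs : 0 ≤ s) (hsr : s < r)
    (hg : ∀ p, ‖g p‖ * r ^ (p.1 + p.2) ≤ B) : DoubleSummable g s := by
  have hr : 0 < r := hs.trans_lt hsr
  have hgeom := summable_geometric_of_lt_one (div_nonneg hs hr.le) ((div_lt_one hr).2 hsr)
  have hprod : Summable fun p : ℕ × ℕ => (s / r) ^ p.1 * (s / r) ^ p.2 :=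
    hgeom.mul_of_nonneg hgeom (fun _ => by positivity) fun _ => by positivity
  refine Summable.of_nonneg_of_le (fun p => by positivity) (fun p => ?_) (hprod.mul_left B)
  calc ‖g p‖ * s ^ (p.1 + p.2)
      = ‖g p‖ * r ^ (p.1 + p.2) * ((s / r) ^ p.1 * (s / r) ^ p.2) := by
        rw [← pow_add, div_pow]; field_simp
    _ ≤ B * ((s / r) ^ p.1 * (s / r) ^ p.2) := by
        gcongr
        exact hg p

lemma DoubleSummable.mono {g : ℕ × ℕ → E} {r s : ℝ} (h : DoubleSummable g r) (hs : 0 ≤ s)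
    (hsr : s ≤ r) : DoubleSummable g s :=
  Summable.of_nonneg_of_le (fun _ => by positivity) (fun _ => by gcongr) h

lemma tsum_norm_mul_pow_le {g : ℕ × ℕ → E} {r s : ℝ} (hg : DoubleSummable g r) (hr : 0 < r)
    (hs : 0 ≤ s) (hsr : s ≤ r) (hg0 : g 0 = 0) :
    ∑' p, ‖g p‖ * s ^ (p.1 + p.2) ≤ s / r * ∑' p, ‖g p‖ * r ^ (p.1 + p.2) := by
  rw [← tsum_mul_left]
  refine (hg.mono hs hsr).tsum_le_tsum (fun p => ?_) (hg.mul_left _)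
  rcases eq_or_ne p 0 with rfl | hp
  · simp [hg0]
  have hdeg : p.1 + p.2 ≠ 0 := fun h => hp (Prod.ext (by simp; omega) (by simp; omega))
  calc ‖g p‖ * s ^ (p.1 + p.2) = (s / r) ^ (p.1 + p.2) * (‖g p‖ * r ^ (p.1 + p.2)) := by
        rw [div_pow]; field_simp
    _ ≤ s / r * (‖g p‖ * r ^ (p.1 + p.2)) := by
        gcongr
        exact pow_le_of_le_one (by positivity) ((div_le_one hr).2 hsr) hdeg

lemma exists_mul_tsum_norm_le_one {g : ℕ × ℕ → E} {r : ℝ} (hg : DoubleSummable g r) (hr : 0 < r)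
    (hg0 : g 0 = 0) {C : ℝ} (hC : 0 ≤ C) :
    ∃ s > 0, s ≤ r ∧ C * ∑' p, ‖g p‖ * s ^ (p.1 + p.2) ≤ 1 := by
  set T := ∑' p, ‖g p‖ * r ^ (p.1 + p.2)
  have hT : 0 ≤ T := tsum_nonneg fun p => by positivity
  have hpos : 0 < 1 + C * T := by positivity
  have hsr : r / (1 + C * T) ≤ r := div_le_self hr.le (by nlinarith)
  refine ⟨r / (1 + C * T), by positivity, hsr, ?_⟩
  calc C * ∑' p, ‖g p‖ * (r / (1 + C * T)) ^ (p.1 + p.2)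
      ≤ C * (r / (1 + C * T) / r * T) := by
        gcongr
        exact tsum_norm_mul_pow_le hg hr (by positivity) hsr hg0
    _ = C * T / (1 + C * T) := by field_simp
    _ ≤ 1 := (div_le_one hpos).2 (by linarith)

variable [NormedSpace ℂ E]

/-- The sum of the double power series `∑ zᵐ uⁿ g (m, n)` at the point `(z, u)`. -/
def doubleSeries (g : ℕ × ℕ → E) (x : ℂ × ℂ) : E := ∑' p : ℕ × ℕ, (x.1 ^ p.1 * x.2 ^ p.2) • g p

lemma norm_monomial_smul_le (g : E) (p : ℕ × ℕ) {x : ℂ × ℂ} {r : ℝ} (hx : ‖x‖ ≤ r) :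
    ‖(x.1 ^ p.1 * x.2 ^ p.2) • g‖ ≤ ‖g‖ * r ^ (p.1 + p.2) := by
  have hr : 0 ≤ r := (norm_nonneg x).trans hx
  have h₁ := (norm_fst_le x).trans hx
  have h₂ := (norm_snd_le x).trans hx
  rw [norm_smul, norm_mul, norm_pow, norm_pow, mul_comm, pow_add]
  gcongr

lemma doubleSeries_zero (g : ℕ × ℕ → E) : doubleSeries g 0 = g 0 := by
  rw [doubleSeries, tsum_eq_single 0]
  · simp
  · rintro ⟨m, n⟩ hp
    have hmn : m ≠ 0 ∨ n ≠ 0 := by simpa [-not_and, not_and_or] using hp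
    rcases hmn with h | h <;> simp [h]

namespace DoubleSummable

variable {g : ℕ × ℕ → E} {r : ℝ}

lemma summable_norm (h : DoubleSummable g r) {x : ℂ × ℂ} (hx : ‖x‖ ≤ r) :
    Summable fun p : ℕ × ℕ => ‖(x.1 ^ p.1 * x.2 ^ p.2) • g p‖ :=
  Summable.of_nonneg_of_le (fun _ => norm_nonneg _) (fun p => norm_monomial_smul_le _ p hx) h

lemma hasSum [CompleteSpace E] (h : DoubleSummable g r) {x : ℂ × ℂ} (hx : ‖x‖ ≤ r) :
    HasSum (fun p : ℕ × ℕ => (x.1 ^ p.1 * x.2 ^ p.2) • g p) (doubleSeries g x) :=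
  (h.summable_norm hx).of_norm.hasSum

end DoubleSummable

/-- The multilinear map whose diagonal is the monomial `(z, u) ↦ zᵐ uᴺ⁻ᵐ g`, for `m ≤ N`. -/
def monomialMultilinear (N m : ℕ) (g : E) :
    ContinuousMultilinearMap ℂ (fun _ : Fin N => ℂ × ℂ) E :=
  ((ContinuousMultilinearMap.mkPiAlgebra ℂ (Fin N) ℂ).compContinuousLinearMap
    fun i => if (i : ℕ) < m then ContinuousLinearMap.fst ℂ ℂ ℂ
      else ContinuousLinearMap.snd ℂ ℂ ℂ).smulRight g

lemma norm_monomialMultilinear_le (N m : ℕ) (g : E) : ‖monomialMultilinear N m g‖ ≤ ‖g‖ := by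
  refine ContinuousMultilinearMap.opNorm_le_bound (norm_nonneg g) fun x => ?_
  simp only [monomialMultilinear, ContinuousMultilinearMap.smulRight_apply,
    ContinuousMultilinearMap.compContinuousLinearMap_apply,
    ContinuousMultilinearMap.mkPiAlgebra_apply, norm_smul, norm_prod]
  rw [mul_comm]
  gcongr with i
  split_ifs
  exacts [norm_fst_le _, norm_snd_le _]

lemma monomialMultilinear_diag (m n : ℕ) (g : E) (x : ℂ × ℂ) :
    monomialMultilinear (m + n) m g (fun _ => x) = (x.1 ^ m * x.2 ^ n) • g := by
  simp [monomialMultilinear, Fin.prod_univ_add]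

/-- The double power series as a power series on `ℂ × ℂ`, collected by total degree. -/
def doubleFormalSeries (g : ℕ × ℕ → E) : FormalMultilinearSeries ℂ (ℂ × ℂ) E := fun N =>
  ∑ q ∈ antidiagonal N, monomialMultilinear N q.1 (g q)

lemma doubleFormalSeries_diag (g : ℕ × ℕ → E) (N : ℕ) (x : ℂ × ℂ) :
    doubleFormalSeries g N (fun _ => x) = ∑ q ∈ antidiagonal N, (x.1 ^ q.1 * x.2 ^ q.2) • g q := by
  rw [doubleFormalSeries, _root_.sum_apply]
  refine sum_congr rfl fun q hq => ?_
  obtain rfl := mem_antidiagonal.1 hq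
  exact monomialMultilinear_diag q.1 q.2 (g q) x

lemma DoubleSummable.le_radius {g : ℕ × ℕ → E} {r : NNReal} (h : DoubleSummable g r) :
    r ≤ (doubleFormalSeries g).radius := by
  refine FormalMultilinearSeries.le_radius_of_summable _ <|
    Summable.of_nonneg_of_le (fun _ => by positivity) (fun N => ?_)
      (hasSum_sum_antidiagonal (Summable.hasSum h)).summable
  calc ‖doubleFormalSeries g N‖ * (r : ℝ) ^ N
      ≤ (∑ q ∈ antidiagonal N, ‖g q‖) * (r : ℝ) ^ N := by
        gcongr
        exact (norm_sum_le _ _).trans (sum_le_sum fun q _ => norm_monomialMultilinear_le _ _ _)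
    _ = ∑ q ∈ antidiagonal N, ‖g q‖ * (r : ℝ) ^ (q.1 + q.2) := by
        rw [sum_mul]
        exact sum_congr rfl fun q hq => by rw [mem_antidiagonal.1 hq]

variable [CompleteSpace E] in
theorem DoubleSummable.analyticOnNhd {g : ℕ × ℕ → E} {r : ℝ} (h : DoubleSummable g r)
    (hr : 0 < r) : AnalyticOnNhd ℂ (doubleSeries g) (Metric.ball 0 r) := by
  lift r to NNReal using hr.le
  have hball : HasFPowerSeriesOnBall (doubleSeries g) (doubleFormalSeries g) 0 r := by
    refine ⟨h.le_radius, by exact_mod_cast hr, fun {x} hx => ?_⟩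
    have hx' : ‖x‖ ≤ r := by
      rw [Metric.eball_coe, mem_ball_zero_iff] at hx
      exact hx.le
    simpa only [zero_add, doubleFormalSeries_diag] using hasSum_sum_antidiagonal (h.hasSum hx')
  simpa only [Metric.eball_coe] using hball.analyticOnNhd

instance : HasAntidiagonal (ℕ × ℕ) := antidiagonalOfLocallyFinite

lemma monomial_smul_mul {𝔸 : Type*} [Ring 𝔸] [Algebra ℂ 𝔸] (x : ℂ × ℂ) (p q : ℕ × ℕ) (a b : 𝔸) :
    ((x.1 ^ p.1 * x.2 ^ p.2) • a) * ((x.1 ^ q.1 * x.2 ^ q.2) • b)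
      = (x.1 ^ (p + q).1 * x.2 ^ (p + q).2) • (a * b) := by
  rw [smul_mul_smul_comm, Prod.fst_add, Prod.snd_add, pow_add, pow_add, mul_mul_mul_comm]

theorem doubleSeries_mul {𝔸 : Type*} [NormedRing 𝔸] [NormedAlgebra ℂ 𝔸] [CompleteSpace 𝔸]
    {a g : ℕ × ℕ → 𝔸} {r : ℝ} (ha : DoubleSummable a r) (hg : DoubleSummable g r) {x : ℂ × ℂ}
    (hx : ‖x‖ ≤ r) :
    doubleSeries a x * doubleSeries g x
      = doubleSeries (fun p => ∑ q ∈ antidiagonal p, a q.1 * g q.2) x := by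
  have hprod := summable_mul_of_summable_norm (ha.summable_norm hx) (hg.summable_norm hx)
  refine ((ha.hasSum hx).summable.tsum_mul_tsum_eq_tsum_sum_antidiagonal (hg.hasSum hx).summable
    hprod).trans (tsum_congr fun p => ?_)
  rw [smul_sum]
  refine sum_congr rfl fun q hq => ?_
  rw [monomial_smul_mul, mem_antidiagonal.1 hq]

lemma hasDerivAt_euler_curve (c : ℂ) (x : ℂ × ℂ) :
    HasDerivAt (fun s => (Complex.exp s * x.1, Complex.exp (c * s) * x.2)) (x.1, c * x.2) 0 := by
  have h₁ := (Complex.hasDerivAt_exp 0).mul_const x.1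
  have h₂ := (((hasDerivAt_id (0 : ℂ)).const_mul c).cexp).mul_const x.2
  simpa using h₁.prodMk h₂

lemma hasDerivAt_monomial_euler_curve (c : ℂ) (x : ℂ × ℂ) (p : ℕ × ℕ) (g : E) :
    HasDerivAt (fun s => ((Complex.exp s * x.1) ^ p.1 * (Complex.exp (c * s) * x.2) ^ p.2) • g)
      ((x.1 ^ p.1 * x.2 ^ p.2) • ((p.1 : ℂ) + c * p.2) • g) 0 := by
  have hexp : ∀ s, (Complex.exp s * x.1) ^ p.1 * (Complex.exp (c * s) * x.2) ^ p.2
      = Complex.exp (((p.1 : ℂ) + c * p.2) * s) * (x.1 ^ p.1 * x.2 ^ p.2) := fun s => by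
    rw [mul_pow, mul_pow, ← Complex.exp_nat_mul, ← Complex.exp_nat_mul, mul_mul_mul_comm,
      ← Complex.exp_add]
    ring_nf
  have hderiv := ((((hasDerivAt_id (0 : ℂ)).const_mul ((p.1 : ℂ) + c * p.2)).cexp).mul_const
    (x.1 ^ p.1 * x.2 ^ p.2)).smul_const g
  rw [smul_smul, mul_comm (x.1 ^ p.1 * x.2 ^ p.2)]
  simpa only [hexp, id, mul_zero, Complex.exp_zero, one_mul, mul_one] using hderiv

variable [CompleteSpace E] in
/-- The Euler operator `z ∂_z + c u ∂_u` is differentiation at `s = 0` along `(eˢ z, eᶜˢ u)`, on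
which the double series is a sum of exponentials. -/
theorem hasSum_fderiv_euler {g : ℕ × ℕ → E} {r : ℝ} (h : DoubleSummable g r) (c : ℂ)
    {x : ℂ × ℂ} (hx : x ∈ Metric.ball 0 r) :
    HasSum (fun p : ℕ × ℕ => (x.1 ^ p.1 * x.2 ^ p.2) • ((p.1 : ℂ) + c * p.2) • g p)
      (fderiv ℂ (doubleSeries g) x (x.1, c * x.2)) := by
  let curve : ℂ → ℂ × ℂ := fun s => (Complex.exp s * x.1, Complex.exp (c * s) * x.2)
  have hcurve0 : curve 0 = x := by simp [curve]
  have hchain : HasDerivAt (doubleSeries g ∘ curve)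
      (fderiv ℂ (doubleSeries g) (curve 0) (x.1, c * x.2)) 0 := by
    have hr : 0 < r := (norm_nonneg x).trans_lt (mem_ball_zero_iff.1 hx)
    exact (h.analyticOnNhd hr _ (hcurve0.symm ▸ hx)).differentiableAt.hasFDerivAt.comp_hasDerivAt 0
      (hasDerivAt_euler_curve c x)
  have hsum := Complex.hasSum_deriv_of_summable_norm (z := 0) h
    (fun p => Differentiable.differentiableOn
      (f := fun s => ((curve s).1 ^ p.1 * (curve s).2 ^ p.2) • g p) (by fun_prop))
    (Metric.isOpen_ball.preimage (by fun_prop : Continuous curve))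
    (fun p s hs => norm_monomial_smul_le (g p) p (mem_ball_zero_iff.1 hs).le)
    (by rwa [Set.mem_preimage, hcurve0])
  simp only [curve, (hasDerivAt_monomial_euler_curve c x _ _).deriv] at hsum
  rw [hcurve0] at hchain
  exact hchain.deriv ▸ hsum

/-- The coefficient of `zᵐ uᴺ⁻ᵐ` in `f (fun _ => (z, u))`, for a multilinear `f`. -/
def monomialCoeff {N : ℕ} (f : ContinuousMultilinearMap ℂ (fun _ : Fin N => ℂ × ℂ) E) (m : ℕ) : E :=
  ∑ s ∈ powersetCard m univ, f (s.piecewise (fun _ => (1, 0)) fun _ => (0, 1))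

lemma apply_diag_eq_sum_monomialCoeff {N : ℕ}
    (f : ContinuousMultilinearMap ℂ (fun _ : Fin N => ℂ × ℂ) E) (x : ℂ × ℂ) :
    f (fun _ => x) = ∑ q ∈ antidiagonal N, (x.1 ^ q.1 * x.2 ^ q.2) • monomialCoeff f q.1 := by
  have hterm : ∀ s : Finset (Fin N),
      f (s.piecewise (fun _ => x.1 • (1, 0)) fun _ => x.2 • (0, 1))
        = (x.1 ^ s.card * x.2 ^ (N - s.card)) •
          f (s.piecewise (fun _ => (1, 0)) fun _ => (0, 1)) := fun s => by
    have hprod : ∏ i, s.piecewise (fun _ => x.1) (fun _ => x.2) i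
        = x.1 ^ s.card * x.2 ^ (N - s.card) := by
      rw [prod_piecewise, univ_inter, prod_const, prod_const, card_sdiff_of_subset (subset_univ s),
        card_fin]
    rw [← hprod, ← f.map_smul_univ]
    congr 1
    funext i
    by_cases hi : i ∈ s <;> simp [hi]
  have hx : (fun _ : Fin N => x) = (fun _ => x.1 • ((1, 0) : ℂ × ℂ)) + fun _ => x.2 • (0, 1) := by
    funext i
    simp
  rw [hx, f.map_add_univ, ← powerset_univ, sum_powerset, card_fin,
    Nat.sum_antidiagonal_eq_sum_range_succ_mk]
  refine sum_congr rfl fun m _ => ?_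
  rw [monomialCoeff, smul_sum]
  exact sum_congr rfl fun s hs => by rw [hterm, (mem_powersetCard.1 hs).2]

lemma norm_monomialCoeff_le {N : ℕ} (f : ContinuousMultilinearMap ℂ (fun _ : Fin N => ℂ × ℂ) E)
    (m : ℕ) : ‖monomialCoeff f m‖ ≤ 2 ^ N * ‖f‖ := by
  have hterm : ∀ s : Finset (Fin N),
      ‖f (s.piecewise (fun _ => (1, 0)) fun _ => (0, 1))‖ ≤ ‖f‖ := fun s => by
    refine f.unit_le_opNorm ((pi_norm_le_iff_of_nonneg zero_le_one).2 fun i => ?_)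
    by_cases hi : i ∈ s <;> simp [hi, Prod.norm_def]
  calc ‖monomialCoeff f m‖ ≤ (powersetCard m (univ : Finset (Fin N))).card • ‖f‖ :=
        (norm_sum_le _ _).trans (sum_le_card_nsmul _ _ _ fun s _ => hterm s)
    _ ≤ 2 ^ N * ‖f‖ := by
        rw [card_powersetCard, card_fin, nsmul_eq_mul]
        gcongr
        exact_mod_cast Nat.choose_le_two_pow N m

variable [CompleteSpace E]

theorem exists_doubleSeries_eq {f : ℂ × ℂ → E} (hf : AnalyticAt ℂ f 0) :
    ∃ g : ℕ × ℕ → E, ∃ r > 0, DoubleSummable g r ∧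
      ∀ x ∈ Metric.ball 0 r, f x = doubleSeries g x := by
  obtain ⟨p, ρ, hp⟩ := hf
  obtain ⟨t, ht0, htρ⟩ := ENNReal.lt_iff_exists_nnreal_btwn.1 hp.r_pos
  have ht : (0 : ℝ) < t := by exact_mod_cast ht0
  obtain ⟨B, -, hB⟩ := p.norm_mul_pow_le_of_lt_radius (htρ.trans_le hp.r_le)
  let g : ℕ × ℕ → E := fun q => monomialCoeff (p (q.1 + q.2)) q.1
  have hg : DoubleSummable g (t / 4) := by
    refine doubleSummable_of_norm_le (r := t / 2) (B := B) (by positivity) (by linarith) fun q => ?_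
    calc ‖g q‖ * (t / 2) ^ (q.1 + q.2)
        ≤ 2 ^ (q.1 + q.2) * ‖p (q.1 + q.2)‖ * (t / 2) ^ (q.1 + q.2) := by
          gcongr
          exact norm_monomialCoeff_le _ _
      _ = ‖p (q.1 + q.2)‖ * t ^ (q.1 + q.2) := by
          rw [div_pow]; field_simp
      _ ≤ B := hB _
  refine ⟨g, t / 4, by positivity, hg, fun x hx => ?_⟩
  have hxt : ‖x‖ < t / 4 := mem_ball_zero_iff.1 hx
  have hfx : HasSum (fun N => p N fun _ => x) (f x) := by
    simpa only [zero_add] using hp.hasSum (y := x) (Metric.eball_subset_eball htρ.le (by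
      rw [Metric.eball_coe, mem_ball_zero_iff]; linarith))
  refine hfx.unique ?_
  convert hasSum_sum_antidiagonal (hg.hasSum hxt.le) using 2 with N
  rw [apply_diag_eq_sum_monomialCoeff]
  exact sum_congr rfl fun q hq => by rw [← mem_antidiagonal.1 hq]

end DoubleSeries

section EulerEquation

open Finset HasAntidiagonal

variable {𝔸 : Type*} [NormedRing 𝔸] [NormedAlgebra ℂ 𝔸] [CompleteSpace 𝔸]

lemma fderiv_euler_of_convolution_recursion {a g : ℕ × ℕ → 𝔸} {P : 𝔸 →L[ℂ] 𝔸} {c : ℂ} {r : ℝ}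
    (ha : DoubleSummable a r) (hg : DoubleSummable g r)
    (hrec : ∀ p : ℕ × ℕ,
      ((p.1 : ℂ) + c * p.2) • g p + P (g p) = ∑ q ∈ antidiagonal p, a q.1 * g q.2)
    {x : ℂ × ℂ} (hx : x ∈ Metric.ball 0 r) :
    fderiv ℂ (doubleSeries g) x (x.1, c * x.2)
      = doubleSeries a x * doubleSeries g x - P (doubleSeries g x) := by
  have hx' : ‖x‖ ≤ r := (mem_ball_zero_iff.1 hx).le
  have hsum := (hasSum_fderiv_euler hg c hx).add (P.hasSum (hg.hasSum hx'))
  simp only [map_smul, ← smul_add, hrec] at hsum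
  rw [doubleSeries_mul ha hg hx', eq_sub_iff_add_eq]
  exact hsum.tsum_eq.symm

/-- The Frobenius method: the coefficients of `Y` are determined by inverting the operators
`p.1 + c p.2 + P`, and the uniform bound on the inverses gives convergence. -/
theorem exists_euler_solution {A : ℂ × ℂ → 𝔸} (hA : AnalyticAt ℂ A 0) (hA0 : A 0 = 0)
    {P : 𝔸 →L[ℂ] 𝔸} {c : ℂ} {g₀ : 𝔸} (hg₀ : P g₀ = 0)
    (hP : ∃ C, ∀ p : ℕ × ℕ, p ≠ 0 → ∀ X, ∃ Y,
      ((p.1 : ℂ) + c * p.2) • Y + P Y = X ∧ ‖Y‖ ≤ C * ‖X‖) :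
    ∃ r > 0, ∃ Y : ℂ × ℂ → 𝔸, AnalyticOnNhd ℂ Y (Metric.ball 0 r) ∧ Y 0 = g₀ ∧
      ∀ x ∈ Metric.ball 0 r, fderiv ℂ Y x (x.1, c * x.2) = A x * Y x - P (Y x) := by
  obtain ⟨C, hP⟩ := hP
  choose! R hR hRC using hP
  obtain ⟨a, r, hr, ha, hAa⟩ := exists_doubleSeries_eq hA
  have ha0 : a 0 = 0 := by rw [← doubleSeries_zero a, ← hAa 0 (Metric.mem_ball_self hr), hA0]
  obtain ⟨g, hg0, hg⟩ := exists_convolution_recursion ha0 R g₀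
  obtain ⟨s, hs, hsr, hsmall⟩ :=
    exists_mul_tsum_norm_le_one ha hr ha0 (le_max_right C 0)
  have hbound := norm_le_of_convolution_recursion (w := fun p : ℕ × ℕ => s ^ (p.1 + p.2))
    (fun p => by positivity) (by simp) (fun p q => by simp only [Prod.fst_add, Prod.snd_add]; ring)
    ha0 hg (le_max_right C 0)
    (fun p hp X => (hRC p hp X).trans (by gcongr; exact le_max_left C 0))
    (ha.mono hs.le hsr) hsmall
  have hgs : DoubleSummable g (s / 2) :=
    doubleSummable_of_norm_le (by positivity) (half_lt_self hs) hbound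
  refine ⟨s / 2, by positivity, doubleSeries g, hgs.analyticOnNhd (by positivity),
    (doubleSeries_zero g).trans hg0, fun x hx => ?_⟩
  rw [hAa x (Metric.ball_subset_ball (by linarith) hx)]
  refine fderiv_euler_of_convolution_recursion (ha.mono (by positivity) (by linarith)) hgs
    (fun p => ?_) hx
  rcases eq_or_ne p 0 with rfl | hp
  · simp [hg0, hg₀, ha0]
  · rw [hg p hp]
    exact hR p hp _

end EulerEquation
section LinearODE

section Connectedness

variable {E : Type*} [NormedAddCommGroup E] [NormedSpace ℝ E] {U Z : Set E}

lemma isPreconnected_ball_diff_of_countable (hE : 1 < Module.rank ℝ E) (hZ : Z.Countable) (x : E)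
    {r : ℝ} (hr : 0 < r) : IsPreconnected (Metric.ball x r \ Z) := by
  let e := OpenPartialHomeomorph.univBall x r
  have hinj : Function.Injective e := fun y y' h => e.injOn (by simp [e]) (by simp [e]) h
  have himage : e '' (e ⁻¹' Z)ᶜ = Metric.ball x r \ Z := by
    rw [← Set.preimage_compl, Set.image_preimage_eq_inter_range, Set.inter_comm, ← Set.image_univ,
      ← OpenPartialHomeomorph.univBall_source x r, e.image_source_eq_target,
      OpenPartialHomeomorph.univBall_target x hr, Set.sdiff_eq]
  rw [← himage]
  exact ((hZ.preimage hinj).isConnected_compl_of_one_lt_rank hE).isPreconnected.image _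
    (OpenPartialHomeomorph.continuous_univBall x r).continuousOn

theorem isPreconnected_diff_of_countable (hE : 1 < Module.rank ℝ E) (hU : IsOpen U)
    (hU' : IsPreconnected U) (hZ : Z.Countable) : IsPreconnected (U \ Z) := by
  have : Nontrivial E := rank_pos_iff_nontrivial.1 (zero_lt_one.trans hE)
  -- It suffices to join nearby points of `U`, and these lie in a common ball.
  let Joined : E → E → Prop := fun x y => ∃ T ⊆ U \ Z, IsPreconnected T ∧
    (∃ r > 0, Metric.ball x r \ Z ⊆ T) ∧ ∃ r > 0, Metric.ball y r \ Z ⊆ T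
  have hjoined : ∀ x ∈ U, ∀ y ∈ U, Joined x y := by
    refine fun x hx y hy => hU'.induction₂ Joined (fun x hx => ?_) ?_ ?_ hx hy
    · obtain ⟨r, hr, hrU⟩ := Metric.isOpen_iff.1 hU x hx
      filter_upwards [nhdsWithin_le_nhds (Metric.ball_mem_nhds x hr)] with y hy
      obtain ⟨s, hs, hsr⟩ := Metric.isOpen_iff.1 Metric.isOpen_ball y hy
      exact ⟨_, Set.sdiff_subset_sdiff_left hrU, isPreconnected_ball_diff_of_countable hE hZ x hr,
        ⟨r, hr, subset_rfl⟩, s, hs, Set.sdiff_subset_sdiff_left hsr⟩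
    · rintro x y z - - - ⟨T, hTU, hT, hx, s, hs, hsT⟩ ⟨T', hTU', hT', ⟨s', hs', hsT'⟩, hz⟩
      obtain ⟨w, hw, hwZ⟩ := (hZ.dense_compl ℝ).inter_open_nonempty _
        (Metric.isOpen_ball (x := y) (ε := min s s'))
        ⟨y, Metric.mem_ball_self (lt_min hs hs')⟩
      have hwT : w ∈ T := hsT ⟨Metric.ball_subset_ball (min_le_left _ _) hw, hwZ⟩
      have hwT' : w ∈ T' := hsT' ⟨Metric.ball_subset_ball (min_le_right _ _) hw, hwZ⟩
      refine ⟨T ∪ T', Set.union_subset hTU hTU', hT.union w hwT hwT' hT', ?_, ?_⟩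
      · exact hx.imp fun r hr => ⟨hr.1, hr.2.trans Set.subset_union_left⟩
      · exact hz.imp fun r hr => ⟨hr.1, hr.2.trans Set.subset_union_right⟩
    · rintro x y - - ⟨T, hTU, hT, hx, hy⟩
      exact ⟨T, hTU, hT, hy, hx⟩
  refine isPreconnected_of_forall_pair fun x hx y hy => ?_
  obtain ⟨T, hTU, hT, ⟨r, hr, hrT⟩, s, hs, hsT⟩ := hjoined x hx.1 y hy.1
  exact ⟨T, hTU, hrT ⟨Metric.mem_ball_self hr, hx.2⟩, hsT ⟨Metric.mem_ball_self hs, hy.2⟩, hT⟩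

end Connectedness

variable {V : Type*} [NormedAddCommGroup V] [NormedSpace ℂ V]

/-- `φ` solves the linear differential equation `φ' = B φ` at every point of `U`. -/
def IsSolution (B : ℂ → V →L[ℂ] V) (φ : ℂ → V) (U : Set ℂ) : Prop :=
  ∀ ζ ∈ U, HasDerivAt φ (B ζ (φ ζ)) ζ

/-- Every initial value at every point of `U` is attained by a single-valued solution of
`φ' = B φ` on `U`. -/
def IsSolvableOn (B : ℂ → V →L[ℂ] V) (U : Set ℂ) : Prop :=
  ∀ ζ₁ ∈ U, ∀ w : V, ∃ φ : ℂ → V, φ ζ₁ = w ∧ IsSolution B φ U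

variable {B : ℂ → V →L[ℂ] V} {φ ψ : ℂ → V} {U W Z : Set ℂ}

lemma IsSolution.mono (h : IsSolution B φ U) (hW : W ⊆ U) : IsSolution B φ W :=
  fun ζ hζ => h ζ (hW hζ)

lemma IsSolvableOn.mono (h : IsSolvableOn B U) (hW : W ⊆ U) : IsSolvableOn B W :=
  fun ζ₁ hζ₁ w => (h ζ₁ (hW hζ₁) w).imp fun _ hφ => ⟨hφ.1, hφ.2.mono hW⟩

lemma IsSolution.sub (h : IsSolution B φ U) (h' : IsSolution B ψ U) :
    IsSolution B (fun ζ => φ ζ - ψ ζ) U := fun ζ hζ => by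
  rw [map_sub]
  exact (h ζ hζ).sub (h' ζ hζ)

/-- Grönwall's inequality along the segment from `ζ₁` to `ζ`. -/
lemma IsSolution.eqOn_zero_of_convex (hU : Convex ℝ U) (hB : ContinuousOn B U)
    (h : IsSolution B φ U) {ζ₁ : ℂ} (h₁ : ζ₁ ∈ U) (h0 : φ ζ₁ = 0) : Set.EqOn φ 0 U := by
  intro ζ hζ
  let γ : ℝ → ℂ := fun t => AffineMap.lineMap ζ₁ ζ t
  have hγ : ∀ t ∈ Set.Icc (0 : ℝ) 1, γ t ∈ U := fun t ht => hU.lineMap_mem h₁ hζ ht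
  have hγc : Continuous γ := AffineMap.lineMap_continuous
  obtain ⟨K, hK⟩ := isCompact_Icc.exists_bound_of_continuousOn (hB.comp hγc.continuousOn hγ)
  have hderiv : ∀ t ∈ Set.Icc (0 : ℝ) 1,
      HasDerivAt (φ ∘ γ) ((ζ - ζ₁) • B (γ t) (φ (γ t))) t := fun t ht =>
    (h _ (hγ t ht)).scomp t AffineMap.hasDerivAt_lineMap
  have hbound : ∀ t ∈ Set.Ico (0 : ℝ) 1,
      ‖(ζ - ζ₁) • B (γ t) (φ (γ t))‖ ≤ ‖ζ - ζ₁‖ * K * ‖(φ ∘ γ) t‖ := fun t ht => by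
    rw [norm_smul, mul_assoc]
    gcongr
    exact (B (γ t)).le_of_opNorm_le (hK t ⟨ht.1, ht.2.le⟩) _
  simpa [γ] using eq_zero_of_abs_deriv_le_mul_abs_self_of_eq_zero_right
    (fun t ht => (hderiv t ht).continuousAt.continuousWithinAt)
    (fun t ht => (hderiv t ⟨ht.1, ht.2.le⟩).hasDerivWithinAt) (by simp [γ, h0]) hbound
    1 ⟨zero_le_one, le_rfl⟩

lemma IsSolution.exists_glue {ι : Type*} {U : ι → Set ℂ} (hU : ∀ i, IsOpen (U i))
    {φ : ι → ℂ → V} (h : ∀ i, IsSolution B (φ i) (U i))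
    (hag : ∀ i j, Set.EqOn (φ i) (φ j) (U i ∩ U j)) :
    ∃ ψ : ℂ → V, IsSolution B ψ (⋃ i, U i) ∧ ∀ i, Set.EqOn ψ (φ i) (U i) := by
  classical
  let ψ : ℂ → V := fun ζ => if hζ : ∃ i, ζ ∈ U i then φ hζ.choose ζ else 0
  have hψ : ∀ i, Set.EqOn ψ (φ i) (U i) := fun i ζ hζ => by
    have hex : ∃ i, ζ ∈ U i := ⟨i, hζ⟩
    simp only [ψ, hex, dif_pos]
    exact hag _ _ ⟨hex.choose_spec, hζ⟩
  refine ⟨ψ, fun ζ hζ => ?_, hψ⟩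
  obtain ⟨i, hi⟩ := Set.mem_iUnion.1 hζ
  rw [hψ i hi]
  exact (h i ζ hi).congr_of_eventuallyEq ((hψ i).eventuallyEq_of_mem ((hU i).mem_nhds hi))

variable [CompleteSpace V]

lemma IsSolution.analyticOnNhd (hU : IsOpen U) (h : IsSolution B φ U) : AnalyticOnNhd ℂ φ U :=
  DifferentiableOn.analyticOnNhd
    (fun ζ hζ => (h ζ hζ).differentiableAt.differentiableWithinAt) hU

theorem IsSolution.eqOn_of_isPreconnected (hU : IsOpen U) (hU' : IsPreconnected U)
    (hB : ContinuousOn B U) (h : IsSolution B φ U) (h' : IsSolution B ψ U) {ζ₁ : ℂ}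
    (h₁ : ζ₁ ∈ U) (he : φ ζ₁ = ψ ζ₁) : Set.EqOn φ ψ U := by
  obtain ⟨ε, hε, hεU⟩ := Metric.isOpen_iff.1 hU ζ₁ h₁
  refine (h.analyticOnNhd hU).eqOn_of_preconnected_of_eventuallyEq (h'.analyticOnNhd hU) hU' h₁ ?_
  filter_upwards [Metric.ball_mem_nhds ζ₁ hε] with ζ hζ
  exact sub_eq_zero.1 <| ((h.sub h').mono hεU).eqOn_zero_of_convex (convex_ball ζ₁ ε)
    (hB.mono hεU) (Metric.mem_ball_self hε) (sub_eq_zero.2 he) hζ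

section Monodromy

lemma IsSolution.eqOn_diff (hZ : IsClosed Z) (hZc : Z.Countable) (hB : ContinuousOn B Zᶜ)
    (hU : IsOpen U) (hU' : IsPreconnected U) (h : IsSolution B φ (U \ Z))
    (h' : IsSolution B ψ (U \ Z)) {ζ₁ : ℂ} (h₁ : ζ₁ ∈ U \ Z) (he : φ ζ₁ = ψ ζ₁) :
    Set.EqOn φ ψ (U \ Z) :=
  h.eqOn_of_isPreconnected (hU.sdiff hZ)
    (isPreconnected_diff_of_countable (by rw [Complex.rank_real_complex]; norm_num) hU hU' hZc)
    (hB.mono fun _ hζ => hζ.2) h' h₁ he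

lemma IsSolvableOn.iUnion_of_monotone {U : ℕ → Set ℂ} (hU : ∀ n, IsOpen (U n))
    (hU' : ∀ n, IsPreconnected (U n)) (hmono : Monotone U) (hZ : IsClosed Z) (hZc : Z.Countable)
    (hB : ContinuousOn B Zᶜ) (h : ∀ n, IsSolvableOn B (U n \ Z)) :
    IsSolvableOn B ((⋃ n, U n) \ Z) := by
  rintro ζ₁ ⟨hζ₁, hζ₁Z⟩ w
  obtain ⟨N, hN⟩ := Set.mem_iUnion.1 hζ₁
  have hmem : ∀ n, ζ₁ ∈ U (N + n) \ Z := fun n => ⟨hmono (Nat.le_add_right N n) hN, hζ₁Z⟩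
  choose φ hφ₁ hφ using fun n => h (N + n) ζ₁ (hmem n) w
  have hagree : ∀ m n, m ≤ n → Set.EqOn (φ m) (φ n) (U (N + m) \ Z) := fun m n hmn =>
    (hφ m).eqOn_diff hZ hZc hB (hU _) (hU' _)
      ((hφ n).mono (Set.sdiff_subset_sdiff_left (hmono (by gcongr)))) (hmem m)
      ((hφ₁ m).trans (hφ₁ n).symm)
  obtain ⟨ψ, hψ, hψφ⟩ := IsSolution.exists_glue (fun n => (hU (N + n)).sdiff hZ) hφ fun m n ζ hζ =>
    (le_total m n).elim (fun hmn => hagree m n hmn hζ.1) fun hnm => (hagree n m hnm hζ.2).symm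
  refine ⟨ψ, (hψφ 0 (hmem 0)).trans (hφ₁ 0), hψ.mono ?_⟩
  rintro ζ ⟨hζ, hζZ⟩
  obtain ⟨n, hn⟩ := Set.mem_iUnion.1 hζ
  exact Set.mem_iUnion.2 ⟨n, hmono (Nat.le_add_left n N) hn, hζZ⟩

lemma IsSolvableOn.union (hU : IsOpen U) (hW : IsOpen W) (hUW : IsPreconnected (U ∩ W))
    (hne : (U ∩ W).Nonempty) (hZ : IsClosed Z) (hZc : Z.Countable) (hB : ContinuousOn B Zᶜ)
    (h : IsSolvableOn B (U \ Z)) (h' : IsSolvableOn B (W \ Z)) :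
    IsSolvableOn B ((U ∪ W) \ Z) := by
  intro ζ₁ hζ₁ w
  wlog hζ₁U : ζ₁ ∈ U generalizing U W
  · rw [Set.union_comm] at hζ₁ ⊢
    rw [Set.inter_comm] at hUW hne
    exact this hW hU hUW hne h' h hζ₁ (hζ₁.1.resolve_right hζ₁U)
  obtain ⟨φ, hφ₁, hφ⟩ := h ζ₁ ⟨hζ₁U, hζ₁.2⟩ w
  obtain ⟨ζ₂, ⟨hζ₂U, hζ₂W⟩, hζ₂Z⟩ :=
    (hZc.dense_compl ℝ).inter_open_nonempty _ (hU.inter hW) hne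
  obtain ⟨ψ, hψ₂, hψ⟩ := h' ζ₂ ⟨hζ₂W, hζ₂Z⟩ (φ ζ₂)
  have hagree : Set.EqOn φ ψ ((U ∩ W) \ Z) :=
    (hφ.mono (Set.sdiff_subset_sdiff_left Set.inter_subset_left)).eqOn_diff hZ hZc hB (hU.inter hW)
      hUW (hψ.mono (Set.sdiff_subset_sdiff_left Set.inter_subset_right))
      ⟨⟨hζ₂U, hζ₂W⟩, hζ₂Z⟩ hψ₂.symm
  obtain ⟨χ, hχ, hχφ⟩ := IsSolution.exists_glue (U := fun i => bif i then U \ Z else W \ Z)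
    (φ := fun i => bif i then φ else ψ) (B := B)
    (Bool.forall_bool.2 ⟨hW.sdiff hZ, hU.sdiff hZ⟩) (Bool.forall_bool.2 ⟨hψ, hφ⟩)
    (Bool.forall_bool.2 ⟨Bool.forall_bool.2 ⟨fun _ _ => rfl, fun ζ hζ =>
      (hagree ⟨⟨hζ.2.1, hζ.1.1⟩, hζ.1.2⟩).symm⟩, Bool.forall_bool.2 ⟨fun ζ hζ =>
      hagree ⟨⟨hζ.1.1, hζ.2.1⟩, hζ.1.2⟩, fun _ _ => rfl⟩⟩)
  refine ⟨χ, (hχφ true ⟨hζ₁U, hζ₁.2⟩).trans hφ₁, hχ.mono fun ζ hζ => Set.mem_iUnion.2 ?_⟩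
  exact hζ.1.elim (fun hζU => ⟨true, hζU, hζ.2⟩) fun hζW => ⟨false, hζW, hζ.2⟩

/-- Subdivide `(a, b)` into steps shorter than a Lebesgue number of the cover by good intervals. -/
theorem forall_interval_of_local {P : ℝ → ℝ → Prop}
    (hmono : ∀ ⦃a b a' b'⦄, a ≤ a' → b' ≤ b → P a b → P a' b')
    (hglue : ∀ ⦃a b c d⦄, a < b → b < c → c < d → P a c → P b d → P a d)
    (hloc : ∀ x, ∃ ε > 0, P (x - ε) (x + ε)) (a b : ℝ) : P a b := by
  choose ε hε hP using hloc
  rcases lt_or_ge b a with hba | hab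
  · exact hmono (by linarith [hε a]) (by linarith [hε a]) (hP a)
  obtain ⟨δ, hδ, hLebesgue⟩ := lebesgue_number_lemma_of_metric (isCompact_Icc (a := a) (b := b))
    (fun x => Metric.isOpen_ball (x := x) (ε := ε x))
    fun x _ => Set.mem_iUnion.2 ⟨x, Metric.mem_ball_self (hε x)⟩
  set η := δ / 2
  have hstep : ∀ x ∈ Set.Icc a b, P (x - η) (x + η) := fun x hx => by
    obtain ⟨y, hy⟩ := hLebesgue x hx
    have hl : x - η ∈ Metric.ball y (ε y) := hy (by simp [abs_of_pos hδ, η, hδ])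
    have hr : x + η ∈ Metric.ball y (ε y) := hy (by simp [abs_of_pos hδ, η, hδ])
    rw [Real.ball_eq_Ioo] at hl hr
    exact hmono hl.1.le hr.2.le (hP y)
  have hsteps : ∀ n : ℕ, a + n * η ≤ b → P (a - η) (a + n * η + η) := fun n => by
    have hη0 : 0 < η := half_pos hδ
    induction n with
    | zero => exact fun _ => by simpa using hstep a ⟨le_rfl, hab⟩
    | succ n ih =>
      intro hn
      have hnη : 0 ≤ n * η := by positivity
      push_cast at hn ⊢
      refine hglue (b := a + (n + 1) * η - η) (c := a + n * η + η) ?_ ?_ ?_ (ih ?_)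
        (hstep _ ⟨?_, hn⟩) <;> linarith
  have hη0 : 0 < η := half_pos hδ
  have hfloor := Nat.floor_le (div_nonneg (sub_nonneg.2 hab) hη0.le)
  have hlt := Nat.lt_floor_add_one ((b - a) / η)
  rw [le_div_iff₀ hη0] at hfloor
  rw [div_lt_iff₀ hη0] at hlt
  exact hmono (by linarith) (by linarith) (hsteps ⌊(b - a) / η⌋₊ (by linarith))

/-- The open rectangle `(a, b) × (c, d)` of the complex plane. -/
def openRect (a b c d : ℝ) : Set ℂ := Set.Ioo a b ×ℂ Set.Ioo c d

lemma isOpen_openRect (a b c d : ℝ) : IsOpen (openRect a b c d) := isOpen_Ioo.reProdIm isOpen_Ioo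

lemma isPreconnected_openRect (a b c d : ℝ) : IsPreconnected (openRect a b c d) :=
  (((convex_Ioo a b).linear_preimage Complex.reLm).inter
    ((convex_Ioo c d).linear_preimage Complex.imLm)).isPreconnected

lemma openRect_inter (a b c d a' b' c' d' : ℝ) : openRect a b c d ∩ openRect a' b' c' d'
    = openRect (max a a') (min b b') (max c c') (min d d') := by
  ext ζ
  simp only [openRect, Set.mem_inter_iff, Complex.mem_reProdIm, Set.mem_Ioo, max_lt_iff, lt_min_iff]
  tauto

lemma openRect_nonempty {a b c d : ℝ} (hab : a < b) (hcd : c < d) : (openRect a b c d).Nonempty :=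
  Complex.reProdIm_nonempty.2 ⟨Set.nonempty_Ioo.2 hab, Set.nonempty_Ioo.2 hcd⟩

lemma openRect_subset {a b c d a' b' c' d' : ℝ} (ha : a' ≤ a) (hb : b ≤ b') (hc : c' ≤ c)
    (hd : d ≤ d') : openRect a b c d ⊆ openRect a' b' c' d' :=
  Complex.reProdIm_subset_iff.2 <|
    Set.prod_mono (Set.Ioo_subset_Ioo ha hb) (Set.Ioo_subset_Ioo hc hd)

lemma IsSolvableOn.union_openRect (hZ : IsClosed Z) (hZc : Z.Countable) (hB : ContinuousOn B Zᶜ)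
    {a b c d a' b' c' d' : ℝ} (hab : max a a' < min b b') (hcd : max c c' < min d d')
    (h : IsSolvableOn B (openRect a b c d \ Z)) (h' : IsSolvableOn B (openRect a' b' c' d' \ Z)) :
    IsSolvableOn B ((openRect a b c d ∪ openRect a' b' c' d') \ Z) := by
  refine h.union (isOpen_openRect _ _ _ _) (isOpen_openRect _ _ _ _) ?_ ?_ hZ hZc hB h' <;>
    rw [openRect_inter]
  exacts [isPreconnected_openRect _ _ _ _, openRect_nonempty hab hcd]

theorem exists_isSolvableOn_strip (hZ : IsClosed Z) (hZc : Z.Countable) (hB : ContinuousOn B Zᶜ)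
    (hloc : ∀ ζ₀ : ℂ, ∃ ε > 0, IsSolvableOn B (Metric.ball ζ₀ ε \ Z)) (x c d : ℝ) :
    ∃ ε > 0, IsSolvableOn B (openRect (x - ε) (x + ε) c d \ Z) := by
  refine forall_interval_of_local (P := fun c d => ∃ ε > 0,
    IsSolvableOn B (openRect (x - ε) (x + ε) c d \ Z)) ?_ ?_ (fun y => ?_) c d
  · rintro c d c' d' hc hd ⟨ε, hε, h⟩
    exact ⟨ε, hε, h.mono (Set.sdiff_subset_sdiff_left (openRect_subset le_rfl le_rfl hc hd))⟩
  · rintro c₀ c₁ c₂ c₃ h₀₁ h₁₂ h₂₃ ⟨ε, hε, h⟩ ⟨ε', hε', h'⟩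
    refine ⟨min ε ε', lt_min hε hε', (h.union_openRect hZ hZc hB ?_ ?_ h').mono
      (Set.sdiff_subset_sdiff_left fun ζ hζ => ?_)⟩
    · simp only [max_lt_iff, lt_min_iff]
      refine ⟨⟨?_, ?_⟩, ?_, ?_⟩ <;> linarith
    · rwa [max_eq_right h₀₁.le, min_eq_left h₂₃.le]
    · have hε₁ := min_le_left ε ε'
      have hε₂ := min_le_right ε ε'
      rcases lt_or_ge ζ.im c₂ with hlt | hge
      · exact .inl ⟨⟨by linarith [hζ.1.1], by linarith [hζ.1.2]⟩, hζ.2.1, hlt⟩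
      · exact .inr ⟨⟨by linarith [hζ.1.1], by linarith [hζ.1.2]⟩, h₁₂.trans_le hge, hζ.2.2⟩
  · obtain ⟨ε, hε, h⟩ := hloc ⟨x, y⟩
    refine ⟨ε / 2, half_pos hε, ε / 2, half_pos hε,
      h.mono (Set.sdiff_subset_sdiff_left fun ζ hζ => ?_)⟩
    rw [mem_ball_iff_norm]
    refine (Complex.norm_le_abs_re_add_abs_im _).trans_lt ?_
    have hre : |ζ.re - x| < ε / 2 := abs_sub_lt_iff.2 ⟨by linarith [hζ.1.2], by linarith [hζ.1.1]⟩
    have him : |ζ.im - y| < ε / 2 := abs_sub_lt_iff.2 ⟨by linarith [hζ.2.2], by linarith [hζ.2.1]⟩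
    simpa using add_lt_add hre him

theorem isSolvableOn_openRect_diff (hZ : IsClosed Z) (hZc : Z.Countable) (hB : ContinuousOn B Zᶜ)
    (hloc : ∀ ζ₀ : ℂ, ∃ ε > 0, IsSolvableOn B (Metric.ball ζ₀ ε \ Z)) (a b c d : ℝ) :
    IsSolvableOn B (openRect a b c d \ Z) := by
  rcases le_or_gt d c with hdc | hcd
  · exact fun ζ hζ => absurd (hζ.1.2.1.trans hζ.1.2.2) hdc.not_gt
  refine forall_interval_of_local (P := fun a b => IsSolvableOn B (openRect a b c d \ Z)) ?_ ?_
    (fun x => exists_isSolvableOn_strip hZ hZc hB hloc x c d) a b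
  · exact fun a b a' b' ha hb h =>
      h.mono (Set.sdiff_subset_sdiff_left (openRect_subset ha hb le_rfl le_rfl))
  · intro a₀ a₁ a₂ a₃ h₀₁ h₁₂ h₂₃ h h'
    refine (h.union_openRect hZ hZc hB ?_ ?_ h').mono (Set.sdiff_subset_sdiff_left fun ζ hζ => ?_)
    · rwa [max_eq_right h₀₁.le, min_eq_left h₂₃.le]
    · rwa [max_self, min_self]
    · rcases lt_or_ge ζ.re a₂ with hlt | hge
      · exact .inl ⟨⟨hζ.1.1, hlt⟩, hζ.2⟩
      · exact .inr ⟨⟨h₁₂.trans_le hge, hζ.1.2⟩, hζ.2⟩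

theorem isSolvableOn_compl (hZ : IsClosed Z) (hZc : Z.Countable) (hB : ContinuousOn B Zᶜ)
    (hloc : ∀ ζ₀ : ℂ, ∃ ε > 0, IsSolvableOn B (Metric.ball ζ₀ ε \ Z)) : IsSolvableOn B Zᶜ := by
  have hrect : (⋃ n : ℕ, openRect (-n) n (-n) n) = Set.univ := by
    refine Set.eq_univ_of_forall fun ζ => Set.mem_iUnion.2 ?_
    obtain ⟨n, hn⟩ := exists_nat_gt ‖ζ‖
    exact ⟨n, abs_lt.1 ((Complex.abs_re_le_norm ζ).trans_lt hn),
      abs_lt.1 ((Complex.abs_im_le_norm ζ).trans_lt hn)⟩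
  have hmono : Monotone fun n : ℕ => openRect (-n) n (-n) n := fun m n hmn => by
    have hmn' : (m : ℝ) ≤ n := by exact_mod_cast hmn
    exact openRect_subset (neg_le_neg hmn') hmn' (neg_le_neg hmn') hmn'
  rw [Set.compl_eq_univ_sdiff, ← hrect]
  exact IsSolvableOn.iUnion_of_monotone (fun n => isOpen_openRect _ _ _ _)
    (fun n => isPreconnected_openRect _ _ _ _) hmono hZ hZc hB
    fun n => isSolvableOn_openRect_diff hZ hZc hB hloc _ _ _ _

end Monodromy

end LinearODE
section Propagator

lemma mul_clm_apply {V : Type*} [NormedAddCommGroup V] [NormedSpace ℂ V] (A B : V →L[ℂ] V) (x : V) :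
    (A * B) x = A (B x) := rfl

lemma inverse_apply_apply {V : Type*} [NormedAddCommGroup V] [NormedSpace ℂ V] {A : V →L[ℂ] V}
    (hA : IsUnit A) (v : V) : Ring.inverse A (A v) = v := by
  rw [← mul_clm_apply, Ring.inverse_mul_cancel _ hA]; rfl

lemma apply_inverse_apply {V : Type*} [NormedAddCommGroup V] [NormedSpace ℂ V] {A : V →L[ℂ] V}
    (hA : IsUnit A) (v : V) : A (Ring.inverse A v) = v := by
  rw [← mul_clm_apply, Ring.mul_inverse_cancel _ hA]; rfl

lemma analyticAt_clm_apply {X V : Type*} [NormedAddCommGroup X] [NormedSpace ℂ X]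
    [NormedAddCommGroup V] [NormedSpace ℂ V] {A : X → V →L[ℂ] V} {f : X → V} {x : X}
    (hA : AnalyticAt ℂ A x) (hf : AnalyticAt ℂ f x) : AnalyticAt ℂ (fun y => A y (f y)) x :=
  AnalyticAt.fun_comp (g := fun p : (V →L[ℂ] V) × V => p.1 p.2) (f := fun y => (A y, f y))
    ((ContinuousLinearMap.id ℂ (V →L[ℂ] V)).analyticAt_bilinear (A x, f x)) (hA.prod hf)

lemma exists_degree_smul_eq {E : Type*} [NormedAddCommGroup E] [NormedSpace ℂ E] {p : ℕ × ℕ}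
    (hp : p ≠ 0) (X : E) :
    ∃ Y, ((p.1 : ℂ) + p.2) • Y = X ∧ ‖Y‖ ≤ ‖X‖ := by
  have hdeg : 1 ≤ p.1 + p.2 := Nat.one_le_iff_ne_zero.2 fun h =>
    hp (Prod.ext (Nat.add_eq_zero_iff.1 h).1 (Nat.add_eq_zero_iff.1 h).2)
  rw [← Nat.cast_add]
  refine ⟨((p.1 + p.2 : ℕ) : ℂ)⁻¹ • X, smul_inv_smul₀ (Nat.cast_ne_zero.2 (by omega)) X, ?_⟩
  rw [norm_smul, norm_inv, Complex.norm_natCast]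
  exact mul_le_of_le_one_left (norm_nonneg X) (inv_le_one_of_one_le₀ (by exact_mod_cast hdeg))

lemma mem_ball_zero_of_mem_prod {r y : ℝ} {p : ℂ × ℂ}
    (hp : p ∈ Metric.ball (0 : ℂ) (r / max 1 y) ×ˢ Metric.ball (0 : ℂ) y) :
    (p.1, p.2 * p.1) ∈ Metric.ball (0 : ℂ × ℂ) r := by
  obtain ⟨ht, hlam⟩ := hp
  have hm : (0 : ℝ) < max 1 y := by positivity
  rw [mem_ball_zero_iff, lt_div_iff₀ hm] at ht
  rw [mem_ball_zero_iff] at hlam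
  rw [mem_ball_zero_iff, Prod.norm_def, max_lt_iff, norm_mul]
  constructor
  · exact (le_mul_of_one_le_right (norm_nonneg _) (le_max_left 1 y)).trans_lt ht
  · rw [mul_comm]
    exact lt_of_le_of_lt (by gcongr; exact hlam.le.trans (le_max_right 1 y)) ht

section Algebra

variable {𝔸 : Type*} [NormedRing 𝔸] [NormedAlgebra ℂ 𝔸] [CompleteSpace 𝔸] {B₀ B₁ : ℂ → 𝔸}

/-- At a regular point the equation is the Euler equation with `P = 0` and `c = 1` along the curves
`t ↦ (t, λ t)`. -/
lemma exists_propagator_zero (h₀ : AnalyticAt ℂ B₀ 0) (h₁ : AnalyticAt ℂ B₁ 0) (y : ℝ) :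
    ∃ ε > 0, ∃ U : ℂ × ℂ → 𝔸, AnalyticOnNhd ℂ U (Metric.ball 0 ε ×ˢ Metric.ball 0 y) ∧
      (∀ lam, U (0, lam) = 1) ∧
      ∀ t ∈ Metric.ball (0 : ℂ) ε, ∀ lam ∈ Metric.ball (0 : ℂ) y,
        t • deriv (fun t => U (t, lam)) t = t • ((B₀ t + lam • B₁ t) * U (t, lam)) := by
  let A : ℂ × ℂ → 𝔸 := fun x => x.1 • B₀ x.1 + x.2 • B₁ x.1
  have hA : AnalyticAt ℂ A 0 :=
    (analyticAt_fst.smul (AnalyticAt.fun_comp (g := B₀) h₀ analyticAt_fst)).add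
      (analyticAt_snd.smul (AnalyticAt.fun_comp (g := B₁) h₁ analyticAt_fst))
  obtain ⟨r, hr, Y, hY, hY0, hYd⟩ := exists_euler_solution (P := 0) (c := 1) (g₀ := 1) hA
    (by simp [A]) rfl ⟨1, fun p hp X => by simpa using exists_degree_smul_eq hp X⟩
  refine ⟨r / max 1 y, by positivity, fun p => Y (p.1, p.2 * p.1), fun p hp => ?_, fun lam => ?_,
    fun t ht lam hlam => ?_⟩
  · exact AnalyticAt.fun_comp (g := Y) (hY _ (mem_ball_zero_of_mem_prod hp))
      (analyticAt_fst.prod (analyticAt_snd.mul analyticAt_fst))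
  · change Y (0, lam * 0) = 1
    rw [mul_zero, ← Prod.zero_eq_mk, hY0]
  · have hx := mem_ball_zero_of_mem_prod (p := (t, lam)) ⟨ht, hlam⟩
    have hcurve : HasDerivAt (fun t : ℂ => (t, lam * t)) (1, lam) t := by
      simpa using (hasDerivAt_id t).prodMk ((hasDerivAt_id t).const_mul lam)
    have hd := ((hY _ hx).differentiableAt.hasFDerivAt.comp_hasDerivAt t hcurve).deriv
    have hfd := hYd _ hx
    rw [show ((t, lam * t).1, 1 * (t, lam * t).2) = t • ((1 : ℂ), lam) by simp [mul_comm],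
      map_smul] at hfd
    refine (congrArg (t • ·) hd).trans (hfd.trans ?_)
    simp [A, mul_smul, add_mul, smul_comm lam t]

lemma exists_propagator {ζ₀ : ℂ} (h₀ : AnalyticAt ℂ B₀ ζ₀) (h₁ : AnalyticAt ℂ B₁ ζ₀) (y : ℝ) :
    ∃ ε > 0, ∃ U : ℂ × ℂ → 𝔸, AnalyticOnNhd ℂ U (Metric.ball ζ₀ ε ×ˢ Metric.ball 0 y) ∧
      (∀ lam, U (ζ₀, lam) = 1) ∧
      ∀ ζ ∈ Metric.ball ζ₀ ε, ∀ lam ∈ Metric.ball (0 : ℂ) y,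
        HasDerivAt (fun ζ => U (ζ, lam)) ((B₀ ζ + lam • B₁ ζ) * U (ζ, lam)) ζ := by
  have hshift {B : ℂ → 𝔸} (hB : AnalyticAt ℂ B ζ₀) : AnalyticAt ℂ (fun t => B (ζ₀ + t)) 0 :=
    AnalyticAt.fun_comp (g := B) (by simpa using hB) (by fun_prop)
  obtain ⟨ε, hε, U, hU, hU0, hUd⟩ := exists_propagator_zero (hshift h₀) (hshift h₁) y
  have hmem {ζ : ℂ} (hζ : ζ ∈ Metric.ball ζ₀ ε) : ζ - ζ₀ ∈ Metric.ball (0 : ℂ) ε := by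
    simpa [dist_eq_norm] using hζ
  refine ⟨ε, hε, fun p => U (p.1 - ζ₀, p.2), fun p hp => ?_, fun lam => by simp [hU0],
    fun ζ hζ lam hlam => ?_⟩
  · exact AnalyticAt.fun_comp (g := U) (hU (p.1 - ζ₀, p.2) ⟨hmem hp.1, hp.2⟩)
      ((analyticAt_fst.sub analyticAt_const).prod analyticAt_snd)
  have han {t : ℂ} (ht : t ∈ Metric.ball (0 : ℂ) ε) : AnalyticAt ℂ (fun t => U (t, lam)) t :=
    AnalyticAt.fun_comp (g := U) (hU (t, lam) ⟨ht, hlam⟩) (by fun_prop)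
  have hne : deriv (fun t => U (t, lam)) =ᶠ[𝓝[≠] 0]
      fun t => (B₀ (ζ₀ + t) + lam • B₁ (ζ₀ + t)) * U (t, lam) := by
    filter_upwards [self_mem_nhdsWithin, nhdsWithin_le_nhds (Metric.ball_mem_nhds 0 hε)]
      with t ht0 ht
    exact smul_right_injective 𝔸 ht0 (hUd t ht lam hlam)
  have hd {t : ℂ} (ht : t ∈ Metric.ball (0 : ℂ) ε) : deriv (fun t => U (t, lam)) t
      = (B₀ (ζ₀ + t) + lam • B₁ (ζ₀ + t)) * U (t, lam) := by
    rcases eq_or_ne t 0 with rfl | ht0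
    · exact ((han ht).deriv.continuousAt.eventuallyEq_nhds_iff_eventuallyEq_nhdsNE
        (((hshift h₀).continuousAt.add ((hshift h₁).continuousAt.const_smul lam)).mul
          (han ht).continuousAt)).1 hne |>.self_of_nhds
    · exact smul_right_injective 𝔸 ht0 (hUd t ht lam hlam)
  have h := ((han (hmem hζ)).differentiableAt.hasDerivAt).comp_sub_const ζ ζ₀
  rwa [hd (hmem hζ), add_sub_cancel] at h

theorem exists_invertible_propagator {ζ₀ : ℂ} (h₀ : AnalyticAt ℂ B₀ ζ₀) (h₁ : AnalyticAt ℂ B₁ ζ₀)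
    (y : ℝ) :
    ∃ ε > 0, ∃ U : ℂ × ℂ → 𝔸, AnalyticOnNhd ℂ U (Metric.ball ζ₀ ε ×ˢ Metric.ball 0 y) ∧
      (∀ p ∈ Metric.ball ζ₀ ε ×ˢ Metric.ball (0 : ℂ) y, IsUnit (U p)) ∧
      (∀ lam, U (ζ₀, lam) = 1) ∧
      ∀ ζ ∈ Metric.ball ζ₀ ε, ∀ lam ∈ Metric.ball (0 : ℂ) y,
        HasDerivAt (fun ζ => U (ζ, lam)) ((B₀ ζ + lam • B₁ ζ) * U (ζ, lam)) ζ := by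
  obtain ⟨ε, hε, U, hU, hU1, hUd⟩ := exists_propagator h₀ h₁ (y + 1)
  have hopen : IsOpen ((Metric.ball ζ₀ ε ×ˢ Metric.ball (0 : ℂ) (y + 1)) ∩
      U ⁻¹' {A | IsUnit A}) :=
    hU.continuousOn.isOpen_inter_preimage (Metric.isOpen_ball.prod Metric.isOpen_ball)
      Units.isOpen
  have hy : Metric.closedBall (0 : ℂ) y ⊆ Metric.ball 0 (y + 1) :=
    Metric.closedBall_subset_ball (by linarith)
  have hcenter : ({ζ₀} : Set ℂ) ×ˢ Metric.closedBall (0 : ℂ) y ⊆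
      (Metric.ball ζ₀ ε ×ˢ Metric.ball (0 : ℂ) (y + 1)) ∩ U ⁻¹' {A | IsUnit A} := by
    rintro ⟨ζ, lam⟩ ⟨rfl, hlam⟩
    refine ⟨⟨Metric.mem_ball_self hε, hy hlam⟩, ?_⟩
    rw [Set.mem_preimage, hU1]
    exact isUnit_one
  obtain ⟨u, w, hu, -, hu', hw, huw⟩ := generalized_tube_lemma isCompact_singleton
    (isCompact_closedBall (0 : ℂ) y) hopen hcenter
  obtain ⟨δ, hδ, hδu⟩ := Metric.isOpen_iff.1 hu ζ₀ (hu' rfl)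
  have hsub : Metric.ball ζ₀ δ ×ˢ Metric.ball (0 : ℂ) y ⊆
      (Metric.ball ζ₀ ε ×ˢ Metric.ball (0 : ℂ) (y + 1)) ∩ U ⁻¹' {A | IsUnit A} :=
    (Set.prod_mono hδu (Metric.ball_subset_closedBall.trans hw)).trans huw
  exact ⟨δ, hδ, U, hU.mono fun p hp => (hsub hp).1, fun p hp => (hsub hp).2, hU1,
    fun ζ hζ lam hlam =>
      have h := (hsub (Set.mk_mem_prod hζ hlam)).1
      hUd ζ h.1 lam h.2⟩

end Algebra

section Family

variable {V : Type*} [NormedAddCommGroup V] [NormedSpace ℂ V] {B₀ B₁ : ℂ → V →L[ℂ] V} {U : Set ℂ}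

lemma continuousOn_pencil (h₀ : AnalyticOnNhd ℂ B₀ U) (h₁ : AnalyticOnNhd ℂ B₁ U) (lam : ℂ) :
    ContinuousOn (fun ζ => B₀ ζ + lam • B₁ ζ) U :=
  h₀.continuousOn.add (h₁.continuousOn.const_smul lam)

variable [CompleteSpace V]

lemma exists_isSolvableOn_ball {ζ₀ : ℂ} (h₀ : AnalyticAt ℂ B₀ ζ₀) (h₁ : AnalyticAt ℂ B₁ ζ₀)
    (lam : ℂ) :
    ∃ ε > 0, IsSolvableOn (fun ζ => B₀ ζ + lam • B₁ ζ) (Metric.ball ζ₀ ε) := by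
  obtain ⟨ε, hε, U, -, hU, -, hUd⟩ := exists_invertible_propagator h₀ h₁ (‖lam‖ + 1)
  have hlam : lam ∈ Metric.ball (0 : ℂ) (‖lam‖ + 1) := by simp
  refine ⟨ε, hε, fun ζ₁ hζ₁ w => ⟨fun ζ => U (ζ, lam) (Ring.inverse (U (ζ₁, lam)) w),
    apply_inverse_apply (hU (ζ₁, lam) ⟨hζ₁, hlam⟩) w, fun ζ hζ => ?_⟩⟩
  simpa using (hUd ζ hζ lam hlam).clm_apply (hasDerivAt_const ζ (Ring.inverse (U (ζ₁, lam)) w))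

variable {φ : ℂ → ℂ → V}

lemma exists_eq_propagator_apply (hU : IsOpen U) (h₀ : AnalyticOnNhd ℂ B₀ U)
    (h₁ : AnalyticOnNhd ℂ B₁ U)
    (hφ : ∀ lam, IsSolution (fun ζ => B₀ ζ + lam • B₁ ζ) (φ lam) U) {ζ₀ : ℂ} (hζ₀ : ζ₀ ∈ U)
    (y : ℝ) :
    ∃ ε > 0, ∃ T : ℂ × ℂ → V →L[ℂ] V,
      AnalyticOnNhd ℂ T (Metric.ball ζ₀ ε ×ˢ Metric.ball 0 y) ∧
      (∀ p ∈ Metric.ball ζ₀ ε ×ˢ Metric.ball (0 : ℂ) y, IsUnit (T p)) ∧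
      ∀ ζ ∈ Metric.ball ζ₀ ε, ∀ lam ∈ Metric.ball (0 : ℂ) y, φ lam ζ = T (ζ, lam) (φ lam ζ₀) := by
  obtain ⟨ε₁, hε₁, T, hTa, hT, hT1, hTd⟩ :=
    exists_invertible_propagator (h₀ ζ₀ hζ₀) (h₁ ζ₀ hζ₀) y
  obtain ⟨ε₂, hε₂, hε₂U⟩ := Metric.isOpen_iff.1 hU ζ₀ hζ₀
  have hsub₁ := Metric.ball_subset_ball (x := ζ₀) (min_le_left ε₁ ε₂)
  have hsub₂ := (Metric.ball_subset_ball (x := ζ₀) (min_le_right ε₁ ε₂)).trans hε₂U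
  refine ⟨min ε₁ ε₂, lt_min hε₁ hε₂, T, hTa.mono (Set.prod_mono_left hsub₁),
    fun p hp => hT p ⟨hsub₁ hp.1, hp.2⟩, fun ζ hζ lam hlam => ?_⟩
  have hsol : IsSolution (fun ζ => B₀ ζ + lam • B₁ ζ) (fun ζ => T (ζ, lam) (φ lam ζ₀))
      (Metric.ball ζ₀ (min ε₁ ε₂)) := fun ζ hζ => by
    simpa using (hTd ζ (hsub₁ hζ) lam hlam).clm_apply (hasDerivAt_const ζ (φ lam ζ₀))
  refine ((hφ lam).mono hsub₂).eqOn_of_isPreconnected Metric.isOpen_ball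
    (convex_ball ζ₀ _).isPreconnected ((continuousOn_pencil h₀ h₁ lam).mono hsub₂) hsol
    (Metric.mem_ball_self (lt_min hε₁ hε₂)) ?_ hζ
  simp [hT1]

lemma differentiableOn_param_of_isPreconnected (hU : IsOpen U) (hU' : IsPreconnected U)
    (h₀ : AnalyticOnNhd ℂ B₀ U) (h₁ : AnalyticOnNhd ℂ B₁ U)
    (hφ : ∀ lam, IsSolution (fun ζ => B₀ ζ + lam • B₁ ζ) (φ lam) U) {y : ℝ} {ζ₁ ζ₂ : ℂ}
    (hζ₁ : ζ₁ ∈ U) (hζ₂ : ζ₂ ∈ U)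
    (hd : DifferentiableOn ℂ (fun lam => φ lam ζ₁) (Metric.ball 0 y)) :
    DifferentiableOn ℂ (fun lam => φ lam ζ₂) (Metric.ball 0 y) := by
  let P : ℂ → ℂ → Prop := fun ζ ζ' =>
    DifferentiableOn ℂ (fun lam => φ lam ζ) (Metric.ball 0 y) →
      DifferentiableOn ℂ (fun lam => φ lam ζ') (Metric.ball 0 y)
  refine hU'.induction₂' P (fun ζ₀ hζ₀ => nhdsWithin_le_nhds ?_)
    (fun _ _ _ _ _ _ h h' => h' ∘ h) hζ₁ hζ₂ hd
  obtain ⟨ε, hε, T, hTa, hT, hφT⟩ := exists_eq_propagator_apply hU h₀ h₁ hφ hζ₀ y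
  filter_upwards [Metric.ball_mem_nhds ζ₀ hε] with ζ hζ
  have hTd : DifferentiableOn ℂ (fun lam => T (ζ, lam)) (Metric.ball 0 y) :=
    hTa.differentiableOn.comp (by fun_prop) fun lam hlam => ⟨hζ, hlam⟩
  constructor <;> intro hd
  · exact (hTd.clm_apply hd).congr fun lam hlam => hφT ζ hζ lam hlam
  · have hTi : DifferentiableOn ℂ (fun lam => Ring.inverse (T (ζ, lam))) (Metric.ball 0 y) :=
      fun lam hlam => (hTd lam hlam).inverse (hT (ζ, lam) ⟨hζ, hlam⟩)
    refine (hTi.clm_apply hd).congr fun lam hlam => ?_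
    rw [hφT ζ hζ lam hlam, inverse_apply_apply (hT (ζ, lam) ⟨hζ, hlam⟩)]

theorem analyticOnNhd_uncurry_of_differentiableOn (hU : IsOpen U) (hU' : IsPreconnected U)
    (h₀ : AnalyticOnNhd ℂ B₀ U) (h₁ : AnalyticOnNhd ℂ B₁ U)
    (hφ : ∀ lam, IsSolution (fun ζ => B₀ ζ + lam • B₁ ζ) (φ lam) U)
    (hd : ∀ y : ℝ, ∃ ζ₁ ∈ U, DifferentiableOn ℂ (fun lam => φ lam ζ₁) (Metric.ball 0 y)) :
    AnalyticOnNhd ℂ (fun p : ℂ × ℂ => φ p.2 p.1) (U ×ˢ Set.univ) := by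
  rintro ⟨ζ₀, lam₀⟩ ⟨hζ₀, -⟩
  obtain ⟨ζ₁, hζ₁, hd₁⟩ := hd (‖lam₀‖ + 1)
  obtain ⟨ε, hε, T, hTa, -, hφT⟩ := exists_eq_propagator_apply hU h₀ h₁ hφ hζ₀ (‖lam₀‖ + 1)
  have hlam₀ : lam₀ ∈ Metric.ball (0 : ℂ) (‖lam₀‖ + 1) := by simp
  have hinit : AnalyticAt ℂ (fun lam => φ lam ζ₀) lam₀ :=
    (differentiableOn_param_of_isPreconnected hU hU' h₀ h₁ hφ hζ₁ hζ₀ hd₁).analyticAt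
      (Metric.isOpen_ball.mem_nhds hlam₀)
  refine (analyticAt_clm_apply (hTa (ζ₀, lam₀) ⟨Metric.mem_ball_self hε, hlam₀⟩)
    (AnalyticAt.fun_comp (g := fun lam => φ lam ζ₀) hinit analyticAt_snd)).congr ?_
  filter_upwards [prod_mem_nhds (Metric.ball_mem_nhds ζ₀ hε) (Metric.isOpen_ball.mem_nhds hlam₀)]
    with p hp
  exact (hφT p.1 hp.1 p.2 hp.2).symm

end Family

end Propagator
section Sylvester

variable {K V : Type*} [Field K] [AddCommGroup V] [Module K V]

lemma aeval_mul_eq_mul_aeval {A B X : Module.End K V} (hX : A * X = X * B) (p : Polynomial K) :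
    Polynomial.aeval A p * X = X * Polynomial.aeval B p := by
  induction p using Polynomial.induction_on' with
  | add p q hp hq => rw [map_add, map_add, add_mul, mul_add, hp, hq]
  | monomial n c =>
    have hn : A ^ n * X = X * B ^ n := ((show SemiconjBy X B A from hX.symm).pow_right n).symm
    rw [Polynomial.aeval_monomial, Polynomial.aeval_monomial, mul_assoc, hn, ← mul_assoc,
      ← mul_assoc, Algebra.commutes]

theorem eq_zero_of_mul_eq_mul [IsAlgClosed K] [FiniteDimensional K V] {A B X : Module.End K V}
    (h : ∀ μ, A.HasEigenvalue μ → ¬ B.HasEigenvalue μ) (hX : A * X = X * B) : X = 0 := by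
  rcases subsingleton_or_nontrivial V with hV | hV
  · exact Subsingleton.elim _ _
  obtain ⟨ν, hν⟩ := Module.End.exists_eigenvalue B
  have hunit : IsUnit (Polynomial.aeval B (minpoly K A)) := by
    by_contra hnu
    rw [← spectrum.zero_mem_iff K,
      spectrum.map_polynomial_aeval_of_nonempty _ _ ⟨ν, hν.mem_spectrum⟩] at hnu
    obtain ⟨μ, hμ, hroot⟩ := hnu
    exact h μ (Module.End.hasEigenvalue_iff_isRoot.2 hroot)
      (Module.End.hasEigenvalue_iff_mem_spectrum.2 hμ)
  have haeval := aeval_mul_eq_mul_aeval hX (minpoly K A)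
  rw [minpoly.aeval, zero_mul] at haeval
  exact hunit.mul_left_eq_zero.1 haeval.symm

end Sylvester

section Resolvent

section Uniform

variable {E : Type*} [NormedAddCommGroup E] [NormedSpace ℂ E] {P : E →L[ℂ] E}

lemma norm_le_norm_smul_add_apply {s : ℂ} (hs : ‖P‖ + 1 ≤ ‖s‖) (Y : E) : ‖Y‖ ≤ ‖s • Y + P Y‖ := by
  have h : (‖P‖ + 1) * ‖Y‖ ≤ ‖s • Y + P Y‖ + ‖P‖ * ‖Y‖ :=
    calc (‖P‖ + 1) * ‖Y‖ ≤ ‖s • Y‖ := by rw [norm_smul]; gcongr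
      _ = ‖(s • Y + P Y) - P Y‖ := by rw [add_sub_cancel_right]
      _ ≤ ‖s • Y + P Y‖ + ‖P‖ * ‖Y‖ := (norm_sub_le _ _).trans (by gcongr; exact P.le_opNorm Y)
  linarith

lemma finite_setOf_add_mul_lt {c : ℝ} (hc : 0 < c) (N : ℝ) :
    {p : ℕ × ℕ | (p.1 : ℝ) + c * p.2 < N}.Finite := by
  obtain ⟨m, hm⟩ := exists_nat_gt N
  obtain ⟨n, hn⟩ := exists_nat_gt (N / c)
  refine ((Set.finite_Iio m).prod (Set.finite_Iio n)).subset fun p hp => ?_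
  have hp : (p.1 : ℝ) + c * p.2 < N := hp
  refine ⟨?_, ?_⟩
  · have : (0 : ℝ) ≤ c * p.2 := by positivity
    exact Nat.cast_lt.1 (by linarith : (p.1 : ℝ) < m)
  · refine Nat.cast_lt.1 (lt_trans ?_ hn : (p.2 : ℝ) < n)
    rw [lt_div_iff₀ hc]
    have : (0 : ℝ) ≤ p.1 := by positivity
    linarith

lemma exists_uniform_resolvent {c : ℝ} (hc : 0 < c)
    (h : ∀ p : ℕ × ℕ, p ≠ 0 → ∃ C, ∀ X, ∃ Y,
      ((p.1 : ℂ) + c * p.2) • Y + P Y = X ∧ ‖Y‖ ≤ C * ‖X‖) :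
    ∃ C, ∀ p : ℕ × ℕ, p ≠ 0 → ∀ X, ∃ Y, ((p.1 : ℂ) + c * p.2) • Y + P Y = X ∧ ‖Y‖ ≤ C * ‖X‖ := by
  choose! C hC using h
  obtain ⟨M, hM⟩ := ((finite_setOf_add_mul_lt hc (‖P‖ + 1)).image C).bddAbove
  refine ⟨max 1 M, fun p hp X => ?_⟩
  obtain ⟨Y, hY, hYC⟩ := hC p hp X
  refine ⟨Y, hY, ?_⟩
  rcases lt_or_ge ((p.1 : ℝ) + c * p.2) (‖P‖ + 1) with hlt | hge
  · exact hYC.trans (by gcongr; exact (hM ⟨p, hlt, rfl⟩).trans (le_max_right 1 M))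
  · have hnorm : ‖(p.1 : ℂ) + c * p.2‖ = p.1 + c * p.2 := by
      rw [show (p.1 : ℂ) + c * p.2 = ((p.1 + c * p.2 : ℝ) : ℂ) by push_cast; ring,
        Complex.norm_real, Real.norm_of_nonneg (by positivity)]
    calc ‖Y‖ ≤ ‖X‖ := hY ▸ norm_le_norm_smul_add_apply (hge.trans_eq hnorm.symm) Y
      _ ≤ max 1 M * ‖X‖ := le_mul_of_one_le_left (norm_nonneg X) (le_max_left 1 M)

end Uniform

/-- The commutator with an element of a normed algebra, as a continuous linear operator. -/
def commutatorCLM {A : Type*} [NormedRing A] [NormedAlgebra ℂ A] (a : A) : A →L[ℂ] A :=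
  ContinuousLinearMap.mul ℂ A a - (ContinuousLinearMap.mul ℂ A).flip a

lemma commutatorCLM_apply {A : Type*} [NormedRing A] [NormedAlgebra ℂ A] (a x : A) :
    commutatorCLM a x = a * x - x * a := rfl

variable {V : Type*} [NormedAddCommGroup V] [NormedSpace ℂ V]

/-- No two different eigenvalues of `Q` differ by a number of the form `m + n k`: the spectral
condition under which the equation with residue `-Q` at `z = 0` has a normalized solution that is a
power series in `z` and `λ z^(1-k)`. -/
def NonResonant (Q : V →L[ℂ] V) (k : ℝ) : Prop :=
  ∀ μ ν : ℂ, Module.End.HasEigenvalue (Q : V →ₗ[ℂ] V) μ →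
    Module.End.HasEigenvalue (Q : V →ₗ[ℂ] V) ν → ∀ m n : ℤ, μ - ν = m + n * k → μ = ν

variable [FiniteDimensional ℂ V]

lemma eq_zero_of_smul_add_commutator_eq_zero {Q : V →L[ℂ] V} {s : ℂ}
    (h : ∀ μ ν : ℂ, Module.End.HasEigenvalue (Q : V →ₗ[ℂ] V) μ →
      Module.End.HasEigenvalue (Q : V →ₗ[ℂ] V) ν → ν - μ ≠ s) {X : V →L[ℂ] V}
    (hX : s • X + commutatorCLM Q X = 0) : X = 0 := by
  have hintertwine : ((Q : Module.End ℂ V) + algebraMap ℂ _ s) * (X : Module.End ℂ V)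
      = (X : Module.End ℂ V) * (Q : Module.End ℂ V) := by
    ext v
    have hv : s • X v + (Q (X v) - X (Q v)) = 0 := congrArg (fun Y : V →L[ℂ] V => Y v) hX
    change Q (X v) + s • X v = X (Q v)
    rw [← sub_eq_zero, ← hv]
    abel
  have hzero := eq_zero_of_mul_eq_mul (fun μ hμ hμ' => by
    obtain ⟨v, hv⟩ := hμ.exists_hasEigenvector
    have hQv : Q v + s • v = μ • v := hv.apply_eq_smul
    refine h (μ - s) μ (Module.End.hasEigenvalue_of_hasEigenvector (x := v)
      ⟨Module.End.mem_eigenspace_iff.2 ?_, hv.2⟩) hμ' (by ring)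
    rw [sub_smul, ← hQv, add_sub_cancel_right]
    rfl) hintertwine
  ext v
  exact congrArg (fun Y : Module.End ℂ V => Y v) hzero

lemma exists_smul_add_commutator_eq {Q : V →L[ℂ] V} {s : ℂ}
    (h : ∀ μ ν : ℂ, Module.End.HasEigenvalue (Q : V →ₗ[ℂ] V) μ →
      Module.End.HasEigenvalue (Q : V →ₗ[ℂ] V) ν → ν - μ ≠ s) :
    ∃ C, ∀ X : V →L[ℂ] V, ∃ Y, s • Y + commutatorCLM Q Y = X ∧ ‖Y‖ ≤ C * ‖X‖ := by
  let T : (V →L[ℂ] V) →ₗ[ℂ] (V →L[ℂ] V) :=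
    (s • ContinuousLinearMap.id ℂ (V →L[ℂ] V) + commutatorCLM Q : _ →L[ℂ] _)
  have hinj : Function.Injective T := (injective_iff_map_eq_zero T).2 fun X hX =>
    eq_zero_of_smul_add_commutator_eq_zero h hX
  let e := LinearEquiv.ofInjectiveEndo T hinj
  let R := LinearMap.toContinuousLinearMap e.symm.toLinearMap
  exact ⟨‖R‖, fun X => ⟨R X, e.apply_symm_apply X, R.le_opNorm X⟩⟩

lemma NonResonant.exists_resolvent {Q : V →L[ℂ] V} {k : ℝ} (hQ : NonResonant Q k) (hk : k < 1) :
    ∃ C, ∀ p : ℕ × ℕ, p ≠ 0 → ∀ X : V →L[ℂ] V, ∃ Y,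
      ((p.1 : ℂ) + (1 - k : ℝ) * p.2) • Y + commutatorCLM Q Y = X ∧ ‖Y‖ ≤ C * ‖X‖ := by
  have hk' : 0 < 1 - k := sub_pos.2 hk
  refine exists_uniform_resolvent hk' fun p hp => exists_smul_add_commutator_eq ?_
  intro μ ν hμ hν hμν
  have hpos : 0 < (p.1 : ℝ) + (1 - k) * p.2 := by
    rcases Nat.eq_zero_or_pos p.1 with h | h
    · have : 0 < p.2 := Nat.pos_of_ne_zero fun h' => hp (Prod.ext h h')
      positivity
    · positivity
  have heq := hQ ν μ hν hμ (p.1 + p.2) (-p.2) (by rw [hμν]; push_cast; ring)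
  rw [heq, sub_self] at hμν
  exact hpos.ne (by exact_mod_cast hμν)

end Resolvent

section Frobenius

variable {V : Type*} [NormedAddCommGroup V] [NormedSpace ℂ V]

/-- The coordinates `(z, λ z^(1-k))`, where `z = exp ζ`, in which the equation is of Euler type. -/
def eulerPoint (k : ℝ) (lam ζ : ℂ) : ℂ × ℂ :=
  (Complex.exp ζ, lam * Complex.exp ((1 - k : ℝ) * ζ))

lemma hasDerivAt_eulerPoint (k : ℝ) (lam ζ : ℂ) :
    HasDerivAt (eulerPoint k lam)
      ((eulerPoint k lam ζ).1, ((1 - k : ℝ) : ℂ) * (eulerPoint k lam ζ).2) ζ := by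
  refine (Complex.hasDerivAt_exp ζ).prodMk ?_
  convert! (((hasDerivAt_id ζ).const_mul ((1 - k : ℝ) : ℂ)).cexp.const_mul lam) using 1
  simp only [eulerPoint, id_eq, mul_one]
  ring

/-- The coefficient of the equation `φ' = -(Q + z ((1 + λ z^(-k)) E + S(z))) φ` in the coordinate
`ζ`, where `z = exp ζ`. -/
def gaugedCoeff (Q E : V →L[ℂ] V) (S : ℂ → V →L[ℂ] V) (k : ℝ) (lam ζ : ℂ) : V →L[ℂ] V :=
  -(Q + Complex.exp ζ • ((1 + lam * Complex.exp (-(k : ℂ) * ζ)) • E + S (Complex.exp ζ)))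

lemma gaugedCoeff_eq_eulerPoint (Q E : V →L[ℂ] V) (S : ℂ → V →L[ℂ] V) (k : ℝ) (lam ζ : ℂ) :
    gaugedCoeff Q E S k lam ζ = -((eulerPoint k lam ζ).1 • (E + S (eulerPoint k lam ζ).1))
      + (eulerPoint k lam ζ).2 • -E - Q := by
  have h : Complex.exp ((1 - k : ℝ) * ζ) = Complex.exp ζ * Complex.exp (-(k : ℂ) * ζ) := by
    rw [← Complex.exp_add]; congr 1; push_cast; ring
  simp only [gaugedCoeff, eulerPoint, h]
  module

theorem NonResonant.exists_frobenius_solution [FiniteDimensional ℂ V] {Q : V →L[ℂ] V} {k : ℝ}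
    (hQ : NonResonant Q k) (hk : k < 1) (E : V →L[ℂ] V) {S : ℂ → V →L[ℂ] V}
    (hS : AnalyticAt ℂ S 0) :
    ∃ r > 0, ∃ Ψ : ℂ × ℂ → V →L[ℂ] V, AnalyticOnNhd ℂ Ψ (Metric.ball 0 r) ∧ Ψ 0 = 1 ∧
      (∀ x ∈ Metric.ball 0 r, IsUnit (Ψ x)) ∧
      ∀ ζ lam : ℂ, eulerPoint k lam ζ ∈ Metric.ball 0 r →
        HasDerivAt (fun ζ => Ψ (eulerPoint k lam ζ))
          (gaugedCoeff Q E S k lam ζ * Ψ (eulerPoint k lam ζ) + Ψ (eulerPoint k lam ζ) * Q) ζ := by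
  have : CompleteSpace V := FiniteDimensional.complete ℂ V
  obtain ⟨r, hr, Ψ, hΨ, hΨ0, hΨd⟩ := exists_euler_solution (P := commutatorCLM Q)
    (c := (1 - k : ℝ)) (g₀ := 1) (A := fun x => -(x.1 • (E + S x.1)) + x.2 • -E)
    ((analyticAt_fst.smul (analyticAt_const.add
      (AnalyticAt.fun_comp (g := S) hS analyticAt_fst))).neg.add
        (analyticAt_snd.smul analyticAt_const))
    (by simp) (by simp [commutatorCLM_apply]) (hQ.exists_resolvent hk)
  have hunit : ∀ᶠ x in 𝓝 (0 : ℂ × ℂ), IsUnit (Ψ x) :=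
    (hΨ 0 (Metric.mem_ball_self hr)).continuousAt.eventually_mem
      (Units.isOpen.mem_nhds (by rw [hΨ0]; exact isUnit_one))
  obtain ⟨ε, hε, hεu⟩ := Metric.eventually_nhds_iff_ball.1 hunit
  refine ⟨min r ε, lt_min hr hε, Ψ, hΨ.mono (Metric.ball_subset_ball (min_le_left r ε)), hΨ0,
    fun x hx => hεu x (Metric.ball_subset_ball (min_le_right r ε) hx), fun ζ lam hx => ?_⟩
  have hx' := Metric.ball_subset_ball (min_le_left r ε) hx
  have hd := (hΨ _ hx').differentiableAt.hasFDerivAt.comp_hasDerivAt ζ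
    (hasDerivAt_eulerPoint k lam ζ)
  rw [hΨd _ hx', commutatorCLM_apply] at hd
  convert! hd using 1
  rw [gaugedCoeff_eq_eulerPoint]
  noncomm_ring

end Frobenius
section Kernel

section Exponential

variable {V : Type*} [NormedAddCommGroup V] [NormedSpace ℂ V] [CompleteSpace V]

lemma hasSum_exp_apply (T : V →L[ℂ] V) (x : V) :
    HasSum (fun n : ℕ => (n.factorial⁻¹ : ℂ) • (T ^ n) x) (NormedSpace.exp T x) := by
  have h := (ContinuousLinearMap.apply ℂ V x).hasSum
    (NormedSpace.exp_series_hasSum_exp' (𝕂 := ℂ) T)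
  simpa only [ContinuousLinearMap.apply_apply, _root_.smul_apply] using h

lemma exp_apply_of_apply_eq_smul {T : V →L[ℂ] V} {x : V} {μ : ℂ} (h : T x = μ • x) :
    NormedSpace.exp T x = Complex.exp μ • x := by
  have hpow (n : ℕ) : (T ^ n) x = μ ^ n • x := by
    induction n with
    | zero => rw [pow_zero, pow_zero, one_smul, one_apply_eq_self]
    | succ n ih => rw [pow_succ, mul_clm_apply, h, map_smul, ih, smul_smul, pow_succ']
  refine (hasSum_exp_apply T x).unique ?_
  simp only [hpow, smul_smul]
  rw [Complex.exp_eq_exp_ℂ]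
  exact (NormedSpace.exp_series_hasSum_exp' (𝕂 := ℂ) μ).smul_const x

lemma exp_apply_of_apply_apply_eq_zero {T : V →L[ℂ] V} {x : V} (h : T (T x) = 0) :
    NormedSpace.exp T x = x + T x := by
  have hpow (n : ℕ) (hn : n ∉ Finset.range 2) : (n.factorial⁻¹ : ℂ) • (T ^ n) x = 0 := by
    obtain ⟨m, rfl⟩ := Nat.exists_eq_add_of_le' (not_lt.1 (Finset.mem_range.not.1 hn))
    rw [pow_add, pow_two, mul_clm_apply, mul_clm_apply, h, map_zero, smul_zero]
  have hsum := (hasSum_exp_apply T x).unique (hasSum_sum_of_ne_finset_zero hpow)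
  simpa [Finset.sum_range_succ] using hsum

lemma exp_smul_apply_of_apply_eq_zero {Q : V →L[ℂ] V} {v : V} (hv : Q v = 0) (ζ : ℂ) :
    NormedSpace.exp (ζ • Q) v = v := by
  have h := exp_apply_of_apply_eq_smul (T := ζ • Q) (x := v) (μ := 0) (by simp [hv])
  rwa [Complex.exp_zero, one_smul] at h

end Exponential

variable {V : Type*} [NormedAddCommGroup V] [NormedSpace ℂ V] [FiniteDimensional ℂ V]

lemma exists_apply_apply_eq_smul {Q : V →L[ℂ] V} {W : Submodule ℂ V} (hQW : ∀ x ∈ W, Q x ∈ W)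
    {v : V} (hv : v ∈ W) (hQv : Q v ≠ 0) : ∃ x ∈ W, ∃ ν : ℂ, Q x ≠ 0 ∧ Q (Q x) = ν • Q x := by
  let U : Submodule ℂ V := W.map (Q : V →ₗ[ℂ] V)
  have hUW : U ≤ W := Submodule.map_le_iff_le_comap.2 hQW
  have : Nontrivial U := Submodule.nontrivial_iff_ne_bot.2
    ((Submodule.ne_bot_iff U).2 ⟨_, ⟨v, hv, rfl⟩, hQv⟩)
  obtain ⟨ν, hν⟩ := Module.End.exists_eigenvalue ((Q : V →ₗ[ℂ] V).restrict (p := U) (q := U)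
    fun y hy => Submodule.mem_map_of_mem (hUW hy))
  obtain ⟨⟨_, x, hx, rfl⟩, hνx⟩ := hν.exists_hasEigenvector
  exact ⟨x, hx, ν, fun h => hνx.2 (Subtype.ext h), congrArg Subtype.val hνx.apply_eq_smul⟩

-- If `Q v ≠ 0`, the eigenspace of `exp (2πiQ)` containing `v` contains `x` such that `Q x` is an
-- eigenvector of `Q`, necessarily for the eigenvalue `0`; then `x = exp (2πiQ) x = x + 2πi Q x`.
theorem apply_eq_zero_of_exp_apply {Q : V →L[ℂ] V} {κ : ℂ}
    (hQ : ∀ ν : ℂ, Module.End.HasEigenvalue (Q : V →ₗ[ℂ] V) ν → ∀ m : ℤ, ν = κ + m → ν = 0)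
    {v : V} (hv : NormedSpace.exp ((2 * Real.pi * Complex.I : ℂ) • Q) v
      = Complex.exp (2 * Real.pi * Complex.I * κ) • v) : Q v = 0 := by
  set c := Complex.exp (2 * Real.pi * Complex.I * κ)
  set T := NormedSpace.exp ((2 * Real.pi * Complex.I : ℂ) • Q)
  let W : Submodule ℂ V := Module.End.eigenspace (T : Module.End ℂ V) c
  have hW {x : V} : x ∈ W ↔ T x = c • x := Module.End.mem_eigenspace_iff
  have hQW (x : V) (hx : x ∈ W) : Q x ∈ W := by
    have hcomm : Commute Q T := ((Commute.refl Q).smul_right _).exp_right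
    rw [hW] at hx ⊢
    rw [← mul_clm_apply, ← hcomm.eq, mul_clm_apply, hx, map_smul]
  by_contra hQv
  obtain ⟨x, hx, ν, hQx, hQQx⟩ := exists_apply_apply_eq_smul hQW (hW.2 hv) hQv
  have hc : c = Complex.exp (2 * Real.pi * Complex.I * ν) := by
    refine smul_left_injective ℂ hQx ?_
    simp only [← hW.1 (hQW x hx)]
    exact exp_apply_of_apply_eq_smul (by rw [_root_.smul_apply, hQQx, smul_smul])
  have hν0 : ν = 0 := by
    obtain ⟨m, hm⟩ := Complex.exp_eq_exp_iff_exists_int.1 hc.symm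
    refine hQ ν (Module.End.hasEigenvalue_of_hasEigenvector
      ⟨Module.End.mem_eigenspace_iff.2 hQQx, hQx⟩) m ?_
    refine mul_left_cancel₀ Complex.two_pi_I_ne_zero ?_
    linear_combination hm
  rw [hν0, zero_smul] at hQQx
  have hTx : T x = x + (2 * Real.pi * Complex.I : ℂ) • Q x :=
    exp_apply_of_apply_apply_eq_zero (by
      simp only [_root_.smul_apply, map_smul, hQQx, smul_zero])
  rw [hW.1 hx, hc, hν0, mul_zero, Complex.exp_zero, one_smul, left_eq_add] at hTx
  exact hQx ((smul_eq_zero.1 hTx).resolve_left Complex.two_pi_I_ne_zero)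

end Kernel
section HalfPlane

/-- The set of `ζ` where both coordinates `(z, λ z^(1-k))` are smaller than `r`; for `k < 1` it is
a left half plane. -/
def halfPlane (k r : ℝ) (lam : ℂ) : Set ℂ := eulerPoint k lam ⁻¹' Metric.ball 0 r

variable {k r : ℝ} {lam lam' ζ : ℂ}

lemma mem_halfPlane : ζ ∈ halfPlane k r lam ↔
    ‖Complex.exp ζ‖ < r ∧ ‖lam * Complex.exp ((1 - k : ℝ) * ζ)‖ < r := by
  rw [halfPlane, Set.mem_preimage, mem_ball_zero_iff, Prod.norm_def, max_lt_iff, eulerPoint]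

lemma convex_halfPlane (hk : k < 1) (r : ℝ) (lam : ℂ) : Convex ℝ (halfPlane k r lam) := by
  let I : Set ℝ := {t | Real.exp t < r ∧ ‖lam‖ * Real.exp ((1 - k) * t) < r}
  have hI : IsLowerSet I := fun a b hab ha => by
    have : 0 < 1 - k := sub_pos.2 hk
    refine ⟨(Real.exp_le_exp.2 hab).trans_lt ha.1, lt_of_le_of_lt ?_ ha.2⟩
    gcongr
  have h := hI.ordConnected.convex (𝕜 := ℝ) |>.linear_preimage Complex.reLm
  convert! h using 1
  ext ζ
  simp [mem_halfPlane, I, Complex.norm_exp]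

lemma halfPlane_anti (h : ‖lam‖ ≤ ‖lam'‖) : halfPlane k r lam' ⊆ halfPlane k r lam := fun ζ hζ => by
  rw [mem_halfPlane, norm_mul] at hζ ⊢
  exact ⟨hζ.1, lt_of_le_of_lt (by gcongr) hζ.2⟩

instance neBot_comap_re_atBot : (comap Complex.re atBot).NeBot :=
  NeBot.comap_of_surj inferInstance Complex.re_surjective

lemma tendsto_eulerPoint (hk : k < 1) (lam : ℂ) :
    Tendsto (eulerPoint k lam) (comap Complex.re atBot) (𝓝 0) := by
  have hscale : Tendsto (fun ζ : ℂ => ((1 - k : ℝ) : ℂ) * ζ) (comap Complex.re atBot)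
      (comap Complex.re atBot) := by
    rw [tendsto_comap_iff]
    simpa only [Function.comp_def, Complex.re_ofReal_mul] using
      tendsto_comap.const_mul_atBot (sub_pos.2 hk)
  have h := (Complex.tendsto_exp_comap_re_atBot.comp hscale).const_mul lam
  rw [mul_zero] at h
  exact Complex.tendsto_exp_comap_re_atBot.prodMk_nhds h

lemma eventually_mem_halfPlane (hk : k < 1) (hr : 0 < r) (lam : ℂ) :
    ∀ᶠ ζ in comap Complex.re atBot, ζ ∈ halfPlane k r lam :=
  (tendsto_eulerPoint hk lam).eventually_mem (Metric.ball_mem_nhds 0 hr)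

lemma exists_mem_halfPlane (hk : k < 1) (hr : 0 < r) (y : ℝ) :
    ∃ ζ, ∀ lam, ‖lam‖ ≤ y → ζ ∈ halfPlane k r lam := by
  obtain ⟨ζ, hζ⟩ := (eventually_mem_halfPlane hk hr (y : ℂ)).exists
  refine ⟨ζ, fun lam hlam => halfPlane_anti ?_ hζ⟩
  rw [Complex.norm_real]
  exact hlam.trans (le_abs_self y)

lemma exp_add_int_mul_two_pi_I (ζ : ℂ) (n : ℤ) :
    Complex.exp (ζ + n * (2 * Real.pi * Complex.I)) = Complex.exp ζ :=
  Complex.exp_periodic.int_mul n ζ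

lemma eulerPoint_translate (k : ℝ) (n : ℤ) (lam ζ : ℂ) :
    eulerPoint k (lam * Complex.exp (k * (n * (2 * Real.pi * Complex.I))))
      (ζ + n * (2 * Real.pi * Complex.I)) = eulerPoint k lam ζ := by
  have h : (k : ℂ) * (n * (2 * Real.pi * Complex.I)) + (1 - k : ℝ) *
      (ζ + n * (2 * Real.pi * Complex.I)) = (1 - k : ℝ) * ζ + n * (2 * Real.pi * Complex.I) := by
    push_cast; ring
  rw [eulerPoint, exp_add_int_mul_two_pi_I, mul_assoc lam, ← Complex.exp_add, h,
    exp_add_int_mul_two_pi_I, eulerPoint]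

lemma translate_mem_halfPlane (n : ℤ) : ζ + n * (2 * Real.pi * Complex.I) ∈
      halfPlane k r (lam * Complex.exp (k * (n * (2 * Real.pi * Complex.I)))) ↔
      ζ ∈ halfPlane k r lam := by
  rw [halfPlane, halfPlane, Set.mem_preimage, Set.mem_preimage, eulerPoint_translate]

end HalfPlane

/-- A differential equation `φ' = -(Q + z ((1 + λ z^(-k)) E + S(z))) φ` in the coordinate `ζ`, where
`z = exp ζ`, whose monodromy at the singular points of `S` is trivial: near such a point every
initial value problem has a single-valued solution. -/
structure GaugedSystem (V : Type v) [NormedAddCommGroup V] [NormedSpace ℂ V] where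
  /-- the residue at `z = 0` -/
  Q : V →L[ℂ] V
  /-- the coefficient of the parameter -/
  E : V →L[ℂ] V
  /-- the part with poles -/
  S : ℂ → V →L[ℂ] V
  /-- the exponent -/
  k : ℝ
  /-- the singular points -/
  sing : Finset ℂ
  k_lt_one : k < 1
  zero_notMem : (0 : ℂ) ∉ sing
  analytic : AnalyticOnNhd ℂ S {z | z ∉ sing}
  nonResonant : NonResonant Q k
  trivialMonodromy : ∀ lam ζ₀ : ℂ, Complex.exp ζ₀ ∈ sing →
    ∃ ε > 0, IsSolvableOn (gaugedCoeff Q E S k lam) (Metric.ball ζ₀ ε \ {ζ₀})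

namespace GaugedSystem

variable {V : Type v} [NormedAddCommGroup V] [NormedSpace ℂ V] (G : GaugedSystem V)

/-- The preimages in the `ζ`-plane of the singular points. -/
def lifts : Set ℂ := {ζ | Complex.exp ζ ∈ G.sing}

/-- The coefficient of the equation. -/
def coeff (lam ζ : ℂ) : V →L[ℂ] V := gaugedCoeff G.Q G.E G.S G.k lam ζ

/-- The coefficient of the equation with `λ = 0`. -/
def coeffZero (ζ : ℂ) : V →L[ℂ] V := -(G.Q + Complex.exp ζ • (G.E + G.S (Complex.exp ζ)))

/-- The part of the coefficient that multiplies `λ`. -/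
def coeffOne (ζ : ℂ) : V →L[ℂ] V := -((Complex.exp ζ * Complex.exp (-(G.k : ℂ) * ζ)) • G.E)

/-- The point `(z, λ z^(-k))`, where `z = exp ζ`. -/
def curve (lam ζ : ℂ) : ℂ × ℂ := (Complex.exp ζ, lam * Complex.exp (-(G.k : ℂ) * ζ))

section Coefficients

lemma isOpen_notMem_sing : IsOpen {z | z ∉ G.sing} :=
  (G.sing.finite_toSet.isClosed).isOpen_compl

lemma isClosed_lifts : IsClosed G.lifts :=
  (G.sing.finite_toSet.isClosed).preimage Complex.continuous_exp

lemma countable_lifts : G.lifts.Countable := G.sing.finite_toSet.countable.preimage_cexp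

lemma isOpen_compl_lifts : IsOpen G.liftsᶜ := G.isClosed_lifts.isOpen_compl

lemma isPreconnected_compl_lifts : IsPreconnected G.liftsᶜ := by
  rw [Set.compl_eq_univ_sdiff]
  exact isPreconnected_diff_of_countable (by simp [Complex.rank_real_complex]) isOpen_univ
    isPreconnected_univ G.countable_lifts

lemma translate_mem_lifts (n : ℤ) {ζ : ℂ} :
    ζ + n * (2 * Real.pi * Complex.I) ∈ G.lifts ↔ ζ ∈ G.lifts := by
  simp only [lifts, Set.mem_ofPred_eq, exp_add_int_mul_two_pi_I]

lemma coeff_eq (lam : ℂ) : G.coeff lam = fun ζ => G.coeffZero ζ + lam • G.coeffOne ζ := by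
  funext ζ
  simp only [coeff, gaugedCoeff, coeffZero, coeffOne]
  module

lemma analyticOnNhd_coeffZero : AnalyticOnNhd ℂ G.coeffZero G.liftsᶜ := fun ζ hζ => by
  have hS : AnalyticAt ℂ (fun ζ => G.S (Complex.exp ζ)) ζ :=
    AnalyticAt.fun_comp (g := G.S) (G.analytic _ hζ) analyticAt_cexp
  exact (analyticAt_const.add (analyticAt_cexp.smul (analyticAt_const.add hS))).neg

lemma analyticAt_coeffOne (ζ : ℂ) : AnalyticAt ℂ G.coeffOne ζ := by
  have h : AnalyticAt ℂ (fun ζ => Complex.exp ζ * Complex.exp (-(G.k : ℂ) * ζ)) ζ := by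
    fun_prop
  exact (h.smul analyticAt_const).neg

lemma continuousOn_coeff (lam : ℂ) : ContinuousOn (G.coeff lam) G.liftsᶜ := by
  rw [coeff_eq]
  exact continuousOn_pencil G.analyticOnNhd_coeffZero (fun ζ _ => G.analyticAt_coeffOne ζ) lam

lemma coeff_translate (n : ℤ) (lam ζ : ℂ) :
    G.coeff (lam * Complex.exp (G.k * (n * (2 * Real.pi * Complex.I))))
      (ζ + n * (2 * Real.pi * Complex.I)) = G.coeff lam ζ := by
  rw [coeff, coeff, gaugedCoeff_eq_eulerPoint, gaugedCoeff_eq_eulerPoint, eulerPoint_translate]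

theorem isSolvableOn_compl_lifts [CompleteSpace V] (lam : ℂ) :
    IsSolvableOn (G.coeff lam) G.liftsᶜ := by
  refine isSolvableOn_compl G.isClosed_lifts G.countable_lifts (G.continuousOn_coeff lam)
    fun ζ₀ => ?_
  by_cases hζ₀ : ζ₀ ∈ G.lifts
  · obtain ⟨ε, hε, h⟩ := G.trivialMonodromy lam ζ₀ hζ₀
    exact ⟨ε, hε, h.mono (Set.sdiff_subset_sdiff_right (Set.singleton_subset_iff.2 hζ₀))⟩
  · obtain ⟨ε, hε, h⟩ := exists_isSolvableOn_ball (G.analyticOnNhd_coeffZero ζ₀ hζ₀)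
      (G.analyticAt_coeffOne ζ₀) lam
    exact ⟨ε, hε, G.coeff_eq lam ▸ h.mono Set.sdiff_subset⟩

variable {G} in
theorem eqOn_compl_lifts [CompleteSpace V] {lam : ℂ} {φ ψ : ℂ → V}
    (hφ : IsSolution (G.coeff lam) φ G.liftsᶜ) (hψ : IsSolution (G.coeff lam) ψ G.liftsᶜ) {ζ : ℂ}
    (hζ : ζ ∉ G.lifts) (h : φ ζ = ψ ζ) : Set.EqOn φ ψ G.liftsᶜ :=
  hφ.eqOn_of_isPreconnected G.isOpen_compl_lifts G.isPreconnected_compl_lifts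
    (G.continuousOn_coeff lam) hψ hζ h

end Coefficients

/-- A matrix solution `Ψ(z, λ z^(1-k)) z^(-Q)` of the equation, given by its factor `Ψ`, which is
analytic and invertible on the polydisc of radius `r`. -/
structure IsFrobenius (r : ℝ) (Ψ : ℂ × ℂ → V →L[ℂ] V) : Prop where
  pos : 0 < r
  analytic : AnalyticOnNhd ℂ Ψ (Metric.ball 0 r)
  map_zero : Ψ 0 = 1
  isUnit : ∀ x ∈ Metric.ball 0 r, IsUnit (Ψ x)
  hasDerivAt : ∀ lam, ∀ ζ ∈ halfPlane G.k r lam, HasDerivAt (fun ζ => Ψ (eulerPoint G.k lam ζ))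
    (G.coeff lam ζ * Ψ (eulerPoint G.k lam ζ) + Ψ (eulerPoint G.k lam ζ) * G.Q) ζ
  halfPlane_subset : ∀ lam, halfPlane G.k r lam ⊆ G.liftsᶜ

theorem exists_isFrobenius [FiniteDimensional ℂ V] : ∃ r Ψ, G.IsFrobenius r Ψ := by
  obtain ⟨r, hr, Ψ, hΨ, hΨ0, hΨu, hΨd⟩ :=
    G.nonResonant.exists_frobenius_solution G.k_lt_one G.E (G.analytic 0 G.zero_notMem)
  obtain ⟨ε, hε, hεsing⟩ := Metric.isOpen_iff.1 G.isOpen_notMem_sing 0 G.zero_notMem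
  have hsub : Metric.ball (0 : ℂ × ℂ) (min r ε) ⊆ Metric.ball 0 r :=
    Metric.ball_subset_ball (min_le_left _ _)
  refine ⟨min r ε, Ψ, lt_min hr hε, hΨ.mono hsub, hΨ0, fun x hx => hΨu x (hsub hx),
    fun lam ζ hζ => hΨd ζ lam (hsub hζ), fun lam ζ hζ => hεsing ?_⟩
  exact mem_ball_zero_iff.2 ((mem_halfPlane.1 hζ).1.trans_le (min_le_right _ _))

section Frobenius

variable {G} {r : ℝ} {Ψ : ℂ × ℂ → V →L[ℂ] V}

lemma IsFrobenius.tendsto (h : G.IsFrobenius r Ψ) (lam : ℂ) (v : V) :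
    Tendsto (fun ζ => Ψ (eulerPoint G.k lam ζ) v) (comap Complex.re atBot) (𝓝 v) := by
  have hcont : Tendsto (fun x => Ψ x v) (𝓝 0) (𝓝 (Ψ 0 v)) :=
    (h.analytic 0 (Metric.mem_ball_self h.pos)).continuousAt.clm_apply continuousAt_const
  rw [h.map_zero] at hcont
  exact hcont.comp (tendsto_eulerPoint G.k_lt_one lam)

lemma IsFrobenius.differentiableAt_param (h : G.IsFrobenius r Ψ) {lam ζ : ℂ}
    (hζ : ζ ∈ halfPlane G.k r lam) :
    DifferentiableAt ℂ (fun lam => Ψ (eulerPoint G.k lam ζ)) lam :=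
  (h.analytic _ hζ).differentiableAt.comp lam
    ((differentiableAt_const _).prodMk (differentiableAt_id.mul_const _))

lemma IsFrobenius.eqOn_halfPlane (h : G.IsFrobenius r Ψ) {lam : ℂ} {φ ψ : ℂ → V}
    (hφ : IsSolution (G.coeff lam) φ (halfPlane G.k r lam))
    (hψ : IsSolution (G.coeff lam) ψ (halfPlane G.k r lam)) {ζ₁ : ℂ}
    (hζ₁ : ζ₁ ∈ halfPlane G.k r lam) (he : φ ζ₁ = ψ ζ₁) : Set.EqOn φ ψ (halfPlane G.k r lam) :=
  fun _ hζ => sub_eq_zero.1 ((hφ.sub hψ).eqOn_zero_of_convex (convex_halfPlane G.k_lt_one r lam)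
    ((G.continuousOn_coeff lam).mono (h.halfPlane_subset lam)) hζ₁ (sub_eq_zero.2 he) hζ)

variable [CompleteSpace V]

lemma IsFrobenius.isSolution (h : G.IsFrobenius r Ψ) (lam : ℂ) (v : V) :
    IsSolution (G.coeff lam)
      (fun ζ => Ψ (eulerPoint G.k lam ζ) (NormedSpace.exp (ζ • (-G.Q)) v))
      (halfPlane G.k r lam) := by
  intro ζ hζ
  have hexp := (hasDerivAt_exp_smul_const' (𝕂 := ℂ) (-G.Q) ζ).clm_apply (hasDerivAt_const ζ v)
  rw [_root_.map_zero, add_zero] at hexp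
  convert! (h.hasDerivAt lam ζ hζ).clm_apply hexp using 1
  simp only [_root_.add_apply, mul_clm_apply, _root_.neg_apply, map_neg]
  abel

end Frobenius

section Descent

variable {G} {r : ℝ} {Ψ : ℂ × ℂ → V →L[ℂ] V} {χ₀ : V} {φ : ℂ → ℂ → V}

variable (G) in
/-- Invariance of a family of functions of `ζ = log z`, indexed by `λ`, under analytic continuation
around `z = 0` with `λ z^(-k)` fixed. -/
def IsSingleValued (φ : ℂ → ℂ → V) : Prop :=
  ∀ (n : ℤ) (lam ζ : ℂ), ζ ∉ G.lifts →
    φ (lam * Complex.exp (G.k * (n * (2 * Real.pi * Complex.I))))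
      (ζ + n * (2 * Real.pi * Complex.I)) = φ lam ζ

variable (G) in
/-- The function `F` of `(z, w)` such that `F(z, λ z^(-k)) = φ λ (log z)` for a single-valued
family `φ`, extended by `χ₀` to `z = 0`. -/
def descend (χ₀ : V) (φ : ℂ → ℂ → V) (p : ℂ × ℂ) : V :=
  if p.1 = 0 then χ₀ else φ (p.2 * Complex.exp (G.k * Complex.log p.1)) (Complex.log p.1)

lemma descend_exp (hper : G.IsSingleValued φ) {ζ : ℂ} (w : ℂ) (hζ : ζ ∉ G.lifts) :
    G.descend χ₀ φ (Complex.exp ζ, w) = φ (w * Complex.exp (G.k * ζ)) ζ := by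
  obtain ⟨n, hn⟩ := Complex.exp_eq_exp_iff_exists_int.1 (Complex.exp_log (Complex.exp_ne_zero ζ))
  simp only [descend, Complex.exp_ne_zero, if_false]
  rw [hn, ← hper n (w * Complex.exp (G.k * ζ)) ζ hζ, mul_assoc w, ← Complex.exp_add, ← mul_add]

lemma descend_curve (hper : G.IsSingleValued φ) (lam : ℂ) {ζ : ℂ} (hζ : ζ ∉ G.lifts) :
    G.descend χ₀ φ (G.curve lam ζ) = φ lam ζ := by
  rw [curve, descend_exp hper _ hζ, mul_assoc, ← Complex.exp_add, neg_mul, neg_add_cancel,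
    Complex.exp_zero, mul_one]

lemma descend_eq_of_mem_ball (hΨ : G.IsFrobenius r Ψ)
    (hφΨ : ∀ lam, Set.EqOn (φ lam) (fun ζ => Ψ (eulerPoint G.k lam ζ) χ₀) (halfPlane G.k r lam))
    {z w : ℂ} (hzw : (z, z * w) ∈ Metric.ball 0 r) :
    G.descend χ₀ φ (z, w) = Ψ (z, z * w) χ₀ := by
  rcases eq_or_ne z 0 with rfl | hz
  · rw [zero_mul, Prod.mk_zero_zero, hΨ.map_zero, one_apply_eq_self]
    exact if_pos rfl
  · have hpoint : eulerPoint G.k (w * Complex.exp (G.k * Complex.log z)) (Complex.log z)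
        = (z, z * w) := by
      have hlog : (G.k : ℂ) * Complex.log z + (1 - G.k : ℝ) * Complex.log z = Complex.log z := by
        push_cast; ring
      rw [eulerPoint, mul_assoc, ← Complex.exp_add, hlog, Complex.exp_log hz, mul_comm]
    have hmem : Complex.log z ∈ halfPlane G.k r (w * Complex.exp (G.k * Complex.log z)) := by
      rwa [halfPlane, Set.mem_preimage, hpoint]
    simp only [descend, hz, if_false, hφΨ _ hmem, hpoint]

lemma analyticAt_descend_zero (hΨ : G.IsFrobenius r Ψ)
    (hφΨ : ∀ lam, Set.EqOn (φ lam) (fun ζ => Ψ (eulerPoint G.k lam ζ) χ₀) (halfPlane G.k r lam))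
    (w₀ : ℂ) : AnalyticAt ℂ (G.descend χ₀ φ) (0, w₀) := by
  let blowup : ℂ × ℂ → ℂ × ℂ := fun p => (p.1, p.1 * p.2)
  have hmem : blowup (0, w₀) ∈ Metric.ball (0 : ℂ × ℂ) r := by simpa [blowup] using hΨ.pos
  have hΨa : AnalyticAt ℂ (fun p => Ψ (blowup p)) (0, w₀) :=
    AnalyticAt.fun_comp (g := Ψ) (f := blowup) (hΨ.analytic _ hmem)
      (analyticAt_fst.prod (analyticAt_fst.mul analyticAt_snd))
  refine (analyticAt_clm_apply hΨa (analyticAt_const (v := χ₀))).congr ?_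
  have hcont : Continuous blowup := by fun_prop
  filter_upwards [hcont.continuousAt.eventually_mem (Metric.isOpen_ball.mem_nhds hmem)] with p hp
  exact (descend_eq_of_mem_ball hΨ hφΨ hp).symm

lemma exists_analyticAt_exp_eq {z₀ : ℂ} (hz₀ : z₀ ≠ 0) :
    ∃ L : ℂ → ℂ, AnalyticAt ℂ L z₀ ∧ ∀ z ≠ 0, Complex.exp (L z) = z := by
  refine ⟨fun z => Complex.log z₀ + Complex.log (z / z₀), analyticAt_const.add
    (AnalyticAt.clog (f := fun z => z / z₀) (analyticAt_id.div_const) ?_), fun z hz => ?_⟩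
  · rw [div_self hz₀]
    exact Complex.one_mem_slitPlane
  · rw [Complex.exp_add, Complex.exp_log hz₀, Complex.exp_log (div_ne_zero hz hz₀),
      mul_div_cancel₀ _ hz₀]

lemma analyticAt_descend_of_ne_zero
    (hφ : AnalyticOnNhd ℂ (fun p : ℂ × ℂ => φ p.2 p.1) (G.liftsᶜ ×ˢ Set.univ))
    (hper : G.IsSingleValued φ)
    {z₀ : ℂ} (hz₀ : z₀ ≠ 0) (hsing : z₀ ∉ G.sing) (w₀ : ℂ) :
    AnalyticAt ℂ (G.descend χ₀ φ) (z₀, w₀) := by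
  obtain ⟨L, hL, hexp⟩ := exists_analyticAt_exp_eq hz₀
  have hlifts {z : ℂ} (hz : z ≠ 0) (hz' : z ∉ G.sing) : L z ∉ G.lifts := by
    rwa [lifts, Set.mem_ofPred_eq, hexp z hz]
  have hL' : AnalyticAt ℂ (fun p : ℂ × ℂ => L p.1) (z₀, w₀) :=
    AnalyticAt.fun_comp (g := L) (f := fun p : ℂ × ℂ => p.1) hL analyticAt_fst
  have hφL : AnalyticAt ℂ (fun p : ℂ × ℂ => φ (p.2 * Complex.exp (G.k * L p.1)) (L p.1))
      (z₀, w₀) :=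
    AnalyticAt.fun_comp (g := fun p : ℂ × ℂ => φ p.2 p.1)
      (f := fun p : ℂ × ℂ => (L p.1, p.2 * Complex.exp (G.k * L p.1)))
      (hφ _ ⟨hlifts hz₀ hsing, trivial⟩)
      (hL'.prod (analyticAt_snd.mul (analyticAt_const.mul hL').cexp))
  refine hφL.congr ?_
  filter_upwards [continuousAt_fst.eventually_ne hz₀,
    continuousAt_fst.eventually_mem (G.isOpen_notMem_sing.mem_nhds hsing)] with p hp hp'
  rw [← descend_exp (χ₀ := χ₀) hper p.2 (hlifts hp hp'), hexp p.1 hp]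

end Descent

section RegularSolution

variable {G} [FiniteDimensional ℂ V] {r : ℝ} {Ψ : ℂ × ℂ → V →L[ℂ] V} {χ₀ : V} {φ : ℂ → ℂ → V}

lemma exists_regular_family (hΨ : G.IsFrobenius r Ψ) (hχ₀ : G.Q χ₀ = 0) :
    ∃ φ : ℂ → ℂ → V, (∀ lam, IsSolution (G.coeff lam) (φ lam) G.liftsᶜ) ∧ ∀ lam,
      Set.EqOn (φ lam) (fun ζ => Ψ (eulerPoint G.k lam ζ) χ₀) (halfPlane G.k r lam) := by
  have : CompleteSpace V := FiniteDimensional.complete ℂ V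
  have hregular (lam : ℂ) : IsSolution (G.coeff lam) (fun ζ => Ψ (eulerPoint G.k lam ζ) χ₀)
      (halfPlane G.k r lam) := by
    simpa only [exp_smul_apply_of_apply_eq_zero (show (-G.Q) χ₀ = 0 by simp [hχ₀])] using
      hΨ.isSolution lam χ₀
  choose c hc using fun lam => (eventually_mem_halfPlane G.k_lt_one hΨ.pos lam).exists
  choose φ hφc hφ using fun lam => G.isSolvableOn_compl_lifts lam (c lam)
    (hΨ.halfPlane_subset lam (hc lam)) (Ψ (eulerPoint G.k lam (c lam)) χ₀)
  exact ⟨φ, hφ, fun lam => hΨ.eqOn_halfPlane ((hφ lam).mono (hΨ.halfPlane_subset lam))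
    (hregular lam) (hc lam) (hφc lam)⟩

lemma analyticOnNhd_family (hΨ : G.IsFrobenius r Ψ)
    (hφ : ∀ lam, IsSolution (G.coeff lam) (φ lam) G.liftsᶜ)
    (hφΨ : ∀ lam, Set.EqOn (φ lam) (fun ζ => Ψ (eulerPoint G.k lam ζ) χ₀) (halfPlane G.k r lam)) :
    AnalyticOnNhd ℂ (fun p : ℂ × ℂ => φ p.2 p.1) (G.liftsᶜ ×ˢ Set.univ) := by
  have : CompleteSpace V := FiniteDimensional.complete ℂ V
  refine analyticOnNhd_uncurry_of_differentiableOn G.isOpen_compl_lifts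
    G.isPreconnected_compl_lifts G.analyticOnNhd_coeffZero (fun ζ _ => G.analyticAt_coeffOne ζ)
    (fun lam => G.coeff_eq lam ▸ hφ lam) fun y => ?_
  obtain ⟨ζ, hζ⟩ := exists_mem_halfPlane G.k_lt_one hΨ.pos |y|
  have hball {lam : ℂ} (hlam : lam ∈ Metric.ball 0 y) : ζ ∈ halfPlane G.k r lam :=
    hζ lam ((mem_ball_zero_iff.1 hlam).le.trans (le_abs_self y))
  refine ⟨ζ, hΨ.halfPlane_subset 0 (hζ 0 (by simp)), fun lam hlam => ?_⟩
  exact (((hΨ.differentiableAt_param (hball hlam)).clm_apply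
    (differentiableAt_const χ₀)).differentiableWithinAt).congr
      (fun lam hlam => hφΨ lam (hball hlam)) (hφΨ lam (hball hlam))

lemma isSingleValued_family (hΨ : G.IsFrobenius r Ψ)
    (hφ : ∀ lam, IsSolution (G.coeff lam) (φ lam) G.liftsᶜ)
    (hφΨ : ∀ lam, Set.EqOn (φ lam) (fun ζ => Ψ (eulerPoint G.k lam ζ) χ₀) (halfPlane G.k r lam)) :
    G.IsSingleValued φ := fun n lam ζ hζ => by
  have : CompleteSpace V := FiniteDimensional.complete ℂ V
  set lam' := lam * Complex.exp (G.k * (n * (2 * Real.pi * Complex.I)))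
  have hsol : IsSolution (G.coeff lam) (fun ζ => φ lam' (ζ + n * (2 * Real.pi * Complex.I)))
      G.liftsᶜ := fun ζ hζ => by
    have h := (hφ lam' _ (mt (G.translate_mem_lifts n).1 hζ)).comp_add_const
    rwa [G.coeff_translate] at h
  obtain ⟨c, hc⟩ := (eventually_mem_halfPlane G.k_lt_one hΨ.pos lam).exists
  refine eqOn_compl_lifts hsol (hφ lam) (hΨ.halfPlane_subset lam hc) ?_ hζ
  simp only [hφΨ lam' ((translate_mem_halfPlane n).2 hc), hφΨ lam hc, lam', eulerPoint_translate]

variable (G) in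
theorem exists_regular_solution (hχ₀ : G.Q χ₀ = 0) :
    ∃ F : ℂ × ℂ → V, AnalyticOnNhd ℂ F ({z | z ∉ G.sing} ×ˢ Set.univ) ∧
      (∀ lam, IsSolution (G.coeff lam) (fun ζ => F (G.curve lam ζ)) G.liftsᶜ) ∧
      ∀ lam, Tendsto (fun ζ => F (G.curve lam ζ)) (comap Complex.re atBot) (𝓝 χ₀) := by
  obtain ⟨r, Ψ, hΨ⟩ := G.exists_isFrobenius
  obtain ⟨φ, hφ, hφΨ⟩ := exists_regular_family hΨ hχ₀
  have hper := isSingleValued_family hΨ hφ hφΨ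
  refine ⟨G.descend χ₀ φ, ?_, fun lam ζ hζ => ?_, fun lam => ?_⟩
  · rintro ⟨z₀, w₀⟩ ⟨hz₀, -⟩
    rcases eq_or_ne z₀ 0 with rfl | hz
    · exact analyticAt_descend_zero hΨ hφΨ w₀
    · exact analyticAt_descend_of_ne_zero (analyticOnNhd_family hΨ hφ hφΨ) hper hz hz₀ w₀
  · simp only [descend_curve hper lam hζ]
    exact (hφ lam ζ hζ).congr_of_eventuallyEq (Set.EqOn.eventuallyEq_of_mem
      (fun _ => descend_curve hper lam) (G.isOpen_compl_lifts.mem_nhds hζ))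
  · refine (hΨ.tendsto lam χ₀).congr' ?_
    filter_upwards [eventually_mem_halfPlane G.k_lt_one hΨ.pos lam] with ζ hζ
    rw [descend_curve hper lam (hΨ.halfPlane_subset lam hζ), hφΨ lam hζ]

end RegularSolution

end GaugedSystem

section QuasiPeriodic

variable {V : Type*} [NormedAddCommGroup V] [NormedSpace ℂ V]

lemma exp_add_smul [CompleteSpace V] (Q : V →L[ℂ] V) (x y : ℂ) :
    NormedSpace.exp ((x + y) • Q) = NormedSpace.exp (x • Q) * NormedSpace.exp (y • Q) := by
  rw [add_smul, NormedSpace.exp_add_of_commute_of_mem_ball (𝕂 := ℂ)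
    (((Commute.refl Q).smul_left x).smul_right y) (by simp [NormedSpace.expSeries_radius_eq_top])
    (by simp [NormedSpace.expSeries_radius_eq_top])]

lemma exp_smul_apply_exp_neg_smul_apply [CompleteSpace V] (Q : V →L[ℂ] V) (ζ : ℂ) (v : V) :
    NormedSpace.exp (ζ • Q) (NormedSpace.exp (ζ • (-Q)) v) = v := by
  rw [← mul_clm_apply, smul_neg, ← neg_smul, ← exp_add_smul, add_neg_cancel, zero_smul,
    NormedSpace.exp_zero, one_apply_eq_self]

lemma exp_neg_smul_apply_exp_smul_apply [CompleteSpace V] (Q : V →L[ℂ] V) (ζ : ℂ) (v : V) :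
    NormedSpace.exp (ζ • (-Q)) (NormedSpace.exp (ζ • Q) v) = v := by
  simpa only [neg_neg] using exp_smul_apply_exp_neg_smul_apply (-Q) ζ v

lemma iteratedDeriv_of_quasiPeriodic {q : ℂ} {T : V →L[ℂ] V} {c : ℂ → V}
    {n : ℕ} (hc : ContDiff ℂ n c) (h : ∀ lam, c (q * lam) = T (c lam)) :
    T (iteratedDeriv n c 0) = q ^ n • iteratedDeriv n c 0 := by
  have hT : T (iteratedDeriv n c 0) = iteratedDeriv n (T ∘ c) 0 := by
    rw [iteratedDeriv, iteratedDeriv, T.iteratedFDeriv_comp_left hc.contDiffAt le_rfl]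
    rfl
  have hTc : T ∘ c = fun lam => c (q * lam) := funext fun lam => (h lam).symm
  rw [hT, hTc, iteratedDeriv_comp_const_smul hc]
  simp only [mul_zero]

theorem NonResonant.apply_eq_zero_of_quasiPeriodic [FiniteDimensional ℂ V] {Q : V →L[ℂ] V} {k : ℝ}
    (hQ : NonResonant Q k) (h0 : Module.End.HasEigenvalue (Q : V →ₗ[ℂ] V) 0) {c : ℂ → V}
    (hc : Differentiable ℂ c) (hper : ∀ lam, c (Complex.exp (k * (2 * Real.pi * Complex.I)) * lam)
      = NormedSpace.exp ((2 * Real.pi * Complex.I : ℂ) • Q) (c lam)) (lam : ℂ) : Q (c lam) = 0 := by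
  have : CompleteSpace V := FiniteDimensional.complete ℂ V
  have hcoeff (n : ℕ) : Q (iteratedDeriv n c 0) = 0 := by
    refine apply_eq_zero_of_exp_apply (κ := n * k) (fun ν hν m hm => ?_)
      ((iteratedDeriv_of_quasiPeriodic hc.contDiff hper).trans ?_)
    · refine hQ ν 0 hν h0 m n ?_
      rw [hm]; push_cast; ring
    · rw [← Complex.exp_nat_mul]
      congr 2
      ring
  have hsum := Q.hasSum (Complex.hasSum_taylorSeries_of_entire hc 0 lam)
  simp only [map_smul, hcoeff, smul_zero] at hsum
  exact hsum.unique hasSum_zero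

end QuasiPeriodic

namespace GaugedSystem

section Uniqueness

variable {V : Type v} [NormedAddCommGroup V] [NormedSpace ℂ V] {G : GaugedSystem V} {r : ℝ}
  {Ψ : ℂ × ℂ → V →L[ℂ] V}

lemma IsFrobenius.apply_eq_apply [CompleteSpace V] (h : G.IsFrobenius r Ψ) {lam : ℂ} {φ : ℂ → V}
    (hφ : IsSolution (G.coeff lam) φ G.liftsᶜ) {ζ₁ ζ : ℂ} (hζ₁ : ζ₁ ∈ halfPlane G.k r lam)
    (hζ : ζ ∈ halfPlane G.k r lam) :
    φ ζ = Ψ (eulerPoint G.k lam ζ) (NormedSpace.exp (ζ • (-G.Q)) (NormedSpace.exp (ζ₁ • G.Q)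
      (Ring.inverse (Ψ (eulerPoint G.k lam ζ₁)) (φ ζ₁)))) := by
  refine h.eqOn_halfPlane (hφ.mono (h.halfPlane_subset lam)) (h.isSolution lam _) hζ₁ ?_ hζ
  rw [exp_neg_smul_apply_exp_smul_apply, apply_inverse_apply (h.isUnit _ hζ₁)]

lemma IsFrobenius.exists_entire_coordinates [CompleteSpace V] (h : G.IsFrobenius r Ψ)
    {φ : ℂ → ℂ → V} (hφ : ∀ lam, IsSolution (G.coeff lam) (φ lam) G.liftsᶜ)
    (hdiff : ∀ ζ ∉ G.lifts, Differentiable ℂ fun lam => φ lam ζ) :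
    ∃ c : ℂ → V, Differentiable ℂ c ∧ ∀ lam, ∀ ζ ∈ halfPlane G.k r lam,
      φ lam ζ = Ψ (eulerPoint G.k lam ζ) (NormedSpace.exp (ζ • (-G.Q)) (c lam)) ∧
      c lam = NormedSpace.exp (ζ • G.Q) (Ring.inverse (Ψ (eulerPoint G.k lam ζ)) (φ lam ζ)) := by
  choose p hp using fun lam => (eventually_mem_halfPlane G.k_lt_one h.pos lam).exists
  let c : ℂ → V := fun lam => NormedSpace.exp (p lam • G.Q)
    (Ring.inverse (Ψ (eulerPoint G.k lam (p lam))) (φ lam (p lam)))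
  have hrep {lam ζ : ℂ} (hζ : ζ ∈ halfPlane G.k r lam) :
      φ lam ζ = Ψ (eulerPoint G.k lam ζ) (NormedSpace.exp (ζ • (-G.Q)) (c lam)) :=
    h.apply_eq_apply (hφ lam) (hp lam) hζ
  have hc {lam ζ : ℂ} (hζ : ζ ∈ halfPlane G.k r lam) : c lam =
      NormedSpace.exp (ζ • G.Q) (Ring.inverse (Ψ (eulerPoint G.k lam ζ)) (φ lam ζ)) := by
    rw [hrep hζ, inverse_apply_apply (h.isUnit _ hζ), exp_smul_apply_exp_neg_smul_apply]
  refine ⟨c, fun lam₀ => ?_, fun lam ζ hζ => ⟨hrep hζ, hc hζ⟩⟩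
  obtain ⟨ζ, hζ⟩ := exists_mem_halfPlane G.k_lt_one h.pos (‖lam₀‖ + 1)
  have hζ₀ := hζ lam₀ (by simp)
  have hd := ((h.differentiableAt_param hζ₀).inverse (h.isUnit _ hζ₀)).clm_apply
    (hdiff ζ (h.halfPlane_subset _ hζ₀) lam₀)
  have hexpd := (differentiableAt_const (NormedSpace.exp (ζ • G.Q))).clm_apply hd
  refine hexpd.congr_of_eventuallyEq ?_
  filter_upwards [Metric.closedBall_mem_nhds_of_mem (mem_ball_zero_iff.2 (lt_add_one ‖lam₀‖))]
    with lam hlam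
  exact hc (hζ lam (mem_closedBall_zero_iff.1 hlam))

lemma IsFrobenius.quasiPeriodic_coordinates [CompleteSpace V] (h : G.IsFrobenius r Ψ)
    {φ : ℂ → ℂ → V} {c : ℂ → V} (hc : ∀ lam, ∀ ζ ∈ halfPlane G.k r lam,
      c lam = NormedSpace.exp (ζ • G.Q) (Ring.inverse (Ψ (eulerPoint G.k lam ζ)) (φ lam ζ)))
    (hper : ∀ lam, ∀ᶠ ζ in comap Complex.re atBot,
      φ (lam * Complex.exp (G.k * (2 * Real.pi * Complex.I))) (ζ + 2 * Real.pi * Complex.I)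
        = φ lam ζ) (lam : ℂ) :
    c (Complex.exp (G.k * (2 * Real.pi * Complex.I)) * lam)
      = NormedSpace.exp ((2 * Real.pi * Complex.I : ℂ) • G.Q) (c lam) := by
  obtain ⟨ζ, hζ, hζper⟩ :=
    ((eventually_mem_halfPlane G.k_lt_one h.pos lam).and (hper lam)).exists
  have hmem := (translate_mem_halfPlane 1).2 hζ
  have hpoint := eulerPoint_translate G.k 1 lam ζ
  simp only [Int.cast_one, one_mul] at hmem hpoint
  rw [mul_comm, hc _ _ hmem, hc _ _ hζ, hpoint, hζper, add_comm ζ, exp_add_smul, mul_clm_apply]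

theorem eq_zero_of_tendsto_zero [FiniteDimensional ℂ V]
    (h0 : Module.End.HasEigenvalue (G.Q : V →ₗ[ℂ] V) 0) {φ : ℂ → ℂ → V}
    (hφ : ∀ lam, IsSolution (G.coeff lam) (φ lam) G.liftsᶜ)
    (hdiff : ∀ ζ ∉ G.lifts, Differentiable ℂ fun lam => φ lam ζ)
    (hper : ∀ lam, ∀ᶠ ζ in comap Complex.re atBot,
      φ (lam * Complex.exp (G.k * (2 * Real.pi * Complex.I))) (ζ + 2 * Real.pi * Complex.I)
        = φ lam ζ)
    (hlim : ∀ lam, Tendsto (φ lam) (comap Complex.re atBot) (𝓝 0)) (lam : ℂ) :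
    Set.EqOn (φ lam) 0 G.liftsᶜ := by
  have : CompleteSpace V := FiniteDimensional.complete ℂ V
  obtain ⟨r, Ψ, hΨ⟩ := G.exists_isFrobenius
  obtain ⟨c, hcd, hc⟩ := hΨ.exists_entire_coordinates hφ hdiff
  have hQc : G.Q (c lam) = 0 := G.nonResonant.apply_eq_zero_of_quasiPeriodic h0 hcd
    (hΨ.quasiPeriodic_coordinates (fun lam ζ hζ => (hc lam ζ hζ).2) hper) lam
  have hφc {ζ : ℂ} (hζ : ζ ∈ halfPlane G.k r lam) : φ lam ζ = Ψ (eulerPoint G.k lam ζ) (c lam) := by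
    rw [(hc lam ζ hζ).1, exp_smul_apply_of_apply_eq_zero (by rw [_root_.neg_apply, hQc, neg_zero])]
  have hmem := eventually_mem_halfPlane G.k_lt_one hΨ.pos lam
  have hc0 : c lam = 0 := tendsto_nhds_unique
    ((hΨ.tendsto lam (c lam)).congr' (hmem.mono fun ζ hζ => (hφc hζ).symm)) (hlim lam)
  obtain ⟨ζ, hζ⟩ := hmem.exists
  have hzero : IsSolution (G.coeff lam) 0 G.liftsᶜ := fun ζ _ => by
    simp [hasDerivAt_zero]
  exact eqOn_compl_lifts (hφ lam) hzero (hΨ.halfPlane_subset lam hζ) (by simp [hφc hζ, hc0])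

end Uniqueness

end GaugedSystem
section LieGeneration

variable {R L : Type*} [CommRing R] [LieRing L] [LieAlgebra R L]

lemma lie_mem_of_lieSpan_eq_top {M : Type*} [AddCommGroup M] [Module R M] [LieRingModule L M]
    [LieModule R L M] {s : Set L} (hs : LieSubalgebra.lieSpan R L s = ⊤) {U : Submodule R M}
    (hU : ∀ y ∈ s, ∀ m ∈ U, ⁅y, m⁆ ∈ U) (y : L) {m : M} (hm : m ∈ U) : ⁅y, m⁆ ∈ U := by
  have hy : y ∈ LieSubalgebra.lieSpan R L s := hs ▸ LieSubalgebra.mem_top y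
  induction hy using LieSubalgebra.lieSpan_induction generalizing m with
  | mem y hy => exact hU y hy m hm
  | zero => simp
  | add y z _ _ hy hz => rw [add_lie]; exact add_mem (hy hm) (hz hm)
  | smul c y _ hy => rw [smul_lie]; exact U.smul_mem c (hy hm)
  | lie y z _ _ hy hz => rw [lie_lie]; exact sub_mem (hy (hz hm)) (hz (hy hm))

lemma eq_top_of_lie_mem [LieAlgebra.IsSimple R L] {s : Set L}
    (hs : LieSubalgebra.lieSpan R L s = ⊤) {U : Submodule R L} (hne : U ≠ ⊥)
    (hU : ∀ y ∈ s, ∀ x ∈ U, ⁅y, x⁆ ∈ U) : U = ⊤ := by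
  let I : LieIdeal R L := { U with lie_mem := lie_mem_of_lieSpan_eq_top hs hU _ }
  have hI : I.toSubmodule = U := rfl
  rcases LieAlgebra.IsSimple.eq_bot_or_eq_top I with h | h
  · rw [h, LieSubmodule.bot_toSubmodule] at hI
    exact absurd hI.symm hne
  · rw [h, LieSubmodule.top_toSubmodule] at hI
    exact hI.symm

lemma isNilpotent_of_filtration {M : Type*} [AddCommGroup M] [Module R M] {T : Module.End R M}
    {F : ℤ → Submodule R M} (hT : ∀ k, ∀ x ∈ F k, T x ∈ F (k + 1)) {a c : ℤ} (htop : F a = ⊤)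
    (hbot : ∀ k, c < k → F k = ⊥) : IsNilpotent T := by
  have hpow (j : ℕ) (x : M) : (T ^ j) x ∈ F (a + j) := by
    induction j with
    | zero => simp [htop]
    | succ j ih =>
      rw [pow_succ', Module.End.mul_apply, Nat.cast_succ, ← add_assoc]
      exact hT _ _ ih
  refine ⟨(c - a).toNat + 1, LinearMap.ext fun x => ?_⟩
  have hx := hpow ((c - a).toNat + 1) x
  rwa [hbot _ (by omega), Submodule.mem_bot] at hx

end LieGeneration

section HighestWeight

variable {ι R L : Type*} [Finite ι] [CommRing R] [LieRing L] [LieAlgebra R L]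
  {H : LieSubalgebra R L} (b : LieAlgebra.Basis ι H)

/-- The elements annihilated by all `ad (e i)`. -/
def singularSpace : Submodule R L := ⨅ i, LinearMap.ker (LieAlgebra.ad R L (b.e i))

lemma mem_singularSpace {x : L} : x ∈ singularSpace b ↔ ∀ i, ⁅b.e i, x⁆ = 0 := by
  simp [singularSpace]

/-- The smallest subspace that contains `K` and is stable under all `ad (f i)`. -/
def loweringClosure (K : Submodule R L) : Submodule R L :=
  sInf {P | K ≤ P ∧ ∀ i, ∀ x ∈ P, ⁅b.f i, x⁆ ∈ P}

variable {b} {K : Submodule R L}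

lemma le_loweringClosure : K ≤ loweringClosure b K := le_sInf fun _ hP => hP.1

lemma lie_f_mem_loweringClosure (i : ι) {x : L} (hx : x ∈ loweringClosure b K) :
    ⁅b.f i, x⁆ ∈ loweringClosure b K :=
  Submodule.mem_sInf.2 fun P hP => hP.2 i x (Submodule.mem_sInf.1 hx P hP)

lemma loweringClosure_le {P : Submodule R L} (hKP : K ≤ P) (hP : ∀ i, ∀ x ∈ P, ⁅b.f i, x⁆ ∈ P) :
    loweringClosure b K ≤ P :=
  sInf_le ⟨hKP, hP⟩

lemma lie_h_mem_loweringClosure (hK : ∀ h : H, ∀ x ∈ K, ⁅(h : L), x⁆ ∈ K) (j : ι) {x : L}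
    (hx : x ∈ loweringClosure b K) : ⁅b.h j, x⁆ ∈ loweringClosure b K := by
  let P := loweringClosure b K ⊓ (loweringClosure b K).comap (LieAlgebra.ad R L (b.h j))
  suffices loweringClosure b K ≤ P from (this hx).2
  refine loweringClosure_le (fun x hx => ⟨le_loweringClosure hx, ?_⟩) fun i x hx =>
    ⟨lie_f_mem_loweringClosure i hx.1, ?_⟩
  · exact le_loweringClosure (hK (b.h' j) x hx)
  · change ⁅b.h j, ⁅b.f i, x⁆⁆ ∈ loweringClosure b K
    rw [leibniz_lie, b.lie_h_f, zsmul_lie]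
    exact add_mem (zsmul_mem (lie_f_mem_loweringClosure i hx.1) _)
      (lie_f_mem_loweringClosure i hx.2)

lemma lie_e_mem_loweringClosure (hKe : K ≤ singularSpace b)
    (hKh : ∀ h : H, ∀ x ∈ K, ⁅(h : L), x⁆ ∈ K) (j : ι) {x : L}
    (hx : x ∈ loweringClosure b K) : ⁅b.e j, x⁆ ∈ loweringClosure b K := by
  let P := loweringClosure b K ⊓ (loweringClosure b K).comap (LieAlgebra.ad R L (b.e j))
  suffices loweringClosure b K ≤ P from (this hx).2
  refine loweringClosure_le (fun x hx => ⟨le_loweringClosure hx, ?_⟩) fun i x hx =>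
    ⟨lie_f_mem_loweringClosure i hx.1, ?_⟩
  · change ⁅b.e j, x⁆ ∈ loweringClosure b K
    rw [(mem_singularSpace b).1 (hKe hx) j]
    exact zero_mem _
  · change ⁅b.e j, ⁅b.f i, x⁆⁆ ∈ loweringClosure b K
    rw [leibniz_lie]
    refine add_mem ?_ (lie_f_mem_loweringClosure i hx.2)
    rcases eq_or_ne j i with rfl | hij
    · rw [(b.sl2 j).lie_e_f]
      exact lie_h_mem_loweringClosure hKh j hx.1
    · rw [b.lie_e_f_ne j i hij, zero_lie]
      exact zero_mem _

lemma loweringClosure_eq_top [LieAlgebra.IsSimple R L] (hK : K ≠ ⊥) (hKe : K ≤ singularSpace b)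
    (hKh : ∀ h : H, ∀ x ∈ K, ⁅(h : L), x⁆ ∈ K) : loweringClosure b K = ⊤ := by
  refine eq_top_of_lie_mem b.span_ef (ne_bot_of_le_ne_bot hK le_loweringClosure) ?_
  rintro _ (⟨i, rfl⟩ | ⟨i, rfl⟩) x hx
  exacts [lie_e_mem_loweringClosure hKe hKh i hx, lie_f_mem_loweringClosure i hx]

lemma lie_mem_singularSpace {x : L} (h : H) (hx : x ∈ singularSpace b) :
    ⁅(h : L), x⁆ ∈ singularSpace b := by
  cases nonempty_fintype ι
  rw [mem_singularSpace] at *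
  intro i
  have hroot : ⁅(h : L), b.e i⁆ = b.baseSupp i h • b.e i := (b.baseSupp_apply_smul_e i h).symm
  rw [leibniz_lie, hx, lie_zero, add_zero, ← lie_skew (b.e i) (h : L), neg_lie, hroot,
    smul_lie, hx, smul_zero, neg_zero]

variable (b) in
include b in
lemma nonempty_of_isSimple [LieAlgebra.IsSimple R L] : Nonempty ι := by
  by_contra h
  rw [not_nonempty_iff] at h
  have hspan := b.span_ef
  rw [Set.range_eq_empty, Set.range_eq_empty, Set.union_empty, LieSubalgebra.span_empty] at hspan
  refine LieAlgebra.IsSimple.non_abelian (R := R) (L := L) ⟨fun x y => ?_⟩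
  have hx : x ∈ (⊥ : LieSubalgebra R L) := hspan ▸ LieSubalgebra.mem_top x
  rw [(LieSubalgebra.mem_bot x).1 hx, zero_lie]

end HighestWeight

section PrincipalGrading

variable {ι : Type*} [Fintype ι] [DecidableEq ι] {L : Type u} [LieRing L] [LieAlgebra ℂ L]
  {H : LieSubalgebra ℂ L} (b : LieAlgebra.Basis ι H)

lemma lie_rhoCheck_of_forall {x : L} {m : ι} {c : ℂ}
    (hx : ∀ j, ⁅b.h j, x⁆ = (c * (b.A m j : ℂ)) • x) : ⁅(rhoCheck b : L), x⁆ = c • x := by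
  set B : Matrix ι ι ℂ := b.A.map (Int.cast : ℤ → ℂ) with hB
  have hdet : IsUnit B.det := by
    have h1 : B.det = ((b.A.det : ℤ) : ℂ) := (RingHom.map_det (Int.castRingHom ℂ) b.A).symm
    rw [h1, isUnit_iff_ne_zero, Int.cast_ne_zero]
    exact Matrix.nondegenerate_iff_det_ne_zero.1 b.nondegen
  have hrho : (rhoCheck b : L) = ∑ i, ∑ j, (B⁻¹ : Matrix ι ι ℂ) j i • b.h j := by
    simp only [rhoCheck, ← hB, AddSubmonoidClass.coe_finsetSum]
    rfl
  have hinv (i : ι) : ∑ j, B m j * (B⁻¹ : Matrix ι ι ℂ) j i = (1 : Matrix ι ι ℂ) m i := by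
    rw [← Matrix.mul_nonsing_inv B hdet, Matrix.mul_apply]
  calc ⁅(rhoCheck b : L), x⁆
      = ∑ i, ∑ j, (c * (B m j * (B⁻¹ : Matrix ι ι ℂ) j i)) • x := by
        simp_rw [hrho, sum_lie, smul_lie, hx, smul_smul]
        refine Finset.sum_congr rfl fun i _ => Finset.sum_congr rfl fun j _ => ?_
        rw [mul_comm _ (c * _), mul_assoc, hB, Matrix.map_apply]
    _ = c • x := by
        simp_rw [← Finset.sum_smul, ← Finset.mul_sum, hinv, Matrix.one_apply]
        simp

lemma lie_rhoCheck_e (i : ι) : ⁅(rhoCheck b : L), b.e i⁆ = (1 : ℂ) • b.e i :=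
  lie_rhoCheck_of_forall b (m := i) fun j => by
    rw [b.lie_h_e, one_mul, Int.cast_smul_eq_zsmul]

lemma lie_rhoCheck_f (i : ι) : ⁅(rhoCheck b : L), b.f i⁆ = (-1 : ℂ) • b.f i :=
  lie_rhoCheck_of_forall b (m := i) fun j => by
    rw [b.lie_h_f, neg_one_mul, ← Int.cast_neg, Int.cast_smul_eq_zsmul]

lemma lie_rhoCheck_cartan (h : H) : ⁅(rhoCheck b : L), (h : L)⁆ = 0 := by
  have := b.isLieAbelian_cartan
  simpa using congrArg Subtype.val (trivial_lie_zero H H (rhoCheck b) h)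

/-- The eigenspaces of `ad ρ^∨`, for arbitrary complex degrees: that only integers occur is part of
what has to be shown. -/
def gradedPiece (μ : ℂ) : Submodule ℂ L :=
  Module.End.eigenspace (LieAlgebra.ad ℂ L (rhoCheck b : L)) μ

/-- The sum of the graded pieces with degrees in `s`. -/
def gradedSum (s : Set ℂ) : Submodule ℂ L := ⨆ μ ∈ s, gradedPiece b μ

variable {b} {s t : Set ℂ} {μ ν : ℂ} {x y : L}

lemma mem_gradedPiece : x ∈ gradedPiece b μ ↔ ⁅(rhoCheck b : L), x⁆ = μ • x :=
  Module.End.mem_eigenspace_iff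

lemma principalDegree_eq (d : ℤ) : principalDegree b d = gradedPiece b d := by
  ext x
  rw [mem_gradedPiece]
  rfl

lemma lie_mem_gradedPiece (hx : x ∈ gradedPiece b μ) (hy : y ∈ gradedPiece b ν) :
    ⁅x, y⁆ ∈ gradedPiece b (μ + ν) := by
  rw [mem_gradedPiece] at *
  rw [leibniz_lie, hx, hy, smul_lie, lie_smul, add_smul]

lemma gradedPiece_le_gradedSum (hμ : μ ∈ s) : gradedPiece b μ ≤ gradedSum b s :=
  le_biSup (gradedPiece b) hμ

lemma gradedSum_le {P : Submodule ℂ L} (h : ∀ μ ∈ s, gradedPiece b μ ≤ P) : gradedSum b s ≤ P :=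
  iSup₂_le h

open Pointwise in
lemma lie_mem_gradedSum (hx : x ∈ gradedSum b s) (hy : y ∈ gradedSum b t) :
    ⁅x, y⁆ ∈ gradedSum b (s + t) := by
  have hhom : ∀ μ ∈ s, ∀ z ∈ gradedPiece b μ, ⁅z, y⁆ ∈ gradedSum b (s + t) := fun μ hμ z hz =>
    gradedSum_le (P := (gradedSum b (s + t)).comap (LieAlgebra.ad ℂ L z))
      (fun ν hν w hw => gradedPiece_le_gradedSum (Set.add_mem_add hμ hν)
        (lie_mem_gradedPiece hz hw)) hy
  have hneg : ⁅y, x⁆ ∈ gradedSum b (s + t) :=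
    gradedSum_le (P := (gradedSum b (s + t)).comap (LieAlgebra.ad ℂ L y))
      (fun μ hμ z hz => by
        rw [Submodule.mem_comap, LieAlgebra.ad_apply, ← lie_skew]
        exact neg_mem (hhom μ hμ z hz)) hx
  rw [← lie_skew]
  exact neg_mem hneg

lemma gradedSum_mono (h : s ⊆ t) : gradedSum b s ≤ gradedSum b t := biSup_mono h

open Pointwise in
lemma lieSpan_le_gradedSum (hs : s + s ⊆ s) {S : Set L} (hS : S ⊆ gradedSum b s) :
    (LieSubalgebra.lieSpan ℂ L S).toSubmodule ≤ gradedSum b s := by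
  let K : LieSubalgebra ℂ L :=
    { gradedSum b s with lie_mem' := fun hx hy => gradedSum_mono hs (lie_mem_gradedSum hx hy) }
  exact (LieSubalgebra.lieSpan_le (K := K)).2 hS

variable (b)

lemma e_mem_gradedSum (i : ι) (h : 1 ∈ s) : b.e i ∈ gradedSum b s :=
  gradedPiece_le_gradedSum h (mem_gradedPiece.2 (lie_rhoCheck_e b i))

lemma f_mem_gradedSum (i : ι) (h : -1 ∈ s) : b.f i ∈ gradedSum b s :=
  gradedPiece_le_gradedSum h (mem_gradedPiece.2 (lie_rhoCheck_f b i))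

lemma gradedSum_range_intCast : gradedSum b (Set.range (Int.cast : ℤ → ℂ)) = ⊤ := by
  have h := lieSpan_le_gradedSum (b := b) (s := Set.range (Int.cast : ℤ → ℂ))
    (S := Set.range b.e ∪ Set.range b.f)
    (by rintro _ ⟨_, ⟨m, rfl⟩, _, ⟨n, rfl⟩, rfl⟩; exact ⟨m + n, Int.cast_add m n⟩) <| by
      rintro _ (⟨i, rfl⟩ | ⟨i, rfl⟩)
      exacts [e_mem_gradedSum b i ⟨1, Int.cast_one⟩, f_mem_gradedSum b i ⟨-1, by simp⟩]
  rwa [b.span_ef, LieSubalgebra.top_toSubmodule, top_le_iff] at h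

lemma nPlus_le_gradedSum : nPlus b ≤ gradedSum b ((Int.cast : ℤ → ℂ) '' Set.Ici 1) := by
  refine lieSpan_le_gradedSum ?_ ?_
  · rintro _ ⟨_, ⟨m, hm, rfl⟩, _, ⟨n, hn, rfl⟩, rfl⟩
    exact ⟨m + n, by simp only [Set.mem_Ici] at *; omega, Int.cast_add m n⟩
  · rintro _ ⟨i, rfl⟩
    exact e_mem_gradedSum b i ⟨1, Set.self_mem_Ici, Int.cast_one⟩

variable {b} in
lemma gradedPiece_eq_bot_of_notMem (hs : gradedSum b s = ⊤) (hμ : μ ∉ s) :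
    gradedPiece b μ = ⊥ := by
  have hind : iSupIndep (gradedPiece b) := Module.End.eigenspaces_iSupIndep _
  exact disjoint_top.1 (hs ▸ hind.disjoint_biSup hμ)

lemma exists_forall_gradedPiece_eq_bot [FiniteDimensional ℂ L] :
    ∃ N : ℤ, ∀ d : ℤ, N < |d| → gradedPiece b d = ⊥ := by
  have hfin : {d : ℤ | gradedPiece b d ≠ ⊥}.Finite :=
    (Module.End.finite_hasEigenvalue (LieAlgebra.ad ℂ L (rhoCheck b : L))).preimage
      (f := (Int.cast : ℤ → ℂ)) Int.cast_injective.injOn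
  obtain ⟨N, hN⟩ := (hfin.image fun d => |d|).bddAbove
  exact ⟨N, fun d hd => by_contra fun h => absurd (hN ⟨d, h, rfl⟩) (not_le.2 hd)⟩

omit [DecidableEq ι] in
variable {b} in
lemma ad_pow_finrank_eq_zero [FiniteDimensional ℂ L] {n : L} (hn : n ∈ nPlus b) :
    LieAlgebra.ad ℂ L n ^ Module.finrank ℂ L = 0 := by
  classical
  obtain ⟨N, hN⟩ := exists_forall_gradedPiece_eq_bot b
  let F : ℤ → Submodule ℂ L := fun k => gradedSum b ((Int.cast : ℤ → ℂ) '' Set.Ici k)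
  have hstep : ∀ k, ∀ x ∈ F k, ⁅n, x⁆ ∈ F (k + 1) := fun k x hx => by
    refine gradedSum_mono ?_ (lie_mem_gradedSum (nPlus_le_gradedSum b hn) hx)
    rintro _ ⟨_, ⟨m, hm, rfl⟩, _, ⟨m', hm', rfl⟩, rfl⟩
    exact ⟨m + m', by simp only [Set.mem_Ici] at *; omega, Int.cast_add m m'⟩
  have htop : F (-N) = ⊤ := by
    rw [eq_top_iff, ← gradedSum_range_intCast b]
    refine gradedSum_le ?_
    rintro _ ⟨d, rfl⟩
    by_cases hd : -N ≤ d
    · exact gradedPiece_le_gradedSum ⟨d, hd, rfl⟩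
    · rw [hN d (lt_of_lt_of_le (by omega) (neg_le_abs d))]
      exact bot_le
  have hbot : ∀ k, N < k → F k = ⊥ := fun k hk => by
    refine eq_bot_iff.2 (gradedSum_le ?_)
    rintro _ ⟨d, hd, rfl⟩
    rw [hN d (lt_of_lt_of_le (hk.trans_le hd) (le_abs_self d))]
  obtain ⟨j, hj⟩ := isNilpotent_of_filtration (T := LieAlgebra.ad ℂ L n) hstep htop hbot
  refine LinearMap.ext fun x =>
    Module.End.ker_pow_le_ker_pow_finrank (LieAlgebra.ad ℂ L n) j (?_ : x ∈ LinearMap.ker _)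
  rw [hj, LinearMap.mem_ker, LinearMap.zero_apply]

end PrincipalGrading

section HighestRoot

variable {ι : Type*} [Fintype ι] {L : Type u} [LieRing L] [LieAlgebra ℂ L]
  {H : LieSubalgebra ℂ L} (b : LieAlgebra.Basis ι H)

variable [LieAlgebra.IsSimple ℂ L] [DecidableEq ι]

lemma gradedPiece_zero_ne_bot : gradedPiece b 0 ≠ ⊥ := by
  obtain ⟨i⟩ := nonempty_of_isSimple b
  refine fun h => b.linInd.ne_zero i ?_
  rw [← Submodule.mem_bot ℂ, ← h, mem_gradedPiece, zero_smul]
  exact lie_rhoCheck_cartan b (b.h' i)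

variable {b} in
lemma gradedSum_range_sub_natCast_eq_top {μ : ℂ} (hμ : singularSpace b ⊓ gradedPiece b μ ≠ ⊥) :
    gradedSum b (Set.range fun n : ℕ => μ - n) = ⊤ := by
  rw [← top_le_iff, ← loweringClosure_eq_top hμ inf_le_left]
  · refine loweringClosure_le (inf_le_right.trans (gradedPiece_le_gradedSum ⟨0, by simp⟩)) ?_
    intro i x hx
    refine gradedSum_mono ?_ (lie_mem_gradedSum (f_mem_gradedSum b i (Set.mem_singleton _)) hx)
    rintro _ ⟨_, rfl, _, ⟨n, rfl⟩, rfl⟩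
    exact ⟨n + 1, by push_cast; ring⟩
  · refine fun h x hx => ⟨lie_mem_singularSpace h hx.1, ?_⟩
    have hdeg : (h : L) ∈ gradedPiece b 0 :=
      mem_gradedPiece.2 ((lie_rhoCheck_cartan b h).trans (zero_smul ℂ _).symm)
    exact zero_add μ ▸ lie_mem_gradedPiece hdeg hx.2

variable {b} in
lemma eq_coxeterNumber_sub_one {μ : ℂ} (hμ : singularSpace b ⊓ gradedPiece b μ ≠ ⊥) :
    μ = ((coxeterNumber b - 1 : ℤ) : ℂ) := by
  have hdeg (ν : ℂ) (hν : gradedPiece b ν ≠ ⊥) : ∃ n : ℕ, μ - n = ν :=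
    by_contra fun h =>
      hν (gradedPiece_eq_bot_of_notMem (gradedSum_range_sub_natCast_eq_top hμ) h)
  obtain ⟨m, hm⟩ := hdeg 0 (gradedPiece_zero_ne_bot b)
  obtain rfl : μ = m := sub_eq_zero.1 hm
  have hgreatest : IsGreatest {d : ℕ | principalDegree b (d : ℤ) ≠ ⊥} m := by
    refine ⟨fun h => hμ ?_, fun d hd => ?_⟩
    · rw [principalDegree_eq, Int.cast_natCast] at h
      rw [h, inf_bot_eq]
    · rw [Set.mem_ofPred_eq, principalDegree_eq, Int.cast_natCast] at hd
      obtain ⟨n, hn⟩ := hdeg d hd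
      have hdn : m = d + n := by exact_mod_cast sub_eq_iff_eq_add.1 hn
      omega
  simp [coxeterNumber, hgreatest.csSup_eq]

theorem singularSpace_le [FiniteDimensional ℂ L] :
    singularSpace b ≤ principalDegree b (coxeterNumber b - 1) := by
  have htop : ⨆ μ, gradedPiece b μ = ⊤ :=
    top_le_iff.1 ((gradedSum_range_intCast b).ge.trans (iSup₂_le_iSup _ _))
  have hsplit : singularSpace b ⊓ (⨆ μ, gradedPiece b μ) = ⨆ μ, singularSpace b ⊓ gradedPiece b μ :=
    Submodule.inf_iSup_genEigenspace (fun x hx => lie_mem_singularSpace (rhoCheck b) hx) 1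
  rw [← inf_top_eq (singularSpace b), ← htop, hsplit, principalDegree_eq]
  refine iSup_le fun μ => ?_
  by_cases hμ : singularSpace b ⊓ gradedPiece b μ = ⊥
  · rw [hμ]
    exact bot_le
  · rw [← eq_coxeterNumber_sub_one hμ]
    exact inf_le_right

end HighestRoot

section Conjugation

section BanachAlgebra

variable {A : Type*} [NormedRing A] [NormedAlgebra ℂ A] [CompleteSpace A]

lemma exp_mul_left_apply (a x : A) :
    NormedSpace.exp (ContinuousLinearMap.mul ℂ A a) x = NormedSpace.exp a * x := by
  have hpow (n : ℕ) : (ContinuousLinearMap.mul ℂ A a ^ n) x = a ^ n * x := by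
    induction n with
    | zero => rw [pow_zero, pow_zero, one_mul, one_apply_eq_self]
    | succ n ih =>
      rw [pow_succ', mul_clm_apply, ih, ContinuousLinearMap.mul_apply', pow_succ', mul_assoc]
  refine (hasSum_exp_apply _ x).unique ?_
  simpa only [hpow, smul_mul_assoc] using
    (NormedSpace.exp_series_hasSum_exp' (𝕂 := ℂ) a).mul_right x

lemma exp_mul_right_apply (a x : A) :
    NormedSpace.exp ((ContinuousLinearMap.mul ℂ A).flip a) x = x * NormedSpace.exp a := by
  have hpow (n : ℕ) : ((ContinuousLinearMap.mul ℂ A).flip a ^ n) x = x * a ^ n := by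
    induction n with
    | zero => rw [pow_zero, pow_zero, mul_one, one_apply_eq_self]
    | succ n ih =>
      rw [pow_succ', mul_clm_apply, ih, ContinuousLinearMap.flip_apply,
        ContinuousLinearMap.mul_apply', pow_succ, mul_assoc]
  refine (hasSum_exp_apply _ x).unique ?_
  simpa only [hpow, mul_smul_comm] using
    (NormedSpace.exp_series_hasSum_exp' (𝕂 := ℂ) a).mul_left x

-- Left multiplication is the sum of right multiplication and the commutator, which commute.
lemma exp_mul_eq_exp_commutatorCLM_mul (a x : A) :
    NormedSpace.exp a * x = NormedSpace.exp (commutatorCLM a) x * NormedSpace.exp a := by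
  let : NormedAlgebra ℚ (A →L[ℂ] A) := NormedAlgebra.restrictScalars ℚ ℂ _
  have hassoc : Commute ((ContinuousLinearMap.mul ℂ A).flip a) (ContinuousLinearMap.mul ℂ A a) :=
    ContinuousLinearMap.ext fun y => mul_assoc a y a
  have hcomm : Commute ((ContinuousLinearMap.mul ℂ A).flip a) (commutatorCLM a) :=
    hassoc.sub_right (.refl _)
  rw [← exp_mul_left_apply, ← exp_mul_right_apply, ← mul_clm_apply,
    ← NormedSpace.exp_add_of_commute hcomm, commutatorCLM, add_sub_cancel]

lemma hasSum_commutatorCLM_pow_mul_exp (a x : A) :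
    HasSum (fun m : ℕ => (m.factorial⁻¹ : ℂ) • (commutatorCLM a ^ m) x * NormedSpace.exp a)
      (NormedSpace.exp a * x) := by
  rw [exp_mul_eq_exp_commutatorCLM_mul]
  exact (hasSum_exp_apply _ x).mul_right _

lemma exp_mul_of_commutatorCLM_eq_smul {a x : A} {μ : ℂ} (h : commutatorCLM a x = μ • x) :
    NormedSpace.exp a * x = Complex.exp μ • (x * NormedSpace.exp a) := by
  rw [exp_mul_eq_exp_commutatorCLM_mul, exp_apply_of_apply_eq_smul h, smul_mul_assoc]

end BanachAlgebra

variable {V : Type*} [NormedAddCommGroup V] [NormedSpace ℂ V]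

lemma hasEigenvalue_of_mul_eq_mul {A B U : V →L[ℂ] V} (hU : IsUnit U) (h : A * U = U * B) {μ : ℂ}
    (hμ : Module.End.HasEigenvalue (A : V →ₗ[ℂ] V) μ) :
    Module.End.HasEigenvalue (B : V →ₗ[ℂ] V) μ := by
  obtain ⟨v, hv⟩ := hμ.exists_hasEigenvector
  have hAv : A v = μ • v := hv.apply_eq_smul
  refine Module.End.hasEigenvalue_of_hasEigenvector (x := Ring.inverse U v)
    ⟨Module.End.mem_eigenspace_iff.2 ?_, fun h0 => hv.2 ?_⟩
  · change B (Ring.inverse U v) = μ • Ring.inverse U v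
    rw [← inverse_apply_apply hU (B _), ← mul_clm_apply U B, ← h, mul_clm_apply,
      apply_inverse_apply hU, hAv, map_smul]
  · rw [← apply_inverse_apply hU v, h0, map_zero]

variable [FiniteDimensional ℂ V]

lemma isClosed_setOf_hasEigenvalue (μ : ℂ) :
    IsClosed {A : V →L[ℂ] V | Module.End.HasEigenvalue (A : V →ₗ[ℂ] V) μ} := by
  have : CompleteSpace V := FiniteDimensional.complete ℂ V
  have hset : {A : V →L[ℂ] V | Module.End.HasEigenvalue (A : V →ₗ[ℂ] V) μ} =
      (fun A => algebraMap ℂ (V →L[ℂ] V) μ - A) ⁻¹' nonunits (V →L[ℂ] V) := by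
    ext A
    rw [Set.mem_ofPred_eq, Module.End.hasEigenvalue_iff_mem_spectrum,
      ← AlgEquiv.spectrum_eq (Module.End.toContinuousLinearMap V)]
    rfl
  rw [hset]
  exact nonunits.isClosed.preimage (continuous_const.sub continuous_id)

end Conjugation

section Representation

variable {L : Type u} [LieRing L] [LieAlgebra ℂ L]
  {V : Type v} [NormedAddCommGroup V] [NormedSpace ℂ V] [FiniteDimensional ℂ V]
  [LieRingModule L V] [LieModule ℂ L V]

variable (L V) in
/-- The representation on `V` by continuous linear maps. -/
def rep : L →ₗ[ℂ] V →L[ℂ] V :=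
  (LinearMap.toContinuousLinearMap : (V →ₗ[ℂ] V) ≃ₗ[ℂ] V →L[ℂ] V).toLinearMap ∘ₗ
    (LieModule.toEnd ℂ L V : L →ₗ[ℂ] Module.End ℂ V)

@[simp] lemma rep_apply (x : L) (v : V) : rep L V x v = ⁅x, v⁆ := rfl

lemma rep_lie (x y : L) : rep L V ⁅x, y⁆ = commutatorCLM (rep L V x) (rep L V y) := by
  ext v
  exact lie_lie x y v

lemma exp_rep_mul_rep {n : L} {M : ℕ} (hn : LieAlgebra.ad ℂ L n ^ M = 0) (x : L) :
    NormedSpace.exp (rep L V n) * rep L V x =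
      rep L V (∑ m ∈ Finset.range M, ((m.factorial : ℂ)⁻¹) • ((LieAlgebra.ad ℂ L n) ^ m) x) *
        NormedSpace.exp (rep L V n) := by
  have : CompleteSpace V := FiniteDimensional.complete ℂ V
  have hpow (m : ℕ) :
      (commutatorCLM (rep L V n) ^ m) (rep L V x) = rep L V ((LieAlgebra.ad ℂ L n ^ m) x) := by
    induction m with
    | zero => rfl
    | succ m ih =>
      rw [pow_succ', mul_clm_apply, ih, ← rep_lie, pow_succ', Module.End.mul_apply,
        LieAlgebra.ad_apply]
  have hzero (m : ℕ) (hm : m ∉ Finset.range M) :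
      (m.factorial⁻¹ : ℂ) • rep L V ((LieAlgebra.ad ℂ L n ^ m) x) *
        NormedSpace.exp (rep L V n) = 0 := by
    rw [pow_eq_zero_of_le (not_lt.1 (Finset.mem_range.not.1 hm)) hn, LinearMap.zero_apply,
      map_zero, smul_zero, zero_mul]
  have hsum := hasSum_commutatorCLM_pow_mul_exp (rep L V n) (rep L V x)
  simp only [hpow] at hsum
  rw [hsum.unique (hasSum_sum_of_ne_finset_zero hzero)]
  simp only [map_sum, map_smul, Finset.sum_mul]

lemma exists_isWeight {H : LieSubalgebra ℂ L} [IsLieAbelian H] (l : H) {μ : ℂ}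
    (hμ : Module.End.HasEigenvalue (LieModule.toEnd ℂ L V (l : L)) μ) :
    ∃ ω : Module.Dual ℂ H, IsWeight H V ω ∧ ω l = μ := by
  let W : LieSubmodule ℂ H V :=
    { Module.End.eigenspace (LieModule.toEnd ℂ L V (l : L)) μ with
      lie_mem := fun {h v} hv => by
        have hlv : ⁅(l : L), v⁆ = μ • v := Module.End.mem_eigenspace_iff.1 hv
        have hlh : ⁅(l : L), (h : L)⁆ = 0 := congrArg Subtype.val (trivial_lie_zero H H l h)
        refine Module.End.mem_eigenspace_iff.2 ?_
        change ⁅(l : L), ⁅(h : L), v⁆⁆ = μ • ⁅(h : L), v⁆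
        rw [leibniz_lie, hlh, zero_lie, zero_add, hlv, lie_smul] }
  obtain ⟨v, hv⟩ := hμ.exists_hasEigenvector
  have : Nontrivial W := ⟨⟨⟨v, hv.1⟩, 0, fun h => hv.2 (congrArg Subtype.val h)⟩⟩
  obtain ⟨ω, hω⟩ := LieModule.exists_nontrivial_weightSpace_of_isSolvable ℂ H W
  obtain ⟨⟨w, hw⟩, hw0⟩ := exists_ne (0 : LieModule.weightSpace W ω)
  rw [LieModule.mem_weightSpace] at hw
  have hwω (h : H) : ⁅(h : L), (w : V)⁆ = ω h • (w : V) := congrArg Subtype.val (hw h)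
  have hwV : (w : V) ≠ 0 := fun h => hw0 (Subtype.ext (Subtype.ext h))
  have hwl : ⁅(l : L), (w : V)⁆ = μ • (w : V) := Module.End.mem_eigenspace_iff.1 w.2
  exact ⟨ω, ⟨w, hwV, hwω⟩, smul_left_injective ℂ hwV ((hwω l).symm.trans hwl)⟩

variable {ι : Type*} [Fintype ι] [DecidableEq ι] {H : LieSubalgebra ℂ L}
  (b : LieAlgebra.Basis ι H)

lemma expRho_eq (ζ : ℂ) : expRho V b ζ = NormedSpace.exp (ζ • rep L V (rhoCheck b : L)) := rfl

lemma expRho_add (x y : ℂ) : expRho V b (x + y) = expRho V b x * expRho V b y :=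
  exp_add_smul _ x y

lemma expRho_zero : expRho V b 0 = 1 := by
  rw [expRho_eq, zero_smul, NormedSpace.exp_zero]

lemma isUnit_expRho (ζ : ℂ) : IsUnit (expRho V b ζ) :=
  ⟨⟨expRho V b ζ, expRho V b (-ζ), by rw [← expRho_add, add_neg_cancel, expRho_zero],
    by rw [← expRho_add, neg_add_cancel, expRho_zero]⟩, rfl⟩

variable {b}

lemma expRho_mul_rep {μ : ℂ} {x : L} (hx : x ∈ gradedPiece b μ) (ζ : ℂ) :
    expRho V b ζ * rep L V x = Complex.exp (ζ * μ) • (rep L V x * expRho V b ζ) := by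
  have : CompleteSpace V := FiniteDimensional.complete ℂ V
  have hcomm : commutatorCLM (ζ • rep L V (rhoCheck b : L)) (rep L V x) =
      (ζ * μ) • rep L V x := by
    rw [← map_smul, ← rep_lie, smul_lie, mem_gradedPiece.1 hx, smul_smul, map_smul]
  rw [expRho_eq, exp_mul_of_commutatorCLM_eq_smul hcomm]

omit [DecidableEq ι] in
lemma hasEigenvalue_of_unipotentConj [FiniteDimensional ℂ L] {x y : L} (h : UnipotentConj b x y)
    {μ : ℂ} (hμ : Module.End.HasEigenvalue (LieModule.toEnd ℂ L V y) μ) :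
    Module.End.HasEigenvalue (LieModule.toEnd ℂ L V x) μ := by
  have : CompleteSpace V := FiniteDimensional.complete ℂ V
  let : NormedAlgebra ℚ (V →L[ℂ] V) := NormedAlgebra.restrictScalars ℚ ℂ _
  obtain ⟨n, hn, rfl⟩ := h
  exact hasEigenvalue_of_mul_eq_mul (NormedSpace.isUnit_exp (rep L V n))
    (exp_rep_mul_rep (V := V) (ad_pow_finrank_eq_zero hn) x).symm hμ

variable (b) in
lemma principalF_mem_gradedPiece : principalF b ∈ gradedPiece b (-1) :=
  sum_mem fun i _ => mem_gradedPiece.2 (lie_rhoCheck_f b i)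

lemma cartan_mem_gradedPiece (h : H) : (h : L) ∈ gradedPiece b 0 :=
  mem_gradedPiece.2 ((lie_rhoCheck_cartan b h).trans (zero_smul ℂ _).symm)

omit [DecidableEq ι] in
-- Conjugation by `exp (ζ ρ^∨)` turns `f + l` into `s f + l` with `s = e^{-ζ}`, and `s → 0`.
lemma hasEigenvalue_of_principalF_add (l : H) {μ : ℂ}
    (hμ : Module.End.HasEigenvalue (LieModule.toEnd ℂ L V (principalF b + (l : L))) μ) :
    Module.End.HasEigenvalue (LieModule.toEnd ℂ L V (l : L)) μ := by
  classical
  let T : ℂ → V →L[ℂ] V := fun s => s • rep L V (principalF b) + rep L V (l : L)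
  let S : Set ℂ := T ⁻¹' {A | Module.End.HasEigenvalue (A : V →ₗ[ℂ] V) μ}
  have hclosed : IsClosed S := (isClosed_setOf_hasEigenvalue μ).preimage (by fun_prop)
  have hscaled : {0}ᶜ ⊆ S := fun s hs => by
    have hexp : Complex.exp (Complex.log s * -1) * s = 1 := by
      rw [mul_neg_one, Complex.exp_neg, Complex.exp_log hs, inv_mul_cancel₀ hs]
    refine hasEigenvalue_of_mul_eq_mul (A := rep L V (principalF b + (l : L)))
      (isUnit_expRho b (Complex.log s)) ?_ hμ
    rw [mul_add, mul_smul_comm, expRho_mul_rep (principalF_mem_gradedPiece b), smul_smul,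
      mul_comm s, hexp, expRho_mul_rep (cartan_mem_gradedPiece l), mul_zero, Complex.exp_zero,
      one_smul, one_smul, map_add, add_mul]
  have hzero : (0 : ℂ) ∈ S :=
    hclosed.closure_subset_iff.2 hscaled ((dense_compl_singleton (0 : ℂ)).closure_eq ▸ trivial)
  have hT : T 0 = rep L V (l : L) := by simp only [T, zero_smul, zero_add]
  rw [Set.mem_preimage, hT] at hzero
  exact hzero

end Representation

section Sign

lemma sgn_ne_zero (p : ZMod 2) : sgn p ≠ 0 := pow_ne_zero _ (neg_ne_zero.2 one_ne_zero)

lemma sgn_mul_sgn_mul (p : ZMod 2) (z : ℂ) : sgn p * (sgn p * z) = z := by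
  rw [← mul_assoc, sgn, ← mul_pow, neg_one_mul, neg_neg, one_pow, one_mul]

lemma sgn_zero : sgn 0 = 1 := pow_zero _

end Sign

lemma eq_of_sub_eq_intCast_add_mul_ratCast {c : ℚ} {μ ν : ℂ} {m n : ℤ} (h : μ - ν = m + n * c)
    (hμν : ∀ N : ℕ, 0 < N → c.den * (μ - ν) ≠ N) (hνμ : ∀ N : ℕ, 0 < N → c.den * (ν - μ) ≠ N) :
    μ = ν := by
  have hden : (c.den : ℂ) ≠ 0 := Nat.cast_ne_zero.2 c.den_nz
  have hnum : (c.den : ℂ) * c = c.num := by exact_mod_cast c.den_mul_eq_num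
  obtain ⟨N, hN⟩ : ∃ N : ℤ, c.den * (μ - ν) = N :=
    ⟨c.den * m + n * c.num, by rw [h]; push_cast; rw [← hnum]; ring⟩
  obtain ⟨j, rfl | rfl⟩ := N.eq_nat_or_neg <;> rcases j.eq_zero_or_pos with rfl | hj
  · exact sub_eq_zero.1 ((mul_eq_zero.1 (by simpa using hN)).resolve_left hden)
  · exact absurd (by simpa using hN) (hμν j hj)
  · exact sub_eq_zero.1 ((mul_eq_zero.1 (by simpa using hN)).resolve_left hden)
  · refine absurd ?_ (hνμ j hj)
    rw [← neg_sub μ ν, mul_neg, hN]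
    push_cast
    ring

section Gauge

variable {L : Type u} [LieRing L] [LieAlgebra ℂ L] {H : LieSubalgebra ℂ L}
  {ι : Type*} [Fintype ι] [DecidableEq ι] (b : LieAlgebra.Basis ι H)
  (V : Type v) [NormedAddCommGroup V] [NormedSpace ℂ V] [FiniteDimensional ℂ V]
  [LieRingModule L V] [LieModule ℂ L V]

/-- The representation conjugated by `z^(ρ^∨)`, `z = exp ζ`; it multiplies a component of principal
degree `d` by `z^d`. -/
def conjRep (ζ : ℂ) : L →ₗ[ℂ] V →L[ℂ] V :=
  LinearMap.mulLeftRight ℂ (expRho V b ζ, expRho V b (-ζ)) ∘ₗ rep L V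

/-- The gauge transformation `z^(ρ^∨) z^a`, `z = exp ζ`, which takes the Frobenius form
`z^(-ρ^∨) z^(-a) F` to `F`. -/
def gauge (a ζ : ℂ) : V →L[ℂ] V := NormedSpace.exp (ζ • (rep L V (rhoCheck b : L) + a • 1))

variable {b V}

lemma conjRep_of_mem_gradedPiece {μ : ℂ} {x : L} (hx : x ∈ gradedPiece b μ) (ζ : ℂ) :
    conjRep b V ζ x = Complex.exp (ζ * μ) • rep L V x := by
  change expRho V b ζ * rep L V x * expRho V b (-ζ) = _
  rw [expRho_mul_rep hx, smul_mul_assoc, mul_assoc, ← expRho_add, add_neg_cancel, expRho_zero,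
    mul_one]

lemma conjRep_mul_expRho (ζ : ℂ) (x : L) :
    conjRep b V ζ x * expRho V b ζ = expRho V b ζ * rep L V x := by
  change expRho V b ζ * rep L V x * expRho V b (-ζ) * _ = _
  rw [mul_assoc, ← expRho_add, neg_add_cancel, expRho_zero, mul_one]

lemma gauge_eq_exp_smul_expRho (a ζ : ℂ) :
    gauge b V a ζ = Complex.exp (a * ζ) • expRho V b ζ := by
  have : CompleteSpace V := FiniteDimensional.complete ℂ V
  let : NormedAlgebra ℚ (V →L[ℂ] V) := NormedAlgebra.restrictScalars ℚ ℂ _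
  have hcomm : Commute (ζ • rep L V (rhoCheck b : L)) ((a * ζ) • 1) :=
    (Commute.one_right _).smul_right _
  have hscalar : NormedSpace.exp ((a * ζ) • (1 : V →L[ℂ] V)) = Complex.exp (a * ζ) • 1 := by
    ext v
    exact exp_apply_of_apply_eq_smul rfl
  rw [gauge, smul_add, smul_smul, mul_comm ζ, NormedSpace.exp_add_of_commute hcomm, hscalar,
    mul_smul_comm, mul_one, expRho_eq]

lemma gauge_mul_rep (a ζ : ℂ) (x : L) :
    gauge b V a ζ * rep L V x = conjRep b V ζ x * gauge b V a ζ := by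
  rw [gauge_eq_exp_smul_expRho, smul_mul_assoc, mul_smul_comm, conjRep_mul_expRho]

lemma gauge_apply_gauge_neg_apply (a ζ : ℂ) (v : V) :
    gauge b V a ζ (gauge b V a (-ζ) v) = v := by
  have : CompleteSpace V := FiniteDimensional.complete ℂ V
  rw [gauge, gauge, neg_smul, ← smul_neg]
  exact exp_smul_apply_exp_neg_smul_apply (rep L V (rhoCheck b : L) + a • 1) ζ v

lemma gauge_neg_apply_gauge_apply (a ζ : ℂ) (v : V) :
    gauge b V a (-ζ) (gauge b V a ζ v) = v := by
  simpa only [neg_neg] using gauge_apply_gauge_neg_apply (b := b) a (-ζ) v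

lemma hasDerivAt_gauge (a ζ : ℂ) : HasDerivAt (gauge b V a)
    ((rep L V (rhoCheck b : L) + a • 1) * gauge b V a ζ) ζ := by
  have : CompleteSpace V := FiniteDimensional.complete ℂ V
  exact hasDerivAt_exp_smul_const' (𝕂 := ℂ) (rep L V (rhoCheck b : L) + a • 1) ζ

lemma hasDerivAt_gauge_neg (a ζ : ℂ) : HasDerivAt (fun ζ => gauge b V a (-ζ))
    (-(gauge b V a (-ζ) * (rep L V (rhoCheck b : L) + a • 1))) ζ := by
  have : CompleteSpace V := FiniteDimensional.complete ℂ V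
  have h : HasDerivAt (gauge b V a) (gauge b V a (-ζ) * (rep L V (rhoCheck b : L) + a • 1)) (-ζ) :=
    hasDerivAt_exp_smul_const (𝕂 := ℂ) (rep L V (rhoCheck b : L) + a • 1) (-ζ)
  have hneg := h.scomp ζ (hasDerivAt_neg ζ)
  rw [neg_smul, one_smul] at hneg
  exact hneg

lemma frobeniusForm_eq_gauge (k : ℝ) (a : ℂ) (F : ℂ × ℂ → V) (ζ lam : ℂ) :
    frobeniusForm b k a F (ζ, lam) =
      gauge b V a (-ζ) (F (Complex.exp ζ, lam * Complex.exp (-(k : ℂ) * ζ))) := by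
  rw [frobeniusForm, gauge_eq_exp_smul_expRho, map_smul, mul_neg, ← neg_mul]
  rfl

end Gauge

namespace OperData

variable {ι : Type*} [Fintype ι] [DecidableEq ι] {L : Type u} [LieRing L] [LieAlgebra ℂ L]
  {H : LieSubalgebra ℂ L} {b : LieAlgebra.Basis ι H} (D : OperData b)
  {V : Type v} [NormedAddCommGroup V] [NormedSpace ℂ V] [FiniteDimensional ℂ V]
  [LieRingModule L V] [LieModule ℂ L V]

section Spectrum

variable (V) in
/-- The residue `f - ρ^∨ + r̄ - a` at `z = 0` of the gauged equation. -/
def residue (a : ℂ) : V →L[ℂ] V := rep L V D.principalCoeff - a • 1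

lemma hasEigenvalue_residue {a ν : ℂ}
    (h : Module.End.HasEigenvalue (D.residue V a : V →ₗ[ℂ] V) ν) :
    Module.End.HasEigenvalue (LieModule.toEnd ℂ L V D.principalCoeff) (ν + a) := by
  obtain ⟨v, hv⟩ := h.exists_hasEigenvector
  have hQv : ⁅D.principalCoeff, v⁆ - a • v = ν • v := hv.apply_eq_smul
  exact Module.End.hasEigenvalue_of_hasEigenvector
    ⟨Module.End.mem_eigenspace_iff.2 ((sub_eq_iff_eq_add.1 hQv).trans (add_smul ν a v).symm), hv.2⟩

lemma residue_apply_eq_zero {a : ℂ} {χ₀ : V}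
    (h : Module.End.HasEigenvector (LieModule.toEnd ℂ L V D.principalCoeff) a χ₀) :
    D.residue V a χ₀ = 0 :=
  sub_eq_zero.2 h.apply_eq_smul

variable [FiniteDimensional ℂ L]

lemma exists_isWeight_of_hasEigenvalue {μ : ℂ}
    (hμ : Module.End.HasEigenvalue (LieModule.toEnd ℂ L V D.principalCoeff) μ) :
    Module.End.HasEigenvalue (LieModule.toEnd ℂ L V ((D.r - rhoCheck b : H) : L)) μ ∧
      ∃ ω : Module.Dual ℂ H, IsWeight H V ω ∧ ω (D.r - rhoCheck b) = μ := by
  have : IsLieAbelian H := b.isLieAbelian_cartan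
  have hf := hasEigenvalue_of_unipotentConj (V := V) D.rBar_conj hμ
  rw [sub_add_eq_add_sub, add_sub_assoc, ← AddSubgroupClass.coe_sub] at hf
  have hμ' := hasEigenvalue_of_principalF_add (D.r - rhoCheck b) hf
  exact ⟨hμ', exists_isWeight _ hμ'⟩

lemma nonResonant_residue (hgen : IsGeneric.{u, v} b D.r D.k) {i : ι}
    (hV : IsFundamentalModule b i V) (a : ℂ) : NonResonant (D.residue V a) D.k := by
  intro μ ν hμ hν m n h
  obtain ⟨hμ, ω, hω, hωμ⟩ := D.exists_isWeight_of_hasEigenvalue (D.hasEigenvalue_residue hμ)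
  obtain ⟨hν, ω', hω', hων⟩ := D.exists_isWeight_of_hasEigenvalue (D.hasEigenvalue_residue hν)
  have hμν := hgen i V hV ω' hω' _ (Module.End.hasEigenvalue_iff_mem_spectrum.1 hμ)
  have hνμ := hgen i V hV ω hω _ (Module.End.hasEigenvalue_iff_mem_spectrum.1 hν)
  rw [hων, add_sub_add_right_eq_sub] at hμν
  rw [hωμ, add_sub_add_right_eq_sub] at hνμ
  by_cases hk : Irrational D.k
  · by_contra hne
    refine hμν.1 hk m n (fun hmn => hne ?_) h
    obtain ⟨rfl, rfl⟩ := Prod.ext_iff.1 hmn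
    simpa [sub_eq_zero] using h
  · obtain ⟨c, hc⟩ := not_not.1 hk
    rw [← hc, Complex.ofReal_ratCast] at h
    exact eq_of_sub_eq_intCast_add_mul_ratCast h (hμν.2 c hc) (hνμ.2 c hc)

end Spectrum

section Coefficient

/-- The function `z^d s^d(z)`, which has no pole at `z = 0`. -/
def clearedSFun (d : ℕ) (z : ℂ) : L :=
  ∑ w ∈ D.sing, ∑ l ∈ Finset.range (d + 1), ((z - w) ^ (d + 1 - l))⁻¹ • D.s w d l

variable (V) in
/-- The part `S` of the gauged equation that is singular at the additional singular points. -/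
def polarPart (p : ZMod 2) (z : ℂ) : V →L[ℂ] V :=
  sgn p • ∑ d ∈ Finset.range (coxeterNumber b), rep L V (D.clearedSFun d (sgn p * z))

/-- The additional singular points `(-1)^p w` of `ℒ^{p/2}`. -/
def singImage (p : ZMod 2) : Finset ℂ := D.sing.image (sgn p * ·)

variable (V) in
/-- The coefficient of the equation obtained from `ℒ^{p/2} ψ = 0` by the gauge transformation
`z^(ρ^∨) z^a`. -/
def gaugedOper (a : ℂ) (p : ZMod 2) : ℂ → ℂ → V →L[ℂ] V :=
  gaugedCoeff (D.residue V a) (sgn p • rep L V D.eTheta) (D.polarPart V p) D.k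

lemma mem_singImage {p : ZMod 2} {z : ℂ} : z ∈ D.singImage p ↔ sgn p * z ∈ D.sing := by
  rw [singImage, Finset.mem_image]
  constructor
  · rintro ⟨w, hw, rfl⟩
    rwa [sgn_mul_sgn_mul]
  · exact fun h => ⟨_, h, sgn_mul_sgn_mul p z⟩

lemma mem_cover_iff {p : ZMod 2} {ζ : ℂ} : ζ ∈ D.cover p ↔ Complex.exp ζ ∉ D.singImage p :=
  not_congr D.mem_singImage.symm

lemma analyticOnNhd_polarPart (p : ZMod 2) :
    AnalyticOnNhd ℂ (D.polarPart V p) {z | z ∉ D.singImage p} := by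
  intro z hz
  refine AnalyticAt.fun_smul analyticAt_const (Finset.analyticAt_fun_sum _ fun d _ => ?_)
  simp only [clearedSFun, map_sum, map_smul]
  refine Finset.analyticAt_fun_sum _ fun w hw => Finset.analyticAt_fun_sum _ fun l _ => ?_
  refine AnalyticAt.fun_smul (AnalyticAt.fun_inv (by fun_prop) ?_) analyticAt_const
  refine pow_ne_zero _ fun h => hz (D.mem_singImage.2 ?_)
  rwa [sub_eq_zero.1 h]

lemma mem_gradedPiece_of_mem_principalDegree {d : ℕ} {x : L} (hx : x ∈ principalDegree b d) :
    x ∈ gradedPiece b d := by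
  rwa [principalDegree_eq, Int.cast_natCast] at hx

lemma clearedSFun_mem_gradedPiece (d : ℕ) (z : ℂ) : D.clearedSFun d z ∈ gradedPiece b d :=
  sum_mem fun w _ => sum_mem fun l _ =>
    Submodule.smul_mem _ _ (mem_gradedPiece_of_mem_principalDegree (D.s_mem w d l).2)

lemma rBar_mem_gradedPiece (d : ℕ) : D.rBar d ∈ gradedPiece b d :=
  mem_gradedPiece_of_mem_principalDegree (D.rBar_mem d).2

lemma eTheta_mem_gradedPiece [FiniteDimensional ℂ L] [LieAlgebra.IsSimple ℂ L] :
    D.eTheta ∈ gradedPiece b (coxeterNumber b - 1) := by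
  simpa only [principalDegree_eq, Int.cast_sub, Int.cast_natCast, Int.cast_one] using
    singularSpace_le b ((mem_singularSpace b).2 D.isHighestRootVector.2)

variable (V)

lemma exp_smul_conjRep_principalF (ζ : ℂ) :
    Complex.exp ζ • conjRep b V ζ (principalF b) = rep L V (principalF b) := by
  rw [conjRep_of_mem_gradedPiece (principalF_mem_gradedPiece b), smul_smul, ← Complex.exp_add,
    mul_neg_one, add_neg_cancel, Complex.exp_zero, one_smul]

lemma exp_smul_conjRep_rBar (d : ℕ) (ζ : ℂ) :
    Complex.exp ζ • Complex.exp (-((d : ℂ) + 1) * ζ) • conjRep b V ζ (D.rBar d) =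
      rep L V (D.rBar d) := by
  have hexp : Complex.exp ζ * (Complex.exp (-((d : ℂ) + 1) * ζ) * Complex.exp (ζ * d)) = 1 := by
    rw [← Complex.exp_add, ← Complex.exp_add, Complex.exp_eq_one_iff]
    exact ⟨0, by push_cast; ring⟩
  rw [conjRep_of_mem_gradedPiece (D.rBar_mem_gradedPiece d), smul_smul, smul_smul, mul_assoc, hexp,
    one_smul]

lemma exp_smul_conjRep_eTheta [FiniteDimensional ℂ L] [LieAlgebra.IsSimple ℂ L] (ζ : ℂ) :
    Complex.exp ((1 - (coxeterNumber b : ℂ)) * ζ) • conjRep b V ζ D.eTheta =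
      rep L V D.eTheta := by
  have hexp : Complex.exp ((1 - (coxeterNumber b : ℂ)) * ζ) *
      Complex.exp (ζ * (coxeterNumber b - 1)) = 1 := by
    rw [← Complex.exp_add, Complex.exp_eq_one_iff]
    exact ⟨0, by push_cast; ring⟩
  rw [conjRep_of_mem_gradedPiece D.eTheta_mem_gradedPiece, smul_smul, hexp, one_smul]

lemma sgn_pow_smul_conjRep_sFun (p : ZMod 2) (d : ℕ) (ζ : ℂ) :
    sgn p ^ (d + 1) • conjRep b V ζ (D.sFun d (sgn p * Complex.exp ζ)) =
      sgn p • rep L V (D.clearedSFun d (sgn p * Complex.exp ζ)) := by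
  have hsgn := sgn_ne_zero p
  have hexp := Complex.exp_ne_zero ζ
  have hs (z : ℂ) : D.sFun d z = (z ^ d)⁻¹ • D.clearedSFun d z := rfl
  have hcancel : sgn p ^ (d + 1) * (((sgn p * Complex.exp ζ) ^ d)⁻¹ * Complex.exp ζ ^ d) =
      sgn p := by
    rw [mul_pow]
    field_simp
    exact pow_succ _ _
  rw [hs, map_smul, conjRep_of_mem_gradedPiece (D.clearedSFun_mem_gradedPiece d _), mul_comm ζ,
    Complex.exp_nat_mul, smul_smul, smul_smul, mul_assoc, hcancel]

variable [FiniteDimensional ℂ L] [LieAlgebra.IsSimple ℂ L]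

lemma exp_smul_conjRep_coeff (a : ℂ) (p : ZMod 2) (ζ lam : ℂ) :
    Complex.exp ζ • conjRep b V ζ (D.coeff p ζ lam) =
      rep L V (rhoCheck b : L) + a • 1 - D.gaugedOper V a p lam ζ := by
  have hθ := D.exp_smul_conjRep_eTheta V ζ
  have hcomm (x y : ℂ) (A : V →L[ℂ] V) : (sgn p * x * y) • A = y • sgn p • x • A := by
    module
  simp only [coeff, map_add, map_sum, map_smul, smul_add, Finset.smul_sum, hcomm, hθ,
    exp_smul_conjRep_principalF, exp_smul_conjRep_rBar, sgn_pow_smul_conjRep_sFun, gaugedOper,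
    gaugedCoeff, residue, principalCoeff, polarPart, map_sub]
  abel

variable {V}

lemma exp_smul_gauge_apply_lie_coeff (a : ℂ) (p : ZMod 2) (ζ lam : ℂ) (v : V) :
    Complex.exp ζ • gauge b V a ζ ⁅D.coeff p ζ lam, v⁆ =
      (rep L V (rhoCheck b : L) + a • 1 - D.gaugedOper V a p lam ζ) (gauge b V a ζ v) := by
  rw [← D.exp_smul_conjRep_coeff, ← rep_apply, ← mul_clm_apply, gauge_mul_rep]
  rfl

end Coefficient

section Solution

variable [FiniteDimensional ℂ L] [LieAlgebra.IsSimple ℂ L] {a lam ζ : ℂ} {p : ZMod 2}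

variable {D} in
lemma SolvesAt.hasDerivAt_gauge {ψ : ℂ → V} (h : D.SolvesAt p lam ψ ζ) :
    HasDerivAt (fun ζ => gauge b V a ζ (ψ ζ))
      (D.gaugedOper V a p lam ζ (gauge b V a ζ (ψ ζ))) ζ := by
  convert! (KdVOper.hasDerivAt_gauge a ζ).clm_apply h using 1
  rw [map_neg, map_smul, D.exp_smul_gauge_apply_lie_coeff, mul_clm_apply, _root_.sub_apply]
  abel

lemma solvesAt_gauge_neg {φ : ℂ → V} (h : HasDerivAt φ (D.gaugedOper V a p lam ζ (φ ζ)) ζ) :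
    D.SolvesAt p lam (fun ζ => gauge b V a (-ζ) (φ ζ)) ζ := by
  have hcoeff := congrArg (gauge b V a (-ζ))
    (D.exp_smul_gauge_apply_lie_coeff a p ζ lam (gauge b V a (-ζ) (φ ζ)))
  rw [map_smul, gauge_neg_apply_gauge_apply, gauge_apply_gauge_neg_apply] at hcoeff
  rw [SolvesAt, hcoeff]
  convert! (hasDerivAt_gauge_neg a ζ).clm_apply h using 1
  rw [_root_.neg_apply, mul_clm_apply, _root_.sub_apply, map_sub]
  abel

end Solution

end OperData

lemma mul_exp_mul_exp_add (k lam ζ s : ℂ) :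
    lam * Complex.exp (k * s) * Complex.exp (-k * (ζ + s)) = lam * Complex.exp (-k * ζ) := by
  rw [mul_assoc, ← Complex.exp_add]
  ring_nf

lemma tendsto_comap_re_atBot_add {s : ℂ} (hs : s.re = 0) :
    Tendsto (· + s) (comap Complex.re atBot) (comap Complex.re atBot) :=
  tendsto_comap_iff.2 (tendsto_comap.congr fun ζ => by simp [hs])

section Solutions

variable {ι : Type*} [Fintype ι] [DecidableEq ι] {L : Type u} [LieRing L] [LieAlgebra ℂ L]
  {H : LieSubalgebra ℂ L} {b : LieAlgebra.Basis ι H}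
  {V : Type v} [NormedAddCommGroup V] [NormedSpace ℂ V] [FiniteDimensional ℂ V]
  [LieRingModule L V] [LieModule ℂ L V]

lemma IsFrobeniusExpansion.eventually_gauge_eq {k : ℝ} {a : ℂ} {χ₀ : V} {χ F : ℂ × ℂ → V}
    (hF : IsFrobeniusExpansion b k a χ₀ χ F) :
    ∀ᶠ ζ in comap Complex.re atBot, ∀ lam,
      gauge b V a ζ (χ (ζ, lam)) =
        F (Complex.exp ζ, lam * Complex.exp (-(k : ℂ) * ζ)) := by
  obtain ⟨-, ⟨R, hR, hform⟩, -⟩ := hF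
  filter_upwards [Complex.tendsto_exp_comap_re_atBot.eventually_mem (Metric.ball_mem_nhds 0 hR)]
    with ζ hζ lam
  rw [hform ζ lam (mem_ball_zero_iff.1 hζ), frobeniusForm_eq_gauge, gauge_apply_gauge_neg_apply]

namespace OperData

variable (D : OperData b)

lemma gaugedOper_add_shift (a : ℂ) (p : ZMod 2) {s : ℂ} (hs : Complex.exp s = sgn p)
    (lam ζ : ℂ) :
    D.gaugedOper V a 0 (lam * Complex.exp (D.k * s)) (ζ + s) = D.gaugedOper V a p lam ζ := by
  have hexp : Complex.exp (ζ + s) = sgn p * Complex.exp ζ := by rw [Complex.exp_add, hs, mul_comm]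
  rw [gaugedOper, gaugedOper, gaugedCoeff, gaugedCoeff, hexp, mul_exp_mul_exp_add, polarPart,
    polarPart, sgn_zero]
  simp only [one_smul, one_mul]
  module

section Form

variable {a : ℂ} {p : ZMod 2} {F : ℂ × ℂ → V}

lemma analyticOnNhd_frobeniusForm
    (hF : AnalyticOnNhd ℂ F ({z | z ∉ D.singImage p} ×ˢ Set.univ)) :
    AnalyticOnNhd ℂ (frobeniusForm b D.k a F) (D.cover p ×ˢ Set.univ) := by
  rintro ⟨ζ, lam⟩ ⟨hζ, -⟩
  let curve (x : ℂ × ℂ) : ℂ × ℂ := (Complex.exp x.1, x.2 * Complex.exp (-(D.k : ℂ) * x.1))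
  have hcurve : AnalyticAt ℂ curve (ζ, lam) :=
    analyticAt_fst.cexp.prod (analyticAt_snd.mul (analyticAt_const.mul analyticAt_fst).cexp)
  have hmem : curve (ζ, lam) ∈ {z | z ∉ D.singImage p} ×ˢ (Set.univ : Set ℂ) :=
    ⟨D.mem_cover_iff.1 hζ, trivial⟩
  have hgauge : Differentiable ℂ fun ζ : ℂ => gauge b V a (-ζ) := fun ζ =>
    (hasDerivAt_gauge_neg (b := b) (V := V) a ζ).differentiableAt
  have hgauge_fst : AnalyticAt ℂ (fun x : ℂ × ℂ => gauge b V a (-x.1)) (ζ, lam) :=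
    AnalyticAt.fun_comp (g := fun ζ => gauge b V a (-ζ)) (f := Prod.fst) (x := (ζ, lam))
      (hgauge.analyticAt ζ) analyticAt_fst
  have hF_curve : AnalyticAt ℂ (fun x => F (curve x)) (ζ, lam) :=
    AnalyticAt.fun_comp (hF (curve (ζ, lam)) hmem) hcurve
  have hform : frobeniusForm b D.k a F = fun x => gauge b V a (-x.1) (F (curve x)) :=
    funext fun x => frobeniusForm_eq_gauge D.k a F x.1 x.2
  rw [hform]
  exact analyticAt_clm_apply hgauge_fst hF_curve

lemma monodromy_frobeniusForm (x : ℂ × ℂ) :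
    monodromy b D.k (frobeniusForm b D.k a F) x =
      Complex.exp (-(2 * Real.pi * Complex.I * a)) • frobeniusForm b D.k a F x := by
  obtain ⟨ζ, lam⟩ := x
  have hexpRho (v : V) : expRho V b (2 * Real.pi * Complex.I)
      (expRho V b (-(ζ + 2 * Real.pi * Complex.I)) v) = expRho V b (-ζ) v := by
    rw [← mul_clm_apply, ← expRho_add]
    ring_nf
  have hexp : Complex.exp (-a * (ζ + 2 * Real.pi * Complex.I)) =
      Complex.exp (-(2 * Real.pi * Complex.I * a)) * Complex.exp (-a * ζ) := by
    rw [← Complex.exp_add]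
    ring_nf
  simp only [monodromy, frobeniusForm]
  rw [mul_comm _ lam, mul_comm _ (D.k : ℂ), mul_exp_mul_exp_add, hexpRho, Complex.exp_periodic ζ,
    hexp, ← smul_smul, map_smul]

variable {D}

lemma differentiable_gauge {χ : ℂ × ℂ → V} (hχ : χ ∈ D.solutions V p) (a : ℂ) {ζ : ℂ}
    (hζ : ζ ∈ D.cover p) : Differentiable ℂ fun lam => gauge b V a ζ (χ (ζ, lam)) := by
  intro lam
  have hcurve : DifferentiableAt ℂ (fun lam : ℂ => (ζ, lam)) lam :=
    (differentiableAt_const ζ).prodMk differentiableAt_id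
  have hχζ := (hχ.1 (ζ, lam) ⟨hζ, trivial⟩).differentiableAt.comp lam hcurve
  exact (differentiableAt_const _).clm_apply hχζ

end Form

variable [FiniteDimensional ℂ L] [LieAlgebra.IsSimple ℂ L]

lemma isSolvableOn_gaugedOper (hmon : TrivialMonodromy.{u, v} D) (a : ℂ) (p : ZMod 2) (lam : ℂ)
    {ζ₀ : ℂ} (hζ₀ : Complex.exp ζ₀ ∈ D.singImage p) :
    ∃ ε > 0, IsSolvableOn (D.gaugedOper V a p lam) (Metric.ball ζ₀ ε \ {ζ₀}) := by
  obtain ⟨s, hs⟩ : ∃ s, Complex.exp s = sgn p := ⟨_, Complex.exp_log (sgn_ne_zero p)⟩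
  have hmem : Complex.exp (ζ₀ + s) ∈ D.sing := by
    rwa [Complex.exp_add, hs, mul_comm, ← mem_singImage]
  obtain ⟨ε, hε, h⟩ := hmon V (lam * Complex.exp (D.k * s)) (ζ₀ + s) hmem
  have hball : ∀ ζ ∈ Metric.ball ζ₀ ε \ {ζ₀}, ζ + s ∈ Metric.ball (ζ₀ + s) ε \ {ζ₀ + s} :=
    fun ζ hζ => ⟨by simpa using hζ.1, by simpa using hζ.2⟩
  refine ⟨ε, hε, fun ζ₁ hζ₁ w => ?_⟩
  obtain ⟨ψ, hψ_init, hψ⟩ := h (ζ₁ + s) (hball ζ₁ hζ₁) (gauge b V a (-(ζ₁ + s)) w)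
  refine ⟨fun ζ => gauge b V a (ζ + s) (ψ (ζ + s)), ?_, fun ζ hζ => ?_⟩
  · exact (congrArg _ hψ_init).trans (gauge_apply_gauge_neg_apply a (ζ₁ + s) w)
  · have hderiv := (SolvesAt.hasDerivAt_gauge (a := a) (hψ _ (hball ζ hζ))).comp_add_const
    rwa [D.gaugedOper_add_shift a p hs] at hderiv

/-- The equation obtained from `ℒ^{p/2} ψ = 0` by the gauge transformation `z^(ρ^∨) z^a`. -/
def gaugedSystem (hmon : TrivialMonodromy.{u, v} D) (a : ℂ)
    (hQ : NonResonant (D.residue V a) D.k) (p : ZMod 2) : GaugedSystem V where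
  Q := D.residue V a
  E := sgn p • rep L V D.eTheta
  S := D.polarPart V p
  k := D.k
  sing := D.singImage p
  k_lt_one := D.k_lt_one
  zero_notMem := by rw [mem_singImage, mul_zero]; exact D.zero_notMem
  analytic := D.analyticOnNhd_polarPart p
  nonResonant := hQ
  trivialMonodromy := fun lam _ hζ₀ => D.isSolvableOn_gaugedOper hmon a p lam hζ₀

variable {a : ℂ} {p : ZMod 2}

lemma frobeniusForm_mem_solutions {F : ℂ × ℂ → V}
    (hF : AnalyticOnNhd ℂ F ({z | z ∉ D.singImage p} ×ˢ Set.univ))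
    (hsol : ∀ lam, IsSolution (D.gaugedOper V a p lam)
      (fun ζ => F (Complex.exp ζ, lam * Complex.exp (-(D.k : ℂ) * ζ)))
      {ζ | Complex.exp ζ ∉ D.singImage p}) :
    frobeniusForm b D.k a F ∈ D.solutions V p := by
  refine ⟨D.analyticOnNhd_frobeniusForm hF, fun ζ hζ lam => ?_⟩
  simp only [frobeniusForm_eq_gauge]
  exact D.solvesAt_gauge_neg (hsol lam ζ (D.mem_cover_iff.1 hζ))

variable {D} in
lemma isSolution_gauge {χ : ℂ × ℂ → V} (hχ : χ ∈ D.solutions V p) (a lam : ℂ) :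
    IsSolution (D.gaugedOper V a p lam) (fun ζ => gauge b V a ζ (χ (ζ, lam)))
      {ζ | Complex.exp ζ ∉ D.singImage p} :=
  fun ζ hζ => SolvesAt.hasDerivAt_gauge (hχ.2 ζ (D.mem_cover_iff.2 hζ) lam)

lemma eqOn_of_isFrobeniusExpansion (hmon : TrivialMonodromy.{u, v} D)
    (hQ : NonResonant (D.residue V a) D.k) {χ₀ : V} (hχ₀ : D.residue V a χ₀ = 0) (hne : χ₀ ≠ 0)
    {χ χ' : ℂ × ℂ → V} (hχ : χ ∈ D.solutions V p) (hχ' : χ' ∈ D.solutions V p)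
    {F F' : ℂ × ℂ → V} (hF : IsFrobeniusExpansion b D.k a χ₀ χ F)
    (hF' : IsFrobeniusExpansion b D.k a χ₀ χ' F') :
    Set.EqOn χ' χ (D.cover p ×ˢ Set.univ) := by
  let φ (lam ζ : ℂ) : V := gauge b V a ζ (χ' (ζ, lam)) - gauge b V a ζ (χ (ζ, lam))
  let curve (lam ζ : ℂ) : ℂ × ℂ := (Complex.exp ζ, lam * Complex.exp (-(D.k : ℂ) * ζ))
  have hφF : ∀ᶠ ζ in comap Complex.re atBot, ∀ lam,
      φ lam ζ = F' (curve lam ζ) - F (curve lam ζ) := by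
    filter_upwards [hF.eventually_gauge_eq, hF'.eventually_gauge_eq] with ζ hζ hζ' lam
    exact congrArg₂ _ (hζ' lam) (hζ lam)
  have heigen : Module.End.HasEigenvalue (D.residue V a : V →ₗ[ℂ] V) 0 :=
    Module.End.hasEigenvalue_of_hasEigenvector (x := χ₀)
      ⟨Module.End.mem_eigenspace_iff.2 (hχ₀.trans (zero_smul ℂ _).symm), hne⟩
  have hperiodic (lam : ℂ) : ∀ᶠ ζ in comap Complex.re atBot,
      φ (lam * Complex.exp (D.k * (2 * Real.pi * Complex.I))) (ζ + 2 * Real.pi * Complex.I) =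
        φ lam ζ := by
    have htranslate :=
      (tendsto_comap_re_atBot_add (s := 2 * Real.pi * Complex.I) (by simp)).eventually hφF
    filter_upwards [hφF, htranslate] with ζ hζ hζ_translate
    rw [hζ, hζ_translate]
    simp only [curve, mul_exp_mul_exp_add, Complex.exp_periodic ζ]
  have hlim (lam : ℂ) : Tendsto (φ lam) (comap Complex.re atBot) (𝓝 0) := by
    rw [← sub_self χ₀]
    exact ((hF'.2.2 lam).sub (hF.2.2 lam)).congr' (hφF.mono fun ζ hζ => (hζ lam).symm)
  rintro ⟨ζ, lam⟩ ⟨hζ, -⟩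
  have hφ := (D.gaugedSystem hmon a hQ p).eq_zero_of_tendsto_zero heigen (φ := φ)
    (fun lam => (isSolution_gauge hχ' a lam).sub (isSolution_gauge hχ a lam))
    (fun ζ hζ => (differentiable_gauge hχ' a (D.mem_cover_iff.2 hζ)).sub
      (differentiable_gauge hχ a (D.mem_cover_iff.2 hζ)))
    hperiodic hlim lam (D.mem_cover_iff.1 hζ)
  have hχ_eq := congrArg (gauge b V a (-ζ)) (sub_eq_zero.1 hφ)
  rwa [gauge_neg_apply_gauge_apply, gauge_neg_apply_gauge_apply] at hχ_eq

end OperData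

end Solutions

end KdVOper

end

open KdVOper in
theorem mainTheorem10_general {ι : Type*} [Fintype ι] [DecidableEq ι]
    {L : Type u} [LieRing L] [LieAlgebra ℂ L] [FiniteDimensional ℂ L] [LieAlgebra.IsSimple ℂ L]
    {H : LieSubalgebra ℂ L} {b : LieAlgebra.Basis ι H} (D : OperData b)
    (hmon : OperData.TrivialMonodromy.{u, v} D) (hgen : IsGeneric.{u, v} b D.r D.k) (p : ZMod 2)
    {i : ι} {V : Type v} [NormedAddCommGroup V] [NormedSpace ℂ V] [FiniteDimensional ℂ V]
    [LieRingModule L V] [LieModule ℂ L V] (hV : IsFundamentalModule b i V) (a : ℂ) (χ₀ : V)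
    (hχ₀ : Module.End.HasEigenvector (LieModule.toEnd ℂ L V D.principalCoeff) a χ₀) :
    ∃ χ ∈ D.solutions V p,
      (∃ F : ℂ × ℂ → V,
        IsFrobeniusExpansion b D.k a χ₀ χ F ∧
        AnalyticOnNhd ℂ F ({z | sgn p * z ∉ D.sing} ×ˢ Set.univ) ∧
        Set.EqOn χ (frobeniusForm b D.k a F) (D.cover p ×ˢ Set.univ)) ∧
      (∀ χ' ∈ D.solutions V p,
        (∃ F' : ℂ × ℂ → V, IsFrobeniusExpansion b D.k a χ₀ χ' F') →
        Set.EqOn χ' χ (D.cover p ×ˢ Set.univ)) ∧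
      Set.EqOn (monodromy b D.k χ)
        (fun x => Complex.exp (-(2 * Real.pi * Complex.I * a)) • χ x) (D.cover p ×ˢ Set.univ) := by
  have hQ := D.nonResonant_residue hgen hV a
  have hQχ₀ := D.residue_apply_eq_zero hχ₀
  let G := D.gaugedSystem hmon a hQ p
  obtain ⟨F, hF, hsol, hlim⟩ := G.exists_regular_solution hQχ₀
  have hsing : {z | sgn p * z ∉ D.sing} = {z | z ∉ D.singImage p} :=
    Set.ext fun z => not_congr D.mem_singImage.symm
  have hχ := D.frobeniusForm_mem_solutions hF hsol
  have hexpansion : IsFrobeniusExpansion b D.k a χ₀ (frobeniusForm b D.k a F) F :=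
    ⟨hF _ ⟨G.zero_notMem, trivial⟩, ⟨1, one_pos, fun _ _ _ => rfl⟩, hlim⟩
  refine ⟨_, hχ, ⟨F, hexpansion, hsing ▸ hF, fun _ _ => rfl⟩, ?_,
    fun x _ => D.monodromy_frobeniusForm x⟩
  rintro χ' hχ' ⟨F', hF'⟩
  exact D.eqOn_of_isFrobeniusExpansion hmon hQ hQχ₀ hχ₀.2 hχ hχ' hexpansion hF'

theorem mainTheorem10 {ι : Type*} [Fintype ι] [DecidableEq ι]
    {L : Type u} [LieRing L] [LieAlgebra ℂ L] [FiniteDimensional ℂ L] [LieAlgebra.IsSimple ℂ L]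
    {H : LieSubalgebra ℂ L} (b : LieAlgebra.Basis ι H) (hA : b.A.IsSimplyLaced)
    (D : KdVOper.OperData b) (hmon : KdVOper.OperData.TrivialMonodromy.{u, v} D)
    (hgen : KdVOper.IsGeneric.{u, v} b D.r D.k)
    (p : ι → ZMod 2) (hp : ∀ i j, b.A i j < 0 → p j = p i + 1)
    (i : ι) {V : Type v} [NormedAddCommGroup V] [NormedSpace ℂ V] [FiniteDimensional ℂ V]
    [LieRingModule L V] [LieModule ℂ L V] (hV : KdVOper.IsFundamentalModule b i V)
    (ω : Module.Dual ℂ H) (hω : KdVOper.IsWeight H V ω) (χ₀ : V)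
    (hχ₀ : Module.End.HasEigenvector (LieModule.toEnd ℂ L V D.principalCoeff)
      (ω (D.r - KdVOper.rhoCheck b)) χ₀) :
    ∃ χ ∈ D.solutions V (p i),
      (∃ F : ℂ × ℂ → V,
        KdVOper.IsFrobeniusExpansion b D.k (ω (D.r - KdVOper.rhoCheck b)) χ₀ χ F ∧
        AnalyticOnNhd ℂ F ({z | KdVOper.sgn (p i) * z ∉ D.sing} ×ˢ Set.univ) ∧
        Set.EqOn χ (KdVOper.frobeniusForm b D.k (ω (D.r - KdVOper.rhoCheck b)) F)
          (D.cover (p i) ×ˢ Set.univ)) ∧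
      (∀ χ' ∈ D.solutions V (p i),
        (∃ F' : ℂ × ℂ → V,
          KdVOper.IsFrobeniusExpansion b D.k (ω (D.r - KdVOper.rhoCheck b)) χ₀ χ' F') →
        Set.EqOn χ' χ (D.cover (p i) ×ˢ Set.univ)) ∧
      Set.EqOn (KdVOper.monodromy b D.k χ)
        (fun x => Complex.exp (-(2 * Real.pi * Complex.I * ω (D.r - KdVOper.rhoCheck b))) • χ x)
        (D.cover (p i) ×ˢ Set.univ) :=
  mainTheorem10_general D hmon hgen (p i) hV _ χ₀ hχ₀
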